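/- Let $k$ be a field of characteristic not $2$ with algebraic closure $K$. For $R=k,K$ let $C_R=M_2(R)\oplus M_2(R)$ be the split octonion algebra over $R$, with product $(x,y)(u,v)=(xu+\bar v y,\;vx+y\bar u)$, where $\overline{\begin{pmatrix}a&b\\c&d\end{pmatrix}}=\begin{pmatrix}d&-b\\-c&a\end{pmatrix}$. Let $G=\mathrm{Aut}(C_K)\subset \mathrm{GL}_8(K)$, matrices being written in the ordered basis $(E_{11},0),(E_{12},0),(E_{21},0),(E_{22},0),(0,E_{11}),(0,E_{12}),(0,E_{21}),(0,E_{22})$; its $k$-structure $k[G]$ is the $k$-algebra of functions on $G$ generated by the matrix entries and the inverse of the determinant, and $G_k$ is the subgroup of elements with all matrix entries in $k$. A $k$-involution of $G$ is an automorphism $\theta$ of the algebraic group $G$ of order exactly $2$ that is defined over $k$, i.e. $f\circ\theta\in k[G]$ for all $f\in k[G]$. Two $k$-involutions $\theta,\varphi$ lie in the same isomorphy class if $\varphi=\mathcal I_g\,\theta\,\mathcal I_g^{-1}$ for some $g\in G_k$, where $\mathcal I_g(x)=gxg^{-1}$. Let $s=J\oplus J\in G$, where $J$ is the $4\times4$ matrix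 with ones on the antidiagonal and zeros elsewhere, let $t_{(1,-1)}=\mathrm{diag}(1,-1,-1,1,-1,1,1,-1)\in G$, and put $\theta=\mathcal I_s$. **Theorem.** 1. If $k=\mathbb R$, $\mathbb Q$ or $\mathbb Q_2$, then $\theta$ and $\theta\circ\mathcal I_{t_{(1,-1)}}$ are $k$-involutions of $G$ lying in two distinct isomorphy classes. If $k=\mathbb R$ or $k=\mathbb Q_2$, these are the only isomorphy classes of $k$-involutions of $G$; if $k=\mathbb Q$, there is at least one further isomorphy class. 2. If $k=\mathbb Q_p$ with $p>2$ prime, there are exactly two isomorphy classes of $k$-involutions of $G$. 3. If $k=\mathbb C$, or $k=\mathbb F_p$ with $p>2$ prime, there is exactly one isomorphy class of $k$-involutions of $G$. -/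

import Mathlib

/-- The bar involution of the quaternion algebra `M₂(R)`. It is the adjugate:
`(x₁₁, x₁₂; x₂₁, x₂₂) ↦ (x₂₂, -x₁₂; -x₂₁, x₁₁)`. -/
def quatBar {R : Type*} [CommRing R] (x : Matrix (Fin 2) (Fin 2) R) :
    Matrix (Fin 2) (Fin 2) R :=
  !![x 1 1, -x 0 1; -x 1 0, x 0 0]

theorem quatBar_apply {R : Type*} [CommRing R] (x : Matrix (Fin 2) (Fin 2) R) :
    quatBar x 0 0 = x 1 1 ∧ quatBar x 0 1 = -x 0 1 ∧ quatBar x 1 0 = -x 1 0 ∧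
      quatBar x 1 1 = x 0 0 :=
  ⟨rfl, rfl, rfl, rfl⟩

/-- The split octonion algebra over `R`: pairs `(x, y)` of `2 × 2` matrices, with the
Cayley-Dickson product (parameter `1`) defined below. -/
@[ext]
structure SplitOctonion (R : Type*) where
  fst : Matrix (Fin 2) (Fin 2) R
  snd : Matrix (Fin 2) (Fin 2) R

namespace SplitOctonion

def equivProd (R : Type*) :
    SplitOctonion R ≃ Matrix (Fin 2) (Fin 2) R × Matrix (Fin 2) (Fin 2) R where
  toFun a := (a.fst, a.snd)
  invFun p := ⟨p.1, p.2⟩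
  left_inv _ := rfl
  right_inv _ := rfl

instance (R : Type*) [CommRing R] : AddCommGroup (SplitOctonion R) := (equivProd R).addCommGroup

instance (R : Type*) [CommRing R] : Module R (SplitOctonion R) := (equivProd R).module R

/-- `(x, y)(u, v) = (x u + v̄ y, v x + y ū)`. -/
instance (R : Type*) [CommRing R] : Mul (SplitOctonion R) :=
  ⟨fun a b => ⟨a.fst * b.fst + quatBar b.snd * a.snd, b.snd * a.fst + a.snd * quatBar b.fst⟩⟩

theorem fst_add {R : Type*} [CommRing R] (a b : SplitOctonion R) :
    (a + b).fst = a.fst + b.fst := rfl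

theorem snd_add {R : Type*} [CommRing R] (a b : SplitOctonion R) :
    (a + b).snd = a.snd + b.snd := rfl

theorem fst_smul {R : Type*} [CommRing R] (r : R) (a : SplitOctonion R) :
    (r • a).fst = r • a.fst := rfl

theorem snd_smul {R : Type*} [CommRing R] (r : R) (a : SplitOctonion R) :
    (r • a).snd = r • a.snd := rfl

theorem fst_mul {R : Type*} [CommRing R] (a b : SplitOctonion R) :
    (a * b).fst = a.fst * b.fst + quatBar b.snd * a.snd := rfl

theorem snd_mul {R : Type*} [CommRing R] (a b : SplitOctonion R) :
    (a * b).snd = b.snd * a.fst + a.snd * quatBar b.fst := rfl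

def linearEquivProd (R : Type*) [CommRing R] :
    SplitOctonion R ≃ₗ[R] Matrix (Fin 2) (Fin 2) R × Matrix (Fin 2) (Fin 2) R :=
  { equivProd R with
    map_add' := fun _ _ => rfl
    map_smul' := fun _ _ => rfl }

/-- The standard basis `(E_ij, 0)`, `(0, E_ij)`. -/
noncomputable def stdBasis (R : Type*) [CommRing R] :
    Module.Basis ((Fin 2 × Fin 2) ⊕ (Fin 2 × Fin 2)) R (SplitOctonion R) :=
  ((Matrix.stdBasis R (Fin 2) (Fin 2)).prod (Matrix.stdBasis R (Fin 2) (Fin 2))).map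
    (linearEquivProd R).symm

/-- `Aut(C)`: the group of multiplicative linear bijections of the split octonion algebra. -/
def autGroup (K : Type*) [Field K] : Subgroup (SplitOctonion K ≃ₗ[K] SplitOctonion K) where
  carrier := {g | ∀ a b, g (a * b) = g a * g b}
  one_mem' := fun _ _ => rfl
  mul_mem' := fun {g h} hg hh a b => by
    simp only [Set.mem_ofPred_eq] at hg hh
    rw [LinearEquiv.mul_apply, hh, hg]; rfl
  inv_mem' := fun {g} hg a b => by
    simp only [Set.mem_ofPred_eq] at hg
    apply g.injective
    rw [hg]
    exact (g.apply_symm_apply (a * b)).trans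
      (congrArg₂ (· * ·) (g.apply_symm_apply a).symm (g.apply_symm_apply b).symm)

/-- The linear map of `C` that is multiplication by `c i j` on `(E_ij, 0)` and by `d i j` on
`(0, E_ij)`. -/
def diagMap {K : Type*} [Field K] (c d : Fin 2 → Fin 2 → Kˣ) :
    SplitOctonion K ≃ₗ[K] SplitOctonion K where
  toFun a := ⟨Matrix.of fun i j => (c i j : K) * a.fst i j,
    Matrix.of fun i j => (d i j : K) * a.snd i j⟩
  invFun a := ⟨Matrix.of fun i j => ((c i j)⁻¹ : Kˣ) * a.fst i j,
    Matrix.of fun i j => ((d i j)⁻¹ : Kˣ) * a.snd i j⟩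
  map_add' a b := by
    ext i j <;> simp only [fst_add, snd_add, Matrix.of_apply, Matrix.add_apply] <;> ring
  map_smul' r a := by
    ext i j <;> simp only [fst_smul, snd_smul, Matrix.of_apply, Matrix.smul_apply, smul_eq_mul,
      RingHom.id_apply] <;> ring
  left_inv a := by
    ext i j <;> simp
  right_inv a := by
    ext i j <;> simp

/-- The element `t_(β,γ) = diag(1, βγ, β⁻¹γ⁻¹, 1, γ⁻¹, β, β⁻¹, γ)` of the split maximal torus,
written in the basis `(E₁₁,0), (E₁₂,0), (E₂₁,0), (E₂₂,0), (0,E₁₁), (0,E₁₂), (0,E₂₁), (0,E₂₂)`. -/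
def torusElt {K : Type*} [Field K] (β γ : Kˣ) : autGroup K where
  val := diagMap ![![1, β * γ], ![β⁻¹ * γ⁻¹, 1]] ![![γ⁻¹, β], ![β⁻¹, γ]]
  property := by
    intro a b
    have hβ := β.ne_zero
    have hγ := γ.ne_zero
    ext i j <;> fin_cases i <;> fin_cases j <;>
      simp [diagMap, quatBar_apply, Matrix.mul_apply, Fin.sum_univ_two, fst_mul, snd_mul] <;>
      field_simp

/-- The linear map reversing the order of the basis in each of the two blocks:
`(E_ij, 0) ↦ (E_{3-i,3-j}, 0)` and `(0, E_ij) ↦ (0, E_{3-i,3-j})`, that is the matrix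
`antidiag(1,1,1,1) ⊕ antidiag(1,1,1,1)`. -/
def revMap (K : Type*) [Field K] : SplitOctonion K ≃ₗ[K] SplitOctonion K where
  toFun a := ⟨a.fst.submatrix Fin.rev Fin.rev, a.snd.submatrix Fin.rev Fin.rev⟩
  invFun a := ⟨a.fst.submatrix Fin.rev Fin.rev, a.snd.submatrix Fin.rev Fin.rev⟩
  map_add' _ _ := rfl
  map_smul' _ _ := rfl
  left_inv a := by
    ext i j <;> simp
  right_inv a := by
    ext i j <;> simp

theorem revMap_apply {K : Type*} [Field K] (a : SplitOctonion K) :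
    revMap K a = ⟨a.fst.submatrix Fin.rev Fin.rev, a.snd.submatrix Fin.rev Fin.rev⟩ := rfl

/-- The element `s` of `Aut(C)`. -/
def sElt (K : Type*) [Field K] : autGroup K where
  val := revMap K
  property := by
    intro a b
    ext i j <;> fin_cases i <;> fin_cases j <;>
      simp [revMap_apply, quatBar_apply, Matrix.mul_apply, Fin.sum_univ_two, fst_mul, snd_mul] <;> ring

/-- The matrix entry `g ↦ g_ij` with respect to the standard basis, as a function on `Aut(C)`. -/
noncomputable def entry {K : Type*} [Field K] (i j : (Fin 2 × Fin 2) ⊕ (Fin 2 × Fin 2))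
    (g : autGroup K) : K :=
  LinearMap.toMatrix (stdBasis K) (stdBasis K) (g : SplitOctonion K ≃ₗ[K] SplitOctonion K) i j

/-- The `k`-structure `k[G]` on the algebraic group `G = Aut(C) ⊆ GL₈(K)`, for `K` an algebraically
closed extension of `k`: the `k`-algebra of functions on `G` generated by the matrix entries and the
inverse of the determinant. -/
noncomputable def coordRing (k K : Type*) [Field k] [Field K] [Algebra k K] :
    Subalgebra k (autGroup K → K) :=
  Algebra.adjoin k (Set.range (fun p : ((Fin 2 × Fin 2) ⊕ (Fin 2 × Fin 2)) ×
      ((Fin 2 × Fin 2) ⊕ (Fin 2 × Fin 2)) => entry (K := K) p.1 p.2) ∪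
    {fun g : autGroup K => (LinearMap.det
      ((g : SplitOctonion K ≃ₗ[K] SplitOctonion K) : SplitOctonion K →ₗ[K] SplitOctonion K))⁻¹})

/-- A map `G → G` is a morphism defined over `k` if pulling back functions preserves `k[G]`. -/
def DefinedOver (k : Type*) {K : Type*} [Field k] [Field K] [Algebra k K]
    (θ : MulAut (autGroup K)) : Prop :=
  ∀ f ∈ coordRing k K, (fun g => f (θ g)) ∈ coordRing k K

/-- A `k`-involution of `G`: an automorphism of the algebraic group `G` of order exactly `2` that is
defined over `k`. (Since `θ⁻¹ = θ`, the inverse is a morphism defined over `k` as well.) -/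
def IsKInvolution (k : Type*) {K : Type*} [Field k] [Field K] [Algebra k K]
    (θ : MulAut (autGroup K)) : Prop :=
  orderOf θ = 2 ∧ DefinedOver k θ

/-- The group `G_k` of `k`-rational points of `G`. -/
def rationalPoints (k K : Type*) [Field k] [Field K] [Algebra k K] : Subgroup (autGroup K) where
  carrier := {g | ∀ i j, entry i j g ∈ (algebraMap k K).range}
  one_mem' := by
    intro i j
    have h : entry i j (1 : autGroup K) = (1 : Matrix _ _ K) i j :=
      congrFun (congrFun (LinearMap.toMatrix_one (stdBasis K)) i) j
    rw [h, Matrix.one_apply]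
    split_ifs
    · exact one_mem _
    · exact zero_mem _
  mul_mem' := by
    intro g h hg hh i j
    have e : entry i j (g * h) = ∑ l, entry i l g * entry l j h := by
      have := congrFun (congrFun (LinearMap.toMatrix_mul (stdBasis K)
        ((g : SplitOctonion K ≃ₗ[K] SplitOctonion K) : SplitOctonion K →ₗ[K] SplitOctonion K)
        ((h : SplitOctonion K ≃ₗ[K] SplitOctonion K) : SplitOctonion K →ₗ[K] SplitOctonion K)) i) j
      rw [Matrix.mul_apply] at this
      exact this
    rw [e]
    exact sum_mem fun l _ => mul_mem (hg i l) (hh l j)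
  inv_mem' := by
    intro g hg
    choose c hc using hg
    let M : Matrix _ _ k := Matrix.of c
    let e : SplitOctonion K ≃ₗ[K] SplitOctonion K := g
    have hM : LinearMap.toMatrix (stdBasis K) (stdBasis K) (e : SplitOctonion K →ₗ[K] _) =
        M.map (algebraMap k K) := by
      ext i j; exact (hc i j).symm
    have hinv : LinearMap.toMatrix (stdBasis K) (stdBasis K) (e.symm : SplitOctonion K →ₗ[K] _) =
        (M⁻¹).map (algebraMap k K) := by
      have h1 : LinearMap.toMatrix (stdBasis K) (stdBasis K) (e.symm : SplitOctonion K →ₗ[K] _) *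
          M.map (algebraMap k K) = 1 := by
        rw [← hM, ← LinearMap.toMatrix_mul, ← LinearMap.toMatrix_one (stdBasis K)]
        congr 1
        refine LinearMap.ext fun x => ?_
        exact e.symm_apply_apply x
      have h2 : IsUnit M.det := by
        rw [isUnit_iff_ne_zero]
        intro h0
        have := congrArg Matrix.det h1
        rw [Matrix.det_mul, ← RingHom.mapMatrix_apply, ← RingHom.map_det, h0] at this
        simp at this
      have h3 : M.map (algebraMap k K) * (M⁻¹).map (algebraMap k K) = 1 := by
        rw [← Matrix.map_mul, Matrix.mul_nonsing_inv _ h2]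
        simp
      exact left_inv_eq_right_inv h1 h3
    intro i j
    exact ⟨M⁻¹ i j, (congrFun (congrFun hinv i) j).symm⟩

/-- Two `k`-involutions lie in the same (`G_k`-)isomorphy class if they are conjugate by an inner
automorphism `I_g` with `g ∈ G_k`. -/
def kInvolutionSetoid (k K : Type*) [Field k] [Field K] [Algebra k K] :
    Setoid {θ : MulAut (autGroup K) // IsKInvolution k θ} where
  r θ φ := ∃ g ∈ rationalPoints k K, (φ : MulAut (autGroup K)) = MulAut.conj g * θ * (MulAut.conj g)⁻¹
  iseqv :=
    { refl := fun θ => ⟨1, one_mem _, by simp⟩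
      symm := by
        rintro θ φ ⟨g, hg, h⟩
        exact ⟨g⁻¹, inv_mem hg, by rw [h, map_inv]; group⟩
      trans := by
        rintro θ φ ψ ⟨g, hg, h⟩ ⟨g', hg', h'⟩
        exact ⟨g' * g, mul_mem hg' hg, by rw [h', h, map_mul]; group⟩ }

/-- The set of isomorphy classes of `k`-involutions of `G`, where `G` is taken over the algebraic
closure of `k`. -/
abbrev IsoClasses (k : Type*) [Field k] : Type _ :=
  Quotient (kInvolutionSetoid k (AlgebraicClosure k))

/-- The isomorphy class of a `k`-involution. -/
noncomputable def isoClass {k : Type*} [Field k] {θ : MulAut (autGroup (AlgebraicClosure k))}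
    (h : IsKInvolution k θ) : IsoClasses k :=
  Quotient.mk _ ⟨θ, h⟩

/-- The automorphism `θ = I_s` of `G`, where `I_g` is conjugation by `g`. -/
noncomputable def theta (k : Type*) [Field k] : MulAut (autGroup (AlgebraicClosure k)) :=
  MulAut.conj (sElt (AlgebraicClosure k))

/-- The automorphism `θ ∘ I_t` of `G`, where `t = t_(1,-1)`. -/
noncomputable def thetaTwist (k : Type*) [Field k] : MulAut (autGroup (AlgebraicClosure k)) :=
  theta k * MulAut.conj (torusElt 1 (-1))

end SplitOctonion

/-! The classification rests on a dictionary: a `k`-involution of G is conjugation by an involution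
of the octonion algebra over `k`, and such an involution is determined up to conjugacy by the
quaternion algebra it fixes. Counting isomorphy classes then becomes counting quaternion algebras
over `k`.

The first half of the dictionary needs every automorphism θ of the algebraic group to be inner
(`exists_eq_conj`). Three independent commuting involutions of the octonions are simultaneously
diagonal on a triple of anticommuting square roots of 1, and automorphisms act simply transitively
on such triples. Hence, after an inner correction, θ fixes three standard involutions. Each member
of the standard triple has a two-dimensional torus, which can be recognised inside the abstract
group. On it θ acts by an integer matrix that is trivial modulo 2 and commutes with a symmetry of
order 3, so θ is trivial or inversion there (`torus_trivial_or_inversion`). The standard involution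
with the same index inverts that torus and centralises the other two, so a further inner correction
makes θ trivial on all three. The three tori generate G (`eq_top_of_tori`), which finishes this
step. As the centre is trivial, Galois descent puts the conjugating element in the rational points
(`isKInvolution_iff`).

For the second half, let g ≠ 1 be an involution of the octonions over `k`. Its fixed space contains
anticommuting pure elements with nonzero squares α and β (`exists_hasType`). Because the octonions
are split, its negated space contains some c with c² = 1 (`exists_neg_nrm_eq`). The octonions are
then the double of the quaternion algebra (α, β) by c, and g negates c, so the parameters determine
the conjugacy class (`HasType.exists_conj_eq`). Every pair of nonzero parameters occurs
(`exists_involution_hasType`). Changes of quaternion generators identify classes. The values of the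
ternary form αr² + βs² − αβt² on pure quaternions, an invariant by `HasType.form_represents`,
separate them.

The rest is arithmetic of quaternion algebras. Over ℂ and finite fields the form is always
isotropic. Over ℝ and the p-adic fields there are exactly the split algebra and one division
algebra, which is (−1, −1) over ℝ and ℚ₂. Over ℚ the algebras (1, 1), (−1, −1) and (−1, −3) are
distinct. -/

open scoped Quaternion

namespace SplitOctonion

/-! ### Composition identities for the octonions -/

section Identities

/-- Two octonions agree as soon as their eight coordinates do. -/
theorem ext_coords {S : Type*} {x y : SplitOctonion S}
    (h1 : x.fst 0 0 = y.fst 0 0) (h2 : x.fst 0 1 = y.fst 0 1)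
    (h3 : x.fst 1 0 = y.fst 1 0) (h4 : x.fst 1 1 = y.fst 1 1)
    (h5 : x.snd 0 0 = y.snd 0 0) (h6 : x.snd 0 1 = y.snd 0 1)
    (h7 : x.snd 1 0 = y.snd 1 0) (h8 : x.snd 1 1 = y.snd 1 1) : x = y := by
  ext i j <;> fin_cases i <;> fin_cases j <;> assumption

variable {R : Type*} [CommRing R]

instance : One (SplitOctonion R) := ⟨⟨1, 0⟩⟩

theorem fst_one : (1 : SplitOctonion R).fst = 1 := rfl
theorem snd_one : (1 : SplitOctonion R).snd = 0 := rfl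
theorem fst_zero : (0 : SplitOctonion R).fst = 0 := rfl
theorem snd_zero : (0 : SplitOctonion R).snd = 0 := rfl
theorem fst_sub (a b : SplitOctonion R) : (a - b).fst = a.fst - b.fst := rfl
theorem snd_sub (a b : SplitOctonion R) : (a - b).snd = a.snd - b.snd := rfl

/-- With the product in scalar form, every identity of the algebra becomes a polynomial identity in
the coordinates. -/
theorem mul_coords (x y : SplitOctonion R) :
    (x * y).fst 0 0 = x.fst 0 0 * y.fst 0 0 + x.fst 0 1 * y.fst 1 0 +
        (y.snd 1 1 * x.snd 0 0 - y.snd 0 1 * x.snd 1 0) ∧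
    (x * y).fst 0 1 = x.fst 0 0 * y.fst 0 1 + x.fst 0 1 * y.fst 1 1 +
        (y.snd 1 1 * x.snd 0 1 - y.snd 0 1 * x.snd 1 1) ∧
    (x * y).fst 1 0 = x.fst 1 0 * y.fst 0 0 + x.fst 1 1 * y.fst 1 0 +
        (y.snd 0 0 * x.snd 1 0 - y.snd 1 0 * x.snd 0 0) ∧
    (x * y).fst 1 1 = x.fst 1 0 * y.fst 0 1 + x.fst 1 1 * y.fst 1 1 +
        (y.snd 0 0 * x.snd 1 1 - y.snd 1 0 * x.snd 0 1) ∧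
    (x * y).snd 0 0 = y.snd 0 0 * x.fst 0 0 + y.snd 0 1 * x.fst 1 0 +
        (x.snd 0 0 * y.fst 1 1 - x.snd 0 1 * y.fst 1 0) ∧
    (x * y).snd 0 1 = y.snd 0 0 * x.fst 0 1 + y.snd 0 1 * x.fst 1 1 +
        (x.snd 0 1 * y.fst 0 0 - x.snd 0 0 * y.fst 0 1) ∧
    (x * y).snd 1 0 = y.snd 1 0 * x.fst 0 0 + y.snd 1 1 * x.fst 1 0 +
        (x.snd 1 0 * y.fst 1 1 - x.snd 1 1 * y.fst 1 0) ∧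
    (x * y).snd 1 1 = y.snd 1 0 * x.fst 0 1 + y.snd 1 1 * x.fst 1 1 +
        (x.snd 1 1 * y.fst 0 0 - x.snd 1 0 * y.fst 0 1) := by
  refine ⟨?_, ?_, ?_, ?_, ?_, ?_, ?_, ?_⟩ <;>
    simp [fst_mul, snd_mul, Matrix.mul_apply, Fin.sum_univ_two, quatBar_apply] <;> ring

theorem fst_mul00 (x y : SplitOctonion R) : (x * y).fst 0 0 = x.fst 0 0 * y.fst 0 0 +
    x.fst 0 1 * y.fst 1 0 + (y.snd 1 1 * x.snd 0 0 - y.snd 0 1 * x.snd 1 0) := (mul_coords x y).1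
theorem fst_mul01 (x y : SplitOctonion R) : (x * y).fst 0 1 = x.fst 0 0 * y.fst 0 1 +
    x.fst 0 1 * y.fst 1 1 + (y.snd 1 1 * x.snd 0 1 - y.snd 0 1 * x.snd 1 1) := (mul_coords x y).2.1
theorem fst_mul10 (x y : SplitOctonion R) : (x * y).fst 1 0 = x.fst 1 0 * y.fst 0 0 +
    x.fst 1 1 * y.fst 1 0 + (y.snd 0 0 * x.snd 1 0 - y.snd 1 0 * x.snd 0 0) :=
  (mul_coords x y).2.2.1
theorem fst_mul11 (x y : SplitOctonion R) : (x * y).fst 1 1 = x.fst 1 0 * y.fst 0 1 +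
    x.fst 1 1 * y.fst 1 1 + (y.snd 0 0 * x.snd 1 1 - y.snd 1 0 * x.snd 0 1) :=
  (mul_coords x y).2.2.2.1
theorem snd_mul00 (x y : SplitOctonion R) : (x * y).snd 0 0 = y.snd 0 0 * x.fst 0 0 +
    y.snd 0 1 * x.fst 1 0 + (x.snd 0 0 * y.fst 1 1 - x.snd 0 1 * y.fst 1 0) :=
  (mul_coords x y).2.2.2.2.1
theorem snd_mul01 (x y : SplitOctonion R) : (x * y).snd 0 1 = y.snd 0 0 * x.fst 0 1 +
    y.snd 0 1 * x.fst 1 1 + (x.snd 0 1 * y.fst 0 0 - x.snd 0 0 * y.fst 0 1) :=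
  (mul_coords x y).2.2.2.2.2.1
theorem snd_mul10 (x y : SplitOctonion R) : (x * y).snd 1 0 = y.snd 1 0 * x.fst 0 0 +
    y.snd 1 1 * x.fst 1 0 + (x.snd 1 0 * y.fst 1 1 - x.snd 1 1 * y.fst 1 0) :=
  (mul_coords x y).2.2.2.2.2.2.1
theorem snd_mul11 (x y : SplitOctonion R) : (x * y).snd 1 1 = y.snd 1 0 * x.fst 0 1 +
    y.snd 1 1 * x.fst 1 1 + (x.snd 1 1 * y.fst 0 0 - x.snd 1 0 * y.fst 0 1) :=
  (mul_coords x y).2.2.2.2.2.2.2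

instance : NonAssocRing (SplitOctonion R) :=
  { (inferInstance : AddCommGroup (SplitOctonion R)), (inferInstance : Mul (SplitOctonion R)),
    (inferInstance : One (SplitOctonion R)) with
    left_distrib := fun a b c => by
      apply ext_coords <;> simp only [fst_mul00, fst_mul01, fst_mul10, fst_mul11, snd_mul00,
        snd_mul01, snd_mul10, snd_mul11, fst_add, snd_add, Matrix.add_apply] <;> ring
    right_distrib := fun a b c => by
      apply ext_coords <;> simp only [fst_mul00, fst_mul01, fst_mul10, fst_mul11, snd_mul00,
        snd_mul01, snd_mul10, snd_mul11, fst_add, snd_add, Matrix.add_apply] <;> ring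
    zero_mul := fun a => by
      apply ext_coords <;> simp [fst_mul00, fst_mul01, fst_mul10, fst_mul11, snd_mul00,
        snd_mul01, snd_mul10, snd_mul11, fst_zero, snd_zero]
    mul_zero := fun a => by
      apply ext_coords <;> simp [fst_mul00, fst_mul01, fst_mul10, fst_mul11, snd_mul00,
        snd_mul01, snd_mul10, snd_mul11, fst_zero, snd_zero]
    one_mul := fun a => by
      apply ext_coords <;> simp [fst_mul00, fst_mul01, fst_mul10, fst_mul11, snd_mul00,
        snd_mul01, snd_mul10, snd_mul11, fst_one, snd_one]
    mul_one := fun a => by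
      apply ext_coords <;> simp [fst_mul00, fst_mul01, fst_mul10, fst_mul11, snd_mul00,
        snd_mul01, snd_mul10, snd_mul11, fst_one, snd_one] }

instance : IsScalarTower R (SplitOctonion R) (SplitOctonion R) := ⟨fun r a b => by
  simp only [smul_eq_mul]
  apply ext_coords <;> simp only [fst_mul00, fst_mul01, fst_mul10, fst_mul11, snd_mul00,
        snd_mul01, snd_mul10, snd_mul11, fst_smul, snd_smul, Matrix.smul_apply, smul_eq_mul] <;>
    ring⟩

instance : SMulCommClass R (SplitOctonion R) (SplitOctonion R) := ⟨fun r a b => by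
  simp only [smul_eq_mul]
  apply ext_coords <;> simp only [fst_mul00, fst_mul01, fst_mul10, fst_mul11, snd_mul00,
        snd_mul01, snd_mul10, snd_mul11, fst_smul, snd_smul, Matrix.smul_apply, smul_eq_mul] <;>
    ring⟩

/-- The trace of an octonion. -/
def tr (x : SplitOctonion R) : R := x.fst 0 0 + x.fst 1 1

/-- The norm of an octonion. -/
def nrm (x : SplitOctonion R) : R :=
  x.fst 0 0 * x.fst 1 1 - x.fst 0 1 * x.fst 1 0 - x.snd 0 0 * x.snd 1 1 + x.snd 0 1 * x.snd 1 0

/-- The bilinear form polarizing the norm. -/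
def bil (x y : SplitOctonion R) : R :=
  x.fst 0 0 * y.fst 1 1 + x.fst 1 1 * y.fst 0 0 - x.fst 0 1 * y.fst 1 0 - x.fst 1 0 * y.fst 0 1
  - x.snd 0 0 * y.snd 1 1 - x.snd 1 1 * y.snd 0 0 + x.snd 0 1 * y.snd 1 0 + x.snd 1 0 * y.snd 0 1

theorem tr_add (x y : SplitOctonion R) : tr (x + y) = tr x + tr y := by
  simp only [tr, fst_add, Matrix.add_apply]; ring
theorem tr_smul (r : R) (x : SplitOctonion R) : tr (r • x) = r * tr x := by
  simp only [tr, fst_smul, Matrix.smul_apply, smul_eq_mul]; ring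
theorem tr_one : tr (1 : SplitOctonion R) = 2 := by
  simp [tr, fst_one]; norm_num
theorem bil_comm (x y : SplitOctonion R) : bil x y = bil y x := by simp only [bil]; ring
theorem bil_add_left (x y z : SplitOctonion R) : bil (x + y) z = bil x z + bil y z := by
  simp only [bil, fst_add, snd_add, Matrix.add_apply]; ring
theorem bil_smul_left (r : R) (x y : SplitOctonion R) : bil (r • x) y = r * bil x y := by
  simp only [bil, fst_smul, snd_smul, Matrix.smul_apply, smul_eq_mul]; ring
theorem bil_add_right (x y z : SplitOctonion R) : bil x (y + z) = bil x y + bil x z := by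
  simp only [bil, fst_add, snd_add, Matrix.add_apply]; ring
theorem bil_smul_right (r : R) (x y : SplitOctonion R) : bil x (r • y) = r * bil x y := by
  simp only [bil, fst_smul, snd_smul, Matrix.smul_apply, smul_eq_mul]; ring
theorem bil_one_right (x : SplitOctonion R) : bil x 1 = tr x := by
  simp [bil, tr, fst_one, snd_one]
theorem bil_self (x : SplitOctonion R) : bil x x = 2 * nrm x := by
  simp only [bil, nrm]; ring
theorem nrm_add (x y : SplitOctonion R) : nrm (x + y) = nrm x + nrm y + bil x y := by
  simp only [bil, nrm, fst_add, snd_add, Matrix.add_apply]; ring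
theorem nrm_smul (r : R) (x : SplitOctonion R) : nrm (r • x) = r ^ 2 * nrm x := by
  simp only [nrm, fst_smul, snd_smul, Matrix.smul_apply, smul_eq_mul]; ring
theorem nrm_one : nrm (1 : SplitOctonion R) = 1 := by
  simp [nrm, fst_one, snd_one]

theorem mul_self (x : SplitOctonion R) : x * x = tr x • x - nrm x • 1 := by
  apply ext_coords <;> simp [fst_mul00, fst_mul01, fst_mul10, fst_mul11, snd_mul00,
        snd_mul01, snd_mul10, snd_mul11, fst_smul, snd_smul, fst_sub, snd_sub, fst_one, snd_one,
        tr, nrm] <;> ring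

theorem mul_add_mul_comm (x y : SplitOctonion R) :
    x * y + y * x = tr x • y + tr y • x - bil x y • 1 := by
  apply ext_coords <;> simp [fst_mul00, fst_mul01, fst_mul10, fst_mul11, snd_mul00,
        snd_mul01, snd_mul10, snd_mul11, fst_smul, snd_smul, fst_sub, snd_sub, fst_one, snd_one,
        fst_add, snd_add, tr, bil] <;> ring

theorem nrm_mul (x y : SplitOctonion R) : nrm (x * y) = nrm x * nrm y := by
  simp only [fst_mul00, fst_mul01, fst_mul10, fst_mul11, snd_mul00,
        snd_mul01, snd_mul10, snd_mul11, nrm]; ring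

theorem left_alternative_linearized (x y z : SplitOctonion R) :
    x * (y * z) + y * (x * z) = (x * y + y * x) * z := by
  apply ext_coords <;> simp only [fst_mul00, fst_mul01, fst_mul10, fst_mul11, snd_mul00,
        snd_mul01, snd_mul10, snd_mul11, fst_add, snd_add, Matrix.add_apply] <;> ring

theorem right_alternative_linearized (x y z : SplitOctonion R) :
    (z * x) * y + (z * y) * x = z * (x * y + y * x) := by
  apply ext_coords <;> simp only [fst_mul00, fst_mul01, fst_mul10, fst_mul11, snd_mul00,
        snd_mul01, snd_mul10, snd_mul11, fst_add, snd_add, Matrix.add_apply] <;> ring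

theorem left_alternative (x y : SplitOctonion R) : x * (x * y) = (x * x) * y := by
  apply ext_coords <;> simp only [fst_mul00, fst_mul01, fst_mul10, fst_mul11, snd_mul00,
        snd_mul01, snd_mul10, snd_mul11] <;> ring

theorem right_alternative (x y : SplitOctonion R) : (y * x) * x = y * (x * x) := by
  apply ext_coords <;> simp only [fst_mul00, fst_mul01, fst_mul10, fst_mul11, snd_mul00,
        snd_mul01, snd_mul10, snd_mul11] <;> ring

theorem moufang (x y c : SplitOctonion R) : (c * x) * (y * c) = (c * (x * y)) * c := by
  apply ext_coords <;> simp only [fst_mul00, fst_mul01, fst_mul10, fst_mul11, snd_mul00,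
        snd_mul01, snd_mul10, snd_mul11] <;> ring

theorem bil_mul_left (x y z : SplitOctonion R) : bil (x * y) (x * z) = nrm x * bil y z := by
  simp only [fst_mul00, fst_mul01, fst_mul10, fst_mul11, snd_mul00,
        snd_mul01, snd_mul10, snd_mul11, nrm, bil]; ring

/-- `B(xy, z) = B(y, x̄ z)`. -/
theorem bil_mul_adjoint (x y z : SplitOctonion R) :
    bil (x * y) z + bil y (x * z) = tr x * bil y z := by
  simp only [fst_mul00, fst_mul01, fst_mul10, fst_mul11, snd_mul00,
        snd_mul01, snd_mul10, snd_mul11, tr, bil]; ring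

/-- The conjugate of an octonion. -/
def conj (x : SplitOctonion R) : SplitOctonion R := tr x • 1 - x

theorem conj_mul (x y : SplitOctonion R) : conj (x * y) = conj y * conj x := by
  apply ext_coords <;> simp [conj, tr, fst_mul00, fst_mul01, fst_mul10, fst_mul11, snd_mul00,
        snd_mul01, snd_mul10, snd_mul11, fst_smul, snd_smul, fst_sub, snd_sub, fst_one, snd_one]
    <;> ring

theorem conj_conj (x : SplitOctonion R) : conj (conj x) = x := by
  apply ext_coords <;> simp [conj, tr, fst_smul, snd_smul, fst_sub, snd_sub, fst_one, snd_one]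

section Doubling

variable {x y c : SplitOctonion R}

/-- For pure c orthogonal to x, the polarised quadratic equation collapses to cx + xc = tr(x)c. This
and the following rules recover the Cayley-Dickson product intrinsically, from a vector orthogonal
to a subalgebra. -/
theorem mul_of_orthogonal (hc : tr c = 0) (hx : bil c x = 0) : x * c = c * conj x := by
  have := mul_add_mul_comm c x
  rw [hc, hx, zero_smul, zero_smul, zero_add, sub_zero] at this
  rw [conj, mul_sub, mul_smul_comm, mul_one, ← this]
  abel

theorem mul_mul_left_of_orthogonal (hc : tr c = 0) (hx : bil c x = 0) :
    x * (c * y) = c * (conj x * y) := by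
  have h1 := mul_add_mul_comm c x
  rw [hc, hx, zero_smul, zero_smul, zero_add, sub_zero] at h1
  have h2 := left_alternative_linearized x c y
  rw [add_comm (x * c), h1, smul_mul_assoc] at h2
  rw [conj, sub_mul, smul_mul_assoc, one_mul, mul_sub, mul_smul_comm, ← h2]
  abel

theorem doubling_left (hc : tr c = 0) (hx : bil c x = 0) (hy : bil c y = 0)
    (hyx : bil c (y * x) = 0) : x * (y * c) = (y * x) * c := by
  rw [mul_of_orthogonal hc hy, mul_mul_left_of_orthogonal hc hx, ← conj_mul,
    ← mul_of_orthogonal hc hyx]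

theorem doubling_right (hc : tr c = 0) (hy : bil c y = 0) :
    (x * c) * y = (x * conj y) * c := by
  have h1 := mul_add_mul_comm c y
  rw [hc, hy, zero_smul, zero_smul, zero_add, sub_zero] at h1
  have h2 := right_alternative_linearized c y x
  rw [h1, mul_smul_comm] at h2
  rw [conj, mul_sub, sub_mul, mul_smul_comm, mul_one, smul_mul_assoc, ← h2]
  abel

/-- Once xc is rewritten as cx̄, the Moufang identity gathers x̄ and y between two copies of c.
Moving one copy across turns the pair into c² = γ and conjugates x̄y. -/
theorem doubling_both {γ : R} (hc : tr c = 0) (hγ : c * c = γ • 1) (hx : bil c x = 0)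
    (hyx : bil c (conj x * y) = 0) :
    (x * c) * (y * c) = γ • (conj y * x) := by
  rw [mul_of_orthogonal hc hx, moufang, ← conj_conj (conj x * y)]
  have h := mul_of_orthogonal hc hyx
  have h3 : (c * (conj x * y)) * c = c * ((conj x * y) * c) := by
    have h4 := moufang (conj x * y) 1 c
    have h5 := moufang 1 (conj x * y) c
    simp only [mul_one, one_mul] at h4 h5
    exact h5.symm
  rw [conj_conj, h3, h, left_alternative, hγ, smul_mul_assoc, one_mul, conj_mul, conj_conj]

end Doubling

end Identities

end SplitOctonion

open scoped Quaternion

namespace SplitOctonion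

/-! ### Pairs and triples as Cayley-Dickson generators -/

section Triples

variable {K : Type*} [Field K]

theorem smul_one_injective {r s : K} (h : r • (1 : SplitOctonion K) = s • 1) : r = s := by
  have := congrArg (fun x : SplitOctonion K => x.fst 0 0) h
  simpa [fst_smul, fst_one] using this

theorem one_ne_zero' : (1 : SplitOctonion K) ≠ 0 := by
  intro h
  have := congrArg (fun x : SplitOctonion K => x.fst 0 0) h
  simp [fst_one, fst_zero] at this

theorem nrm_of_mul_self {a : SplitOctonion K} {α : K} (ht : tr a = 0) (h : a * a = α • 1) :
    nrm a = -α := by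
  rw [mul_self, ht, zero_smul, zero_sub, ← neg_smul] at h
  rw [← smul_one_injective h, neg_neg]

theorem mul_self_of_nrm {a : SplitOctonion K} {α : K} (ht : tr a = 0) (h : nrm a = -α) :
    a * a = α • 1 := by
  rw [mul_self, ht, h, zero_smul, zero_sub, ← neg_smul, neg_neg]

/-- A pair of anticommuting pure octonions with squares `α`, `β`. -/
structure IsPair (α β : K) (a b : SplitOctonion K) : Prop where
  sq_left : a * a = α • 1
  sq_right : b * b = β • 1
  tr_left : tr a = 0
  tr_right : tr b = 0
  bil_eq : bil a b = 0

/-- A basic triple: three pure, mutually orthogonal octonions with squares `α`, `β`, `γ`, the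
last one being orthogonal to the product of the first two. -/
structure IsTriple (α β γ : K) (a b c : SplitOctonion K) : Prop extends IsPair α β a b where
  sq_last : c * c = γ • 1
  tr_last : tr c = 0
  bil_last_left : bil c a = 0
  bil_last_right : bil c b = 0
  bil_last_mul : bil c (a * b) = 0

/-- The linear map from a quaternion algebra determined by a pair of octonions. -/
def quatMap (α β : K) (a b : SplitOctonion K) : ℍ[K,α,β] →ₗ[K] SplitOctonion K where
  toFun q := q.re • 1 + q.imI • a + q.imJ • b + q.imK • (a * b)
  map_add' p q := by simp [add_smul]; abel
  map_smul' r q := by simp [mul_smul]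

theorem quatMap_apply {α β : K} (a b : SplitOctonion K) (q : ℍ[K,α,β]) :
    quatMap α β a b q = q.re • 1 + q.imI • a + q.imJ • b + q.imK • (a * b) := rfl

namespace IsPair

variable {α β : K} {a b : SplitOctonion K} (h : IsPair α β a b)
include h

theorem anticomm : b * a = -(a * b) := by
  have := mul_add_mul_comm b a
  rw [h.tr_left, h.tr_right, bil_comm, h.bil_eq] at this
  simpa [add_eq_zero_iff_eq_neg] using this

theorem tr_mul : tr (a * b) = 0 := by
  have := bil_mul_adjoint a b 1
  rw [mul_one, bil_one_right, bil_comm b, h.bil_eq, h.tr_left] at this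
  simpa using this

theorem bil_left_mul : bil a (a * b) = 0 := by
  have := bil_mul_left a 1 b
  rw [mul_one, bil_comm 1, bil_one_right, h.tr_right] at this
  simpa using this

theorem bil_right_mul : bil b (a * b) = 0 := by
  have := bil_mul_left b 1 a
  rw [mul_one, bil_comm 1, bil_one_right, h.tr_left, h.anticomm] at this
  rw [show -(a * b) = (-1 : K) • (a * b) by simp, bil_smul_right] at this
  simpa using this

theorem left_mul_mul : a * (a * b) = α • b := by
  rw [left_alternative, h.sq_left, smul_mul_assoc, one_mul]
theorem mul_mul_right : (a * b) * b = β • a := by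
  rw [right_alternative, h.sq_right, mul_smul_comm, mul_one]
theorem right_mul_mul : b * (a * b) = -(β • a) := by
  rw [← neg_eq_iff_eq_neg, ← mul_neg, ← h.anticomm, left_alternative, h.sq_right,
    smul_mul_assoc, one_mul]
theorem mul_mul_left : (a * b) * a = -(α • b) := by
  rw [← neg_eq_iff_eq_neg, ← neg_mul, ← h.anticomm, right_alternative, h.sq_left,
    mul_smul_comm, mul_one]
theorem mul_mul_mul : (a * b) * (a * b) = -((α * β) • 1) := by
  rw [← neg_eq_iff_eq_neg, ← mul_neg, ← h.anticomm, moufang, h.sq_right, mul_smul_comm, mul_one,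
    smul_mul_assoc, h.sq_left, smul_smul, mul_comm]

/-- Alternativity and anticommutation determine the whole multiplication table of 1, a, b, ab,
although the octonions are not associative. -/
theorem quatMap_mul (p q : ℍ[K,α,β]) :
    quatMap α β a b (p * q) = quatMap α β a b p * quatMap α β a b q := by
  simp only [quatMap_apply, mul_add, add_mul, smul_mul_assoc, mul_smul_comm, one_mul, mul_one,
    h.sq_left, h.sq_right, h.left_mul_mul, h.mul_mul_right, h.right_mul_mul, h.mul_mul_left,
    h.mul_mul_mul, h.anticomm, QuaternionAlgebra.re_mul, QuaternionAlgebra.imI_mul,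
    QuaternionAlgebra.imJ_mul, QuaternionAlgebra.imK_mul]
  module

theorem tr_quatMap (q : ℍ[K,α,β]) : tr (quatMap α β a b q) = 2 * q.re := by
  simp only [quatMap_apply, tr_add, tr_smul, tr_one, h.tr_left, h.tr_right, h.tr_mul]
  ring

theorem conj_quatMap (q : ℍ[K,α,β]) :
    conj (quatMap α β a b q) = quatMap α β a b (star q) := by
  rw [conj, h.tr_quatMap, quatMap_apply, quatMap_apply]
  simp only [QuaternionAlgebra.re_star, QuaternionAlgebra.imI_star, QuaternionAlgebra.imJ_star,
    QuaternionAlgebra.imK_star]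
  module

theorem nrm_quatMap (q : ℍ[K,α,β]) : nrm (quatMap α β a b q) =
    q.re ^ 2 - α * q.imI ^ 2 - β * q.imJ ^ 2 + α * β * q.imK ^ 2 := by
  have h1 : nrm (a * b) = α * β := by
    rw [nrm_mul, nrm_of_mul_self h.tr_left h.sq_left, nrm_of_mul_self h.tr_right h.sq_right]
    ring
  simp only [quatMap_apply, nrm_add, nrm_smul, nrm_one, bil_add_left, bil_smul_left,
    bil_smul_right, nrm_of_mul_self h.tr_left h.sq_left,
    nrm_of_mul_self h.tr_right h.sq_right, h1, bil_comm 1, bil_one_right, h.tr_left, h.tr_right,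
    h.tr_mul, h.bil_eq, h.bil_left_mul, h.bil_right_mul]
  ring

theorem bil_quatMap (p q : ℍ[K,α,β]) : bil (quatMap α β a b p) (quatMap α β a b q) =
    2 * (p.re * q.re - α * (p.imI * q.imI) - β * (p.imJ * q.imJ)
      + α * β * (p.imK * q.imK)) := by
  have := nrm_add (quatMap α β a b p) (quatMap α β a b q)
  rw [← map_add, h.nrm_quatMap, h.nrm_quatMap, h.nrm_quatMap] at this
  simp only [QuaternionAlgebra.re_add, QuaternionAlgebra.imI_add, QuaternionAlgebra.imJ_add,
    QuaternionAlgebra.imK_add] at this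
  linear_combination -this

/-- The bilinear form is diagonal on 1, a, b, ab with entries 2, −2α, −2β, 2αβ, so it is
nondegenerate and pairing with these four vectors suffices. -/
theorem quatMap_eq_zero [NeZero (2 : K)] (hα : α ≠ 0) (hβ : β ≠ 0) {p : ℍ[K,α,β]}
    (hp : ∀ q, bil (quatMap α β a b p) (quatMap α β a b q) = 0) : p = 0 := by
  have h0 := hp ⟨1, 0, 0, 0⟩
  have h1 := hp ⟨0, 1, 0, 0⟩
  have h2 := hp ⟨0, 0, 1, 0⟩
  have h3 := hp ⟨0, 0, 0, 1⟩
  rw [h.bil_quatMap] at h0 h1 h2 h3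
  simp [hα, hβ, NeZero.ne] at h0 h1 h2 h3
  ext <;> simp [h0, h1, h2, h3]

end IsPair

/-- The linear map from the double of a quaternion algebra determined by a triple of octonions. -/
def tripleMap (α β : K) (a b c : SplitOctonion K) :
    ℍ[K,α,β] × ℍ[K,α,β] →ₗ[K] SplitOctonion K where
  toFun p := quatMap α β a b p.1 + quatMap α β a b p.2 * c
  map_add' p q := by simp only [Prod.fst_add, Prod.snd_add, map_add, add_mul]; abel
  map_smul' r q := by simp [smul_add, smul_mul_assoc]

theorem tripleMap_apply {α β : K} (a b c : SplitOctonion K) (p : ℍ[K,α,β] × ℍ[K,α,β]) :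
    tripleMap α β a b c p = quatMap α β a b p.1 + quatMap α β a b p.2 * c := rfl

theorem finrank_eq : Module.finrank K (SplitOctonion K) = 8 := by
  rw [Module.finrank_eq_card_basis (stdBasis K)]
  rfl

namespace IsTriple

variable {α β γ : K} {a b c : SplitOctonion K} (h : IsTriple α β γ a b c)
include h

theorem bil_quatMap_last (q : ℍ[K,α,β]) : bil c (quatMap α β a b q) = 0 := by
  simp [quatMap_apply, bil_add_right, bil_smul_right, bil_one_right, h.tr_last, h.bil_last_left,
    h.bil_last_right, h.bil_last_mul]

theorem tripleMap_mul (p q : ℍ[K,α,β] × ℍ[K,α,β]) :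
    tripleMap α β a b c p * tripleMap α β a b c q =
      tripleMap α β a b c (p.1 * q.1 + γ • (star q.2 * p.2), q.2 * p.1 + p.2 * star q.1) := by
  have hp := h.toIsPair
  simp only [tripleMap_apply, mul_add, add_mul, map_add, map_smul, hp.quatMap_mul]
  rw [doubling_left h.tr_last (h.bil_quatMap_last _) (h.bil_quatMap_last _)
      (by rw [← hp.quatMap_mul]; exact h.bil_quatMap_last _),
    doubling_right h.tr_last (h.bil_quatMap_last _),
    doubling_both h.tr_last h.sq_last (h.bil_quatMap_last _)
      (by rw [hp.conj_quatMap, ← hp.quatMap_mul]; exact h.bil_quatMap_last _),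
    hp.conj_quatMap, hp.conj_quatMap]
  abel

theorem bil_quatMap_mul (p q : ℍ[K,α,β]) :
    bil (quatMap α β a b p * c) (quatMap α β a b q) = 0 := by
  have := bil_mul_adjoint (quatMap α β a b p) c (quatMap α β a b q)
  rw [← h.toIsPair.quatMap_mul, h.bil_quatMap_last, h.bil_quatMap_last] at this
  simpa using this

theorem bil_mul_mul (p q : ℍ[K,α,β]) : bil (quatMap α β a b p * c) (quatMap α β a b q * c) =
    -γ * bil (quatMap α β a b p) (quatMap α β a b q) := by
  have e : ∀ x y : SplitOctonion K, bil (x * c) (y * c) = nrm c * bil x y := by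
    intro x y
    simp only [fst_mul00, fst_mul01, fst_mul10, fst_mul11, snd_mul00,
        snd_mul01, snd_mul10, snd_mul11, nrm, bil]; ring
  rw [e, nrm_of_mul_self h.tr_last h.sq_last]

theorem bil_tripleMap (p q : ℍ[K,α,β] × ℍ[K,α,β]) :
    bil (tripleMap α β a b c p) (tripleMap α β a b c q) =
      bil (quatMap α β a b p.1) (quatMap α β a b q.1) -
      γ * bil (quatMap α β a b p.2) (quatMap α β a b q.2) := by
  simp only [tripleMap_apply, bil_add_left, bil_add_right, h.bil_mul_mul, h.bil_quatMap_mul,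
    bil_comm (quatMap α β a b p.1) (_ * c)]
  ring

/-- The two halves of the double are orthogonal, and the second carries −γ times the quaternion
form. Nondegeneracy of both gives injectivity; equality of dimensions will give surjectivity. -/
theorem tripleMap_injective [NeZero (2 : K)] (hα : α ≠ 0) (hβ : β ≠ 0) (hγ : γ ≠ 0) :
    Function.Injective (tripleMap α β a b c) := by
  rw [injective_iff_map_eq_zero]
  intro p hp
  have h0 : ∀ q, bil (tripleMap α β a b c p) (tripleMap α β a b c q) = 0 := by
    intro q
    rw [hp]
    simp [bil, fst_zero, snd_zero]
  have h1 : p.1 = 0 := h.toIsPair.quatMap_eq_zero hα hβ fun q => by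
    have := h0 (q, 0)
    rw [h.bil_tripleMap] at this
    simpa [bil, fst_zero, snd_zero] using this
  have h2 : p.2 = 0 := h.toIsPair.quatMap_eq_zero hα hβ fun q => by
    have := h0 (0, q)
    rw [h.bil_tripleMap, map_zero] at this
    simpa [bil_comm _ 0, show ∀ x : SplitOctonion K, bil 0 x = 0 by
      intro x; simp [bil, fst_zero, snd_zero], hγ] using this
  exact Prod.ext h1 h2

/-- The double of the quaternion algebra is isomorphic to the octonions by a triple. -/
noncomputable def equiv [NeZero (2 : K)] (hα : α ≠ 0) (hβ : β ≠ 0) (hγ : γ ≠ 0) :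
    (ℍ[K,α,β] × ℍ[K,α,β]) ≃ₗ[K] SplitOctonion K :=
  haveI : FiniteDimensional K (SplitOctonion K) :=
    Module.Basis.finiteDimensional_of_finite (stdBasis K)
  LinearEquiv.ofInjectiveOfFinrankEq (tripleMap α β a b c)
    (h.tripleMap_injective hα hβ hγ)
    (by rw [Module.finrank_prod, QuaternionAlgebra.finrank_eq_four, finrank_eq])

theorem tripleMap_surjective [NeZero (2 : K)] (hα : α ≠ 0) (hβ : β ≠ 0) (hγ : γ ≠ 0) :
    Function.Surjective (tripleMap α β a b c) := (h.equiv hα hβ hγ).surjective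

/-- The product transported to the double depends only on α, β, γ, so passing from one
parametrization to the other is multiplicative. -/
theorem exists_aut [NeZero (2 : K)] (hα : α ≠ 0) (hβ : β ≠ 0) (hγ : γ ≠ 0)
    {a' b' c' : SplitOctonion K} (h' : IsTriple α β γ a' b' c') :
    ∃ g : autGroup K, ∀ p, (g : SplitOctonion K ≃ₗ[K] SplitOctonion K)
      (tripleMap α β a b c p) = tripleMap α β a' b' c' p := by
  have key : ∀ p, ((h.equiv hα hβ hγ).symm ≪≫ₗ h'.equiv hα hβ hγ) (tripleMap α β a b c p) =
      tripleMap α β a' b' c' p := by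
    intro p
    rw [LinearEquiv.trans_apply]
    exact congrArg (h'.equiv hα hβ hγ) ((h.equiv hα hβ hγ).symm_apply_apply p)
  refine ⟨⟨(h.equiv hα hβ hγ).symm ≪≫ₗ h'.equiv hα hβ hγ, ?_⟩, key⟩
  intro x y
  obtain ⟨p, rfl⟩ := h.tripleMap_surjective hα hβ hγ x
  obtain ⟨q, rfl⟩ := h.tripleMap_surjective hα hβ hγ y
  rw [h.tripleMap_mul, key, key, key, h'.tripleMap_mul]

end IsTriple

end Triples

/-! ### Invariance of the norm and transitivity on triples -/

section Automorphisms

variable {K : Type*} [Field K]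

instance : CoeFun (autGroup K) (fun _ => SplitOctonion K → SplitOctonion K) :=
  ⟨fun g => (g : SplitOctonion K ≃ₗ[K] SplitOctonion K)⟩

theorem aut_ext {g h : autGroup K} (e : ∀ x, g x = h x) : g = h :=
  Subtype.ext (LinearEquiv.ext e)

theorem aut_mul_apply (g h : autGroup K) (x : SplitOctonion K) : (g * h) x = g (h x) := rfl
theorem aut_one_apply (x : SplitOctonion K) : (1 : autGroup K) x = x := rfl
theorem aut_inv_apply_self (g : autGroup K) (x : SplitOctonion K) : g⁻¹ (g x) = x :=
  (g : SplitOctonion K ≃ₗ[K] SplitOctonion K).symm_apply_apply x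
theorem aut_apply_inv_self (g : autGroup K) (x : SplitOctonion K) : g (g⁻¹ x) = x :=
  (g : SplitOctonion K ≃ₗ[K] SplitOctonion K).apply_symm_apply x
theorem aut_map_mul (g : autGroup K) (x y : SplitOctonion K) : g (x * y) = g x * g y :=
  g.2 x y
theorem aut_map_add (g : autGroup K) (x y : SplitOctonion K) : g (x + y) = g x + g y :=
  map_add (g : SplitOctonion K ≃ₗ[K] SplitOctonion K) x y
theorem aut_map_sub (g : autGroup K) (x y : SplitOctonion K) : g (x - y) = g x - g y :=
  map_sub (g : SplitOctonion K ≃ₗ[K] SplitOctonion K) x y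
theorem aut_map_neg (g : autGroup K) (x : SplitOctonion K) : g (-x) = -g x :=
  map_neg (g : SplitOctonion K ≃ₗ[K] SplitOctonion K) x
theorem aut_map_smul (g : autGroup K) (r : K) (x : SplitOctonion K) : g (r • x) = r • g x :=
  map_smul (g : SplitOctonion K ≃ₗ[K] SplitOctonion K) r x
theorem aut_injective (g : autGroup K) : Function.Injective g :=
  (g : SplitOctonion K ≃ₗ[K] SplitOctonion K).injective

theorem aut_map_one (g : autGroup K) : g 1 = 1 := by
  have h : g (1 * g⁻¹ 1) = g 1 * g (g⁻¹ 1) := aut_map_mul g _ _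
  rwa [one_mul, aut_apply_inv_self, mul_one, eq_comm] at h

/-- Both the image of the quadratic equation of x and the quadratic equation of g x hold for g x.
Comparing coefficients works unless g x is scalar, and then x is the same scalar. -/
theorem aut_tr_nrm (g : autGroup K) (x : SplitOctonion K) :
    tr (g x) = tr x ∧ nrm (g x) = nrm x := by
  have h1 := mul_self (g x)
  rw [← aut_map_mul, mul_self, aut_map_sub, aut_map_smul, aut_map_smul, aut_map_one] at h1
  have h2 : (tr (g x) - tr x) • g x = (nrm (g x) - nrm x) • 1 := by
    rw [sub_smul, sub_smul, sub_eq_sub_iff_sub_eq_sub]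
    exact h1.symm
  have h3 : tr (g x) = tr x := by
    by_contra hne
    have hne' := sub_ne_zero.mpr hne
    have h4 : g x = ((tr (g x) - tr x)⁻¹ * (nrm (g x) - nrm x)) • 1 := by
      rw [mul_smul, ← h2, smul_smul, inv_mul_cancel₀ hne', one_smul]
    have h5 : x = ((tr (g x) - tr x)⁻¹ * (nrm (g x) - nrm x)) • 1 := by
      apply aut_injective g
      rw [aut_map_smul, aut_map_one]
      exact h4
    exact hne (congrArg tr (h4.trans h5.symm))
  refine ⟨h3, ?_⟩
  rw [h3, sub_self, zero_smul] at h2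
  have : (nrm (g x) - nrm x) • (1 : SplitOctonion K) = (0 : K) • 1 := by rw [← h2, zero_smul]
  exact sub_eq_zero.mp (smul_one_injective this)

theorem aut_tr (g : autGroup K) (x : SplitOctonion K) : tr (g x) = tr x := (aut_tr_nrm g x).1
theorem aut_nrm (g : autGroup K) (x : SplitOctonion K) : nrm (g x) = nrm x := (aut_tr_nrm g x).2
theorem aut_bil (g : autGroup K) (x y : SplitOctonion K) : bil (g x) (g y) = bil x y := by
  have h1 := nrm_add (g x) (g y)
  rw [← aut_map_add, aut_nrm, aut_nrm, aut_nrm, nrm_add] at h1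
  linear_combination -h1

theorem aut_quatMap (g : autGroup K) {α β : K} (a b : SplitOctonion K) (q : ℍ[K,α,β]) :
    g (quatMap α β a b q) = quatMap α β (g a) (g b) q := by
  simp only [quatMap_apply, aut_map_add, aut_map_smul, aut_map_mul, aut_map_one]

theorem aut_tripleMap (g : autGroup K) {α β : K} (a b c : SplitOctonion K)
    (p : ℍ[K,α,β] × ℍ[K,α,β]) :
    g (tripleMap α β a b c p) = tripleMap α β (g a) (g b) (g c) p := by
  simp only [tripleMap_apply, aut_map_add, aut_map_mul, aut_quatMap]

namespace IsTriple

variable {α β γ : K} {a b c : SplitOctonion K} (h : IsTriple α β γ a b c)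
include h

theorem map (g : autGroup K) : IsTriple α β γ (g a) (g b) (g c) where
  sq_left := by rw [← aut_map_mul, h.sq_left, aut_map_smul, aut_map_one]
  sq_right := by rw [← aut_map_mul, h.sq_right, aut_map_smul, aut_map_one]
  tr_left := by rw [aut_tr, h.tr_left]
  tr_right := by rw [aut_tr, h.tr_right]
  bil_eq := by rw [aut_bil, h.bil_eq]
  sq_last := by rw [← aut_map_mul, h.sq_last, aut_map_smul, aut_map_one]
  tr_last := by rw [aut_tr, h.tr_last]
  bil_last_left := by rw [aut_bil, h.bil_last_left]
  bil_last_right := by rw [aut_bil, h.bil_last_right]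
  bil_last_mul := by rw [← aut_map_mul, aut_bil, h.bil_last_mul]

theorem aut_ext [NeZero (2 : K)] (hα : α ≠ 0) (hβ : β ≠ 0) (hγ : γ ≠ 0) {g g' : autGroup K}
    (ha : g a = g' a) (hb : g b = g' b) (hc : g c = g' c) : g = g' := by
  apply SplitOctonion.aut_ext
  intro x
  obtain ⟨p, rfl⟩ := h.tripleMap_surjective hα hβ hγ x
  rw [aut_tripleMap, aut_tripleMap, ha, hb, hc]

theorem exists_aut_apply [NeZero (2 : K)] (hα : α ≠ 0) (hβ : β ≠ 0) (hγ : γ ≠ 0)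
    {a' b' c' : SplitOctonion K} (h' : IsTriple α β γ a' b' c') :
    ∃ g : autGroup K, g a = a' ∧ g b = b' ∧ g c = c' := by
  obtain ⟨g, hg⟩ := h.exists_aut hα hβ hγ h'
  refine ⟨g, ?_, ?_, ?_⟩
  · simpa [tripleMap_apply, quatMap_apply] using hg (⟨0, 1, 0, 0⟩, 0)
  · simpa [tripleMap_apply, quatMap_apply] using hg (⟨0, 0, 1, 0⟩, 0)
  · simpa [tripleMap_apply, quatMap_apply] using hg (0, ⟨1, 0, 0, 0⟩)

end IsTriple

end Automorphisms

end SplitOctonion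

namespace SplitOctonion

open Matrix

/-! ### Zorn vector matrices and the action of SL₃ -/

section Zorn

variable {K : Type*} [Field K]

/-- The octonion with prescribed Zorn coordinates: two scalars and two vectors. -/
def zorn (α β : K) (u v : Fin 3 → K) : SplitOctonion K :=
  ⟨!![α, u 0; v 0, β], !![u 1, -v 2; u 2, v 1]⟩

/-- The first vector part of an octonion. -/
def uvec (x : SplitOctonion K) : Fin 3 → K := ![x.fst 0 1, x.snd 0 0, x.snd 1 0]

/-- The second vector part of an octonion. -/
def vvec (x : SplitOctonion K) : Fin 3 → K := ![x.fst 1 0, x.snd 1 1, -x.snd 0 1]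

theorem uvec_zorn (α β : K) (u v : Fin 3 → K) : uvec (zorn α β u v) = u := by
  ext i; fin_cases i <;> simp [uvec, zorn]
theorem vvec_zorn (α β : K) (u v : Fin 3 → K) : vvec (zorn α β u v) = v := by
  ext i; fin_cases i <;> simp [vvec, zorn]
theorem zorn_fst00 (α β : K) (u v : Fin 3 → K) : (zorn α β u v).fst 0 0 = α := rfl
theorem zorn_fst11 (α β : K) (u v : Fin 3 → K) : (zorn α β u v).fst 1 1 = β := rfl
theorem zorn_eta (x : SplitOctonion K) :
    zorn (x.fst 0 0) (x.fst 1 1) (uvec x) (vvec x) = x := by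
  apply ext_coords <;> simp [zorn, uvec, vvec]

theorem zorn_add (α β α' β' : K) (u v u' v' : Fin 3 → K) :
    zorn α β u v + zorn α' β' u' v' = zorn (α + α') (β + β') (u + u') (v + v') := by
  apply ext_coords <;> simp [zorn, fst_add, snd_add]; ring

theorem zorn_smul (r α β : K) (u v : Fin 3 → K) :
    r • zorn α β u v = zorn (r * α) (r * β) (r • u) (r • v) := by
  apply ext_coords <;> simp [zorn, fst_smul, snd_smul]

/-- The signs in `zorn` are arranged so that the product uses only dot and cross products, which
makes the SL₃ symmetry visible. -/
theorem zorn_mul (α β α' β' : K) (u v u' v' : Fin 3 → K) :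
    zorn α β u v * zorn α' β' u' v' = zorn (α * α' + u ⬝ᵥ v') (β * β' + v ⬝ᵥ u')
      (α • u' + β' • u + crossProduct v v') (α' • v + β • v' - crossProduct u u') := by
  apply ext_coords <;> simp [zorn, fst_mul00, fst_mul01, fst_mul10, fst_mul11, snd_mul00,
    snd_mul01, snd_mul10, snd_mul11, cross_apply, dotProduct, Fin.sum_univ_three] <;> ring

theorem bil_zorn (α β α' β' : K) (u v u' v' : Fin 3 → K) :
    bil (zorn α β u v) (zorn α' β' u' v') = α * β' + β * α' - u ⬝ᵥ v' - v ⬝ᵥ u' := by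
  simp [zorn, bil, dotProduct, Fin.sum_univ_three]; ring

theorem nrm_zorn (α β : K) (u v : Fin 3 → K) : nrm (zorn α β u v) = α * β - u ⬝ᵥ v := by
  simp [zorn, nrm, dotProduct, Fin.sum_univ_three]; ring

theorem tr_zorn (α β : K) (u v : Fin 3 → K) : tr (zorn α β u v) = α + β := by
  simp [zorn, tr]

theorem one_eq_zorn : (1 : SplitOctonion K) = zorn 1 1 0 0 := by
  apply ext_coords <;> simp [zorn, fst_one, snd_one]

/-- The special linear group of degree three. -/
abbrev SL₃ (K : Type*) [Field K] := Matrix.SpecialLinearGroup (Fin 3) K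

/-- The linear action of a `3 × 3` matrix of determinant one on the octonions. -/
def rhoLin (M : SL₃ K) : SplitOctonion K →ₗ[K] SplitOctonion K where
  toFun x := zorn (x.fst 0 0) (x.fst 1 1) ((M : Matrix (Fin 3) (Fin 3) K) *ᵥ uvec x)
    (vvec x ᵥ* ((M⁻¹ : SL₃ K) : Matrix (Fin 3) (Fin 3) K))
  map_add' x y := by
    have hu : uvec (x + y) = uvec x + uvec y := by
      ext i; fin_cases i <;> simp [uvec, fst_add, snd_add]
    have hv : vvec (x + y) = vvec x + vvec y := by
      ext i; fin_cases i <;> simp [vvec, fst_add, snd_add]; ring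
    rw [hu, hv, mulVec_add, add_vecMul, zorn_add]; rfl
  map_smul' r x := by
    have hu : uvec (r • x) = r • uvec x := by
      ext i; fin_cases i <;> simp [uvec, fst_smul, snd_smul]
    have hv : vvec (r • x) = r • vvec x := by
      ext i; fin_cases i <;> simp [vvec, fst_smul, snd_smul]
    rw [hu, hv, mulVec_smul, smul_vecMul, RingHom.id_apply, zorn_smul]; rfl

theorem rhoLin_zorn (M : SL₃ K) (α β : K) (u v : Fin 3 → K) :
    rhoLin M (zorn α β u v) = zorn α β ((M : Matrix (Fin 3) (Fin 3) K) *ᵥ u)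
      (v ᵥ* ((M⁻¹ : SL₃ K) : Matrix (Fin 3) (Fin 3) K)) := by
  simp only [rhoLin, LinearMap.coe_mk, AddHom.coe_mk, uvec_zorn, vvec_zorn]
  rfl

theorem rhoLin_mul (M N : SL₃ K) :
    rhoLin (M * N) = rhoLin M ∘ₗ rhoLin N := by
  ext1 x
  rw [← zorn_eta x, LinearMap.comp_apply, rhoLin_zorn, rhoLin_zorn, rhoLin_zorn, _root_.mul_inv_rev,
    Matrix.SpecialLinearGroup.coe_mul, Matrix.SpecialLinearGroup.coe_mul, mulVec_mulVec, vecMul_vecMul]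

theorem rhoLin_one : rhoLin (1 : SL₃ K) = LinearMap.id := by
  ext1 x
  rw [← zorn_eta x, rhoLin_zorn]
  simp

/-- A matrix and its contragredient preserve the dot product and carry cross products to cross
products when the determinant is 1. With the inverse written as the adjugate, these are polynomial
identities modulo det M = 1. -/
theorem rhoLin_map_mul (M : SL₃ K) (x y : SplitOctonion K) :
    rhoLin M (x * y) = rhoLin M x * rhoLin M y := by
  have hM : (M : Matrix (Fin 3) (Fin 3) K).det = 1 := M.2
  rw [← zorn_eta x, ← zorn_eta y, zorn_mul, rhoLin_zorn, rhoLin_zorn, rhoLin_zorn, zorn_mul]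
  generalize uvec x = u
  generalize vvec x = v
  generalize uvec y = u'
  generalize vvec y = v'
  simp only [Matrix.SpecialLinearGroup.coe_inv]
  generalize (M : Matrix (Fin 3) (Fin 3) K) = M at hM ⊢
  rw [det_fin_three] at hM
  congr 1
  · simp only [adjugate_fin_three, dotProduct, mulVec, vecMul,
      Fin.sum_univ_three]
    simp
    linear_combination (-(u 0 * v' 0 + u 1 * v' 1 + u 2 * v' 2)) * hM
  · simp only [adjugate_fin_three, dotProduct, mulVec, vecMul,
      Fin.sum_univ_three]
    simp
    linear_combination (-(u' 0 * v 0 + u' 1 * v 1 + u' 2 * v 2)) * hM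
  · ext i
    fin_cases i
    all_goals
      simp only [adjugate_fin_three, dotProduct, mulVec, vecMul,
        Fin.sum_univ_three, cross_apply]
      simp [mulVec, dotProduct, Fin.sum_univ_three]
    -- The coefficient of the determinant relation is, up to sign, the matching coordinate of M(v ×
    -- v').
    · linear_combination (-(M 0 0 * (v 1 * v' 2 - v 2 * v' 1) +
          M 0 1 * (v 2 * v' 0 - v 0 * v' 2) + M 0 2 * (v 0 * v' 1 - v 1 * v' 0))) * hM
    · linear_combination (-(M 1 0 * (v 1 * v' 2 - v 2 * v' 1) +
          M 1 1 * (v 2 * v' 0 - v 0 * v' 2) + M 1 2 * (v 0 * v' 1 - v 1 * v' 0))) * hM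
    · linear_combination (-(M 2 0 * (v 1 * v' 2 - v 2 * v' 1) +
          M 2 1 * (v 2 * v' 0 - v 0 * v' 2) + M 2 2 * (v 0 * v' 1 - v 1 * v' 0))) * hM
  · ext i
    fin_cases i <;>
    · simp only [adjugate_fin_three, dotProduct, mulVec, vecMul,
        Fin.sum_univ_three, cross_apply]
      simp [vecHead, vecTail]
      ring

/-- The action of `SL₃` by automorphisms of the split octonions. -/
def rho : SL₃ K →* autGroup K where
  toFun M := ⟨LinearEquiv.ofLinearMap (rhoLin M) (rhoLin M⁻¹)
    (by rw [← rhoLin_mul, mul_inv_cancel, rhoLin_one])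
    (by rw [← rhoLin_mul, inv_mul_cancel, rhoLin_one]), rhoLin_map_mul M⟩
  map_one' := aut_ext fun x => congrArg (fun f => f x) rhoLin_one
  map_mul' M N := aut_ext fun x => congrArg (fun f => f x) (rhoLin_mul M N)

theorem rho_zorn (M : SL₃ K) (α β : K) (u v : Fin 3 → K) :
    rho M (zorn α β u v) = zorn α β ((M : Matrix (Fin 3) (Fin 3) K) *ᵥ u)
      (v ᵥ* ((M⁻¹ : SL₃ K) : Matrix (Fin 3) (Fin 3) K)) :=
  rhoLin_zorn M α β u v

/-- The diagonal idempotent. -/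
abbrev e₁ : SplitOctonion K := zorn 1 0 0 0

/-- Fixing the idempotent means preserving its Peirce decomposition, so g acts separately on the two
vector parts. The norm form makes the two actions contragredient, and compatibility with cross
products forces determinant 1. -/
theorem mem_range_rho {g : autGroup K} (hg : g e₁ = e₁) : g ∈ (rho (K := K)).range := by
  have hg2 : g (zorn 0 1 0 0) = zorn 0 1 0 0 := by
    have h : (zorn 0 1 0 0 : SplitOctonion K) = 1 - e₁ := by
      rw [eq_sub_iff_add_eq, zorn_add, one_eq_zorn]; simp
    rw [h, aut_map_sub, aut_map_one, hg]
  have hU : ∀ u, ∃ w, g (zorn 0 0 u 0) = zorn 0 0 w 0 := by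
    intro u
    refine ⟨uvec (g (zorn 0 0 u 0)), ?_⟩
    have h1 : e₁ * g (zorn 0 0 u 0) = g (zorn 0 0 u 0) := by
      conv_lhs => rw [← hg]
      rw [← aut_map_mul, zorn_mul]; simp
    have h2 : g (zorn 0 0 u 0) * zorn 0 1 0 0 = g (zorn 0 0 u 0) := by
      conv_lhs => rw [← hg2]
      rw [← aut_map_mul, zorn_mul]; simp
    rw [← zorn_eta (g _), zorn_mul] at h1 h2
    have a1 := congrArg (fun x : SplitOctonion K => x.fst 1 1) h1
    have a2 := congrArg (fun x : SplitOctonion K => x.fst 0 0) h2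
    have a3 := congrArg vvec h1
    simp only [zorn_fst00, zorn_fst11, vvec_zorn] at a1 a2 a3
    simp at a1 a2 a3
    conv_lhs => rw [← zorn_eta (g _)]
    rw [← a1, ← a2, ← a3]
  have hV : ∀ u, ∃ w, g (zorn 0 0 0 u) = zorn 0 0 0 w := by
    intro u
    refine ⟨vvec (g (zorn 0 0 0 u)), ?_⟩
    have h1 : zorn 0 1 0 0 * g (zorn 0 0 0 u) = g (zorn 0 0 0 u) := by
      conv_lhs => rw [← hg2]
      rw [← aut_map_mul, zorn_mul]; simp
    have h2 : g (zorn 0 0 0 u) * e₁ = g (zorn 0 0 0 u) := by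
      conv_lhs => rw [← hg]
      rw [← aut_map_mul, zorn_mul]; simp
    rw [← zorn_eta (g _), zorn_mul] at h1 h2
    have a1 := congrArg (fun x : SplitOctonion K => x.fst 1 1) h2
    have a2 := congrArg (fun x : SplitOctonion K => x.fst 0 0) h1
    have a3 := congrArg uvec h1
    simp only [zorn_fst00, zorn_fst11, uvec_zorn] at a1 a2 a3
    simp at a1 a2 a3
    conv_lhs => rw [← zorn_eta (g _)]
    rw [← a1, ← a2, ← a3]
  choose p hp using hU
  choose q hq using hV
  have hB : ∀ u v, p u ⬝ᵥ q v = u ⬝ᵥ v := by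
    intro u v
    have := aut_bil g (zorn 0 0 u 0) (zorn 0 0 0 v)
    rw [hp, hq, bil_zorn, bil_zorn] at this
    simpa using this
  have hX : ∀ u u', q (crossProduct u u') = crossProduct (p u) (p u') := by
    intro u u'
    have := aut_map_mul g (zorn 0 0 u 0) (zorn 0 0 u' 0)
    rw [hp, hp, zorn_mul, zorn_mul] at this
    have h0 : (zorn (0 * 0 + u ⬝ᵥ 0) (0 * 0 + 0 ⬝ᵥ u') ((0 : K) • u' + (0 : K) • u +
        crossProduct (0 : Fin 3 → K) 0) ((0 : K) • 0 + (0 : K) • 0 - crossProduct u u')) =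
        -zorn 0 0 0 (crossProduct u u') := by
      rw [← neg_one_smul K, zorn_smul]; simp
    rw [h0, aut_map_neg, hq] at this
    have h2 := congrArg vvec this
    rw [← neg_one_smul K, zorn_smul, vvec_zorn, vvec_zorn] at h2
    simpa only [neg_smul, one_smul, zero_smul, smul_zero, add_zero, zero_sub, zero_add,
      neg_inj] using h2
  have hpl : ∀ u w : Fin 3 → K, ∀ r : K, p (r • u + w) = r • p u + p w := by
    intro u w r
    have : g (r • zorn 0 0 u 0 + zorn 0 0 w 0) = r • g (zorn 0 0 u 0) + g (zorn 0 0 w 0) := by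
      rw [aut_map_add, aut_map_smul]
    rw [hp, hp, zorn_smul, zorn_smul, zorn_add, zorn_add] at this
    have h2 := congrArg uvec this
    simp only [mul_zero, add_zero, smul_zero, hp, uvec_zorn] at h2
    exact h2
  have hp0 : p 0 = 0 := by simpa using hpl 0 0 (-1)
  let P : (Fin 3 → K) →ₗ[K] (Fin 3 → K) :=
    { toFun := p
      map_add' := fun u w => by simpa using hpl u w 1
      map_smul' := fun r u => by simpa [hp0] using hpl u 0 r }
  let M := LinearMap.toMatrix' P
  have hM : ∀ u, M *ᵥ u = p u := fun u => by
    rw [← toLin'_apply, toLin'_toMatrix']; rfl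
  -- The determinant is the triple product of the images of the three basis vectors.
  have hdet : M.det = 1 := by
    have h1 := hB (Pi.single 0 1) (crossProduct (Pi.single 1 1) (Pi.single 2 1))
    rw [hX, ← hM, ← hM, ← hM] at h1
    rw [det_fin_three]
    simp [cross_apply, dotProduct, Fin.sum_univ_three] at h1
    linear_combination h1
  obtain ⟨A, hA⟩ : ∃ A : SL₃ K, (A : Matrix (Fin 3) (Fin 3) K) = M :=
    ⟨⟨M, hdet⟩, rfl⟩
  refine ⟨A, aut_ext fun x => ?_⟩
  have hqv : ∀ v, v ᵥ* ((A⁻¹ : SL₃ K) : Matrix (Fin 3) (Fin 3) K) = q v := by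
    intro v
    have h1 : q v ᵥ* M = v := by
      ext i
      have := hB (Pi.single i 1) v
      rw [← hM] at this
      simp only [single_one_dotProduct] at this
      rw [← this, dotProduct_comm, dotProduct_mulVec]
      simp
    have h2 : M * ((A⁻¹ : SL₃ K) : Matrix (Fin 3) (Fin 3) K) = 1 := by
      have := congrArg (fun A : SL₃ K => (A : Matrix (Fin 3) (Fin 3) K))
        (mul_inv_cancel A)
      simpa only [Matrix.SpecialLinearGroup.coe_mul, Matrix.SpecialLinearGroup.coe_one, hA] using this
    conv_lhs => rw [← h1]
    rw [vecMul_vecMul, h2, vecMul_one]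
  have hsum : ∀ (α β : K) (u v : Fin 3 → K), zorn α β u v =
      α • e₁ + β • zorn 0 1 0 0 + zorn 0 0 u 0 + zorn 0 0 0 v := by
    intro α β u v
    simp [zorn_smul, zorn_add]
  rw [← zorn_eta x, rho_zorn, hqv, hA, hM]
  conv_rhs => rw [hsum]
  rw [aut_map_add, aut_map_add, aut_map_add, aut_map_smul, aut_map_smul, hg, hg2, hp, hq, ← hsum]

end Zorn

end SplitOctonion

namespace SplitOctonion

open Matrix

/-! ### The diagonal torus and the centralizer of its two-torsion -/

section Torus

variable {K : Type*} [Field K]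

theorem torusElt_zorn (β γ : Kˣ) (a b : K) (u v : Fin 3 → K) :
    torusElt β γ (zorn a b u v) = zorn a b
      ![(β : K) * γ * u 0, (γ : K)⁻¹ * u 1, (β : K)⁻¹ * u 2]
      ![(β : K)⁻¹ * (γ : K)⁻¹ * v 0, (γ : K) * v 1, (β : K) * v 2] := by
  apply ext_coords <;> simp [torusElt, diagMap, zorn]

theorem sElt_zorn (a b : K) (u v : Fin 3 → K) :
    sElt K (zorn a b u v) = zorn b a ![v 0, v 1, -v 2] ![u 0, u 1, -u 2] := by
  apply ext_coords <;> simp [sElt, revMap_apply, zorn]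

/-- Automorphisms are equal if they agree on Zorn coordinates. -/
theorem aut_ext_zorn {g h : autGroup K} (e : ∀ a b u v, g (zorn a b u v) = h (zorn a b u v)) :
    g = h :=
  aut_ext fun x => by rw [← zorn_eta x]; exact e _ _ _ _

theorem torusElt_mul (β γ β' γ' : Kˣ) :
    torusElt β γ * torusElt β' γ' = torusElt (β * β') (γ * γ') := by
  refine aut_ext_zorn fun a b u v => ?_
  rw [aut_mul_apply, torusElt_zorn, torusElt_zorn, torusElt_zorn]
  congr 1 <;> ext i <;> fin_cases i <;> simp <;> ring

theorem torusElt_one : torusElt (1 : Kˣ) 1 = 1 := by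
  refine aut_ext_zorn fun a b u v => ?_
  rw [torusElt_zorn, aut_one_apply]
  congr 1 <;> ext i <;> fin_cases i <;> simp

theorem torusElt_inv (β γ : Kˣ) : (torusElt β γ)⁻¹ = torusElt β⁻¹ γ⁻¹ := by
  rw [inv_eq_iff_mul_eq_one, torusElt_mul, mul_inv_cancel, mul_inv_cancel, torusElt_one]

theorem torusElt_injective {β γ β' γ' : Kˣ} (h : torusElt β γ = torusElt β' γ') :
    β = β' ∧ γ = γ' := by
  have h1 := congrArg (fun g : autGroup K => vvec (g (zorn 0 0 0 1))) h
  simp only [torusElt_zorn, vvec_zorn] at h1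
  have h2 := congrFun h1 1
  have h3 := congrFun h1 2
  simp at h2 h3
  exact ⟨Units.ext h3, Units.ext h2⟩

theorem sElt_mul_self : sElt K * sElt K = 1 := by
  refine aut_ext_zorn fun a b u v => ?_
  rw [aut_mul_apply, sElt_zorn, sElt_zorn, aut_one_apply]
  congr 1 <;> ext i <;> fin_cases i <;> simp

theorem sElt_mul_torusElt (β γ : Kˣ) :
    sElt K * torusElt β γ = torusElt β⁻¹ γ⁻¹ * sElt K := by
  refine aut_ext_zorn fun a b u v => ?_
  rw [aut_mul_apply, aut_mul_apply, sElt_zorn, torusElt_zorn, torusElt_zorn, sElt_zorn]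
  congr 1 <;> ext i <;> fin_cases i <;> simp

/-- The diagonal matrices of determinant one. -/
def torusSL (β γ : Kˣ) : SL₃ K :=
  ⟨diagonal ![(β : K) * γ, (γ : K)⁻¹, (β : K)⁻¹], by
    rw [det_diagonal, Fin.prod_univ_three]
    have hβ := β.ne_zero
    have hγ := γ.ne_zero
    simp⟩

theorem coe_torusSL (β γ : Kˣ) : (torusSL β γ : Matrix (Fin 3) (Fin 3) K) =
    diagonal ![(β : K) * γ, (γ : K)⁻¹, (β : K)⁻¹] := rfl

theorem torusSL_inv (β γ : Kˣ) : (torusSL β γ)⁻¹ = torusSL β⁻¹ γ⁻¹ := by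
  rw [inv_eq_iff_mul_eq_one]
  apply Subtype.ext
  rw [Matrix.SpecialLinearGroup.coe_mul, coe_torusSL, coe_torusSL, diagonal_mul_diagonal,
    Matrix.SpecialLinearGroup.coe_one, ← diagonal_one]
  congr 1
  have hβ := β.ne_zero
  have hγ := γ.ne_zero
  ext i; fin_cases i <;> simp
  field_simp

theorem rho_torusSL (β γ : Kˣ) : rho (torusSL β γ) = torusElt β γ := by
  refine aut_ext_zorn fun a b u v => ?_
  rw [rho_zorn, torusElt_zorn, torusSL_inv, coe_torusSL, coe_torusSL]
  congr 1 <;> ext i <;> fin_cases i <;> simp [mulVec_diagonal, vecMul_diagonal] <;> ring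

theorem exists_torusSL (D : Fin 3 → K) (hD : (diagonal D).det = 1) :
    ∃ β γ : Kˣ, (⟨diagonal D, hD⟩ : SL₃ K) = torusSL β γ := by
  have hD' := hD
  rw [det_diagonal, Fin.prod_univ_three] at hD'
  have h1 : D 1 ≠ 0 := fun h => by simp [h] at hD'
  have h2 : D 2 ≠ 0 := fun h => by simp [h] at hD'
  refine ⟨(Units.mk0 _ h2)⁻¹, (Units.mk0 _ h1)⁻¹, Subtype.ext ?_⟩
  rw [coe_torusSL]
  change diagonal D = _
  congr 1
  ext i; fin_cases i
  · simp
    field_simp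
    linear_combination hD'
  · simp
  · simp

/-- The involution negating the second entry of the standard triple. -/
abbrev sigmaB (K : Type*) [Field K] : autGroup K := torusElt (-1) 1

/-- The involution negating the third entry of the standard triple. -/
abbrev sigmaC (K : Type*) [Field K] : autGroup K := torusElt (-1) (-1)

theorem sElt_comm_sigmaB : Commute (sElt K) (sigmaB K) := by
  rw [commute_iff_eq, sElt_mul_torusElt]; simp

theorem sElt_comm_sigmaC : Commute (sElt K) (sigmaC K) := by
  rw [commute_iff_eq, sElt_mul_torusElt]; simp

theorem torusElt_comm (β γ β' γ' : Kˣ) : Commute (torusElt β γ) (torusElt β' γ') := by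
  rw [commute_iff_eq, torusElt_mul, torusElt_mul, mul_comm β, mul_comm γ]

variable [NeZero (2 : K)]

theorem eq_zero_of_eq_neg {x : K} (h : x = -x) : x = 0 := by
  have : (2 : K) * x = 0 := by linear_combination h
  exact (mul_eq_zero.mp this).resolve_left (NeZero.ne _)

/-- The two involutions act on the first vector part by diag(−1, 1, −1) and diag(1, −1, −1). Their
joint characters on the three coordinates are distinct, so a commuting matrix is diagonal. -/
theorem eq_torusElt_of_commute {g : autGroup K} (hB : Commute g (sigmaB K))
    (hC : Commute g (sigmaC K)) (h1 : g e₁ = e₁) : ∃ β γ, g = torusElt β γ := by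
  obtain ⟨M, rfl⟩ := mem_range_rho h1
  have hB' : ∀ u, (M : Matrix (Fin 3) (Fin 3) K) *ᵥ ![-u 0, u 1, -u 2] =
      ![-(M.1 *ᵥ u) 0, (M.1 *ᵥ u) 1, -(M.1 *ᵥ u) 2] := by
    intro u
    have := congrArg (fun g : autGroup K => uvec (g (zorn 0 0 u 0))) hB.eq
    simp only [aut_mul_apply, torusElt_zorn, rho_zorn, uvec_zorn] at this
    simpa using this
  have hC' : ∀ u, (M : Matrix (Fin 3) (Fin 3) K) *ᵥ ![u 0, -u 1, -u 2] =
      ![(M.1 *ᵥ u) 0, -(M.1 *ᵥ u) 1, -(M.1 *ᵥ u) 2] := by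
    intro u
    have := congrArg (fun g : autGroup K => uvec (g (zorn 0 0 u 0))) hC.eq
    simp only [aut_mul_apply, torusElt_zorn, rho_zorn, uvec_zorn] at this
    simpa using this
  have hd : ∃ D, (M : Matrix (Fin 3) (Fin 3) K) = diagonal D := by
    refine ⟨fun i => M.1 i i, ?_⟩
    have b0 := hB' ![1, 0, 0]
    have b1 := hB' ![0, 1, 0]
    have b2 := hB' ![0, 0, 1]
    have c0 := hC' ![1, 0, 0]
    have c1 := hC' ![0, 1, 0]
    have c2 := hC' ![0, 0, 1]
    have m01 : M.1 0 1 = 0 := eq_zero_of_eq_neg (by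
      have := congrFun b1 0
      simpa [mulVec, dotProduct, Fin.sum_univ_three] using this)
    have m10 : M.1 1 0 = 0 := eq_zero_of_eq_neg (by
      have := congrFun c0 1
      simpa [mulVec, dotProduct, Fin.sum_univ_three] using this)
    have m02 : M.1 0 2 = 0 := eq_zero_of_eq_neg (by
      have := (congrFun c2 0).symm
      simpa [mulVec, dotProduct, Fin.sum_univ_three] using this)
    have m20 : M.1 2 0 = 0 := eq_zero_of_eq_neg (by
      have := congrFun c0 2
      simpa [mulVec, dotProduct, Fin.sum_univ_three] using this)
    have m12 : M.1 1 2 = 0 := eq_zero_of_eq_neg (by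
      have := (congrFun b2 1).symm
      simpa [mulVec, dotProduct, Fin.sum_univ_three] using this)
    have m21 : M.1 2 1 = 0 := eq_zero_of_eq_neg (by
      have := congrFun b1 2
      simpa [mulVec, dotProduct, Fin.sum_univ_three] using this)
    ext i j
    fin_cases i <;> fin_cases j <;> simp [m01, m10, m02, m20, m12, m21]
  obtain ⟨D, hD⟩ := hd
  have hdet : (diagonal D).det = 1 := hD ▸ M.2
  obtain ⟨β, γ, h⟩ := exists_torusSL D hdet
  refine ⟨β, γ, ?_⟩
  rw [← rho_torusSL, ← h]
  exact congrArg rho (Subtype.ext hD)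

/-- Both involutions fix the image of the idempotent, and no vector coordinate is fixed by both, so
the image is diagonal. Trace 1 and norm 0 leave two possibilities. -/
theorem apply_e₁_of_commute {g : autGroup K} (hB : Commute g (sigmaB K))
    (hC : Commute g (sigmaC K)) : g e₁ = e₁ ∨ g e₁ = zorn 0 1 0 0 := by
  have hB' := congrArg (fun g : autGroup K => g e₁) hB.eq
  have hC' := congrArg (fun g : autGroup K => g e₁) hC.eq
  simp only [aut_mul_apply, torusElt_zorn] at hB' hC'
  have z1 : ∀ p q r : K, ![p * (0 : Fin 3 → K) 0, q * (0 : Fin 3 → K) 1, r * (0 : Fin 3 → K) 2] =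
      0 := by
    intro p q r; ext i; fin_cases i <;> simp
  rw [z1, z1] at hB' hC'
  have hu : uvec (g e₁) = 0 := by
    have h1 := congrArg uvec hB'
    have h2 := congrArg uvec hC'
    rw [← zorn_eta (g e₁), torusElt_zorn, uvec_zorn, uvec_zorn] at h1 h2
    ext i; fin_cases i
    · exact eq_zero_of_eq_neg (by simpa using congrFun h1 0)
    · exact eq_zero_of_eq_neg (by simpa using congrFun h2 1)
    · exact eq_zero_of_eq_neg (by simpa using congrFun h1 2)
  have hv : vvec (g e₁) = 0 := by
    have h1 := congrArg vvec hB'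
    have h2 := congrArg vvec hC'
    rw [← zorn_eta (g e₁), torusElt_zorn, vvec_zorn, vvec_zorn] at h1 h2
    ext i; fin_cases i
    · exact eq_zero_of_eq_neg (by simpa using congrFun h1 0)
    · exact eq_zero_of_eq_neg (by simpa using congrFun h2 1)
    · exact eq_zero_of_eq_neg (by simpa using congrFun h1 2)
  have ht := aut_tr g e₁
  have hn := aut_nrm g e₁
  rw [← zorn_eta (g e₁), hu, hv] at ht hn ⊢
  rw [tr_zorn, tr_zorn] at ht
  rw [nrm_zorn, nrm_zorn] at hn
  simp at ht hn
  rcases hn with h | h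
  · right; rw [h] at ht ⊢; simp at ht; rw [ht]
  · left; rw [h] at ht ⊢; simp at ht; rw [ht]

theorem eq_torusElt_or_of_commute {g : autGroup K} (hB : Commute g (sigmaB K))
    (hC : Commute g (sigmaC K)) :
    (∃ β γ, g = torusElt β γ) ∨ (∃ β γ, g = torusElt β γ * sElt K) := by
  rcases apply_e₁_of_commute hB hC with h | h
  · exact Or.inl (eq_torusElt_of_commute hB hC h)
  · right
    obtain ⟨β, γ, e⟩ := eq_torusElt_of_commute (g := g * sElt K)
      (hB.mul_left sElt_comm_sigmaB) (hC.mul_left sElt_comm_sigmaC) (by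
        have : sElt K e₁ = 1 - e₁ := by
          rw [sElt_zorn, eq_sub_iff_add_eq, zorn_add, one_eq_zorn]
          simp only [zero_add, add_zero]
          congr 1 <;> (ext i; fin_cases i <;> simp)
        rw [aut_mul_apply, this, aut_map_sub, aut_map_one, h, sub_eq_iff_eq_add, zorn_add,
          one_eq_zorn]
        simp)
    refine ⟨β, γ, ?_⟩
    rw [← e, mul_assoc, sElt_mul_self, mul_one]

/-- Elements centralizing the two-torsion of the torus act on the torus trivially or
by inversion. -/
theorem conj_torusElt_of_commute {g : autGroup K} (hB : Commute g (sigmaB K))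
    (hC : Commute g (sigmaC K)) :
    (∀ β γ, g * torusElt β γ * g⁻¹ = torusElt β γ) ∨
    (∀ β γ, g * torusElt β γ * g⁻¹ = torusElt β⁻¹ γ⁻¹) := by
  rcases eq_torusElt_or_of_commute hB hC with ⟨β, γ, rfl⟩ | ⟨β, γ, rfl⟩
  · left
    intro β' γ'
    rw [mul_inv_eq_iff_eq_mul]
    exact torusElt_comm _ _ _ _
  · right
    intro β' γ'
    rw [mul_inv_eq_iff_eq_mul, mul_assoc, sElt_mul_torusElt, ← mul_assoc, ← mul_assoc,
      (torusElt_comm β γ _ _).eq]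

/-- The torus consists of the squares of the elements centralizing its two-torsion. -/
theorem exists_torusElt_iff [IsAlgClosed K] {t : autGroup K} : (∃ β γ, t = torusElt β γ) ↔
    ∃ g : autGroup K, Commute g (sigmaB K) ∧ Commute g (sigmaC K) ∧ t = g * g := by
  constructor
  · rintro ⟨β, γ, rfl⟩
    have hs : ∀ x : Kˣ, ∃ y : Kˣ, x = y * y := by
      intro x
      obtain ⟨z, hz⟩ := IsAlgClosed.exists_eq_mul_self (x : K)
      have : z ≠ 0 := by rintro rfl; simp at hz
      exact ⟨Units.mk0 z this, Units.ext hz⟩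
    obtain ⟨b, rfl⟩ := hs β
    obtain ⟨c, rfl⟩ := hs γ
    exact ⟨torusElt b c, torusElt_comm _ _ _ _, torusElt_comm _ _ _ _, (torusElt_mul _ _ _ _).symm⟩
  · rintro ⟨g, hB, hC, rfl⟩
    rcases eq_torusElt_or_of_commute hB hC with ⟨β, γ, rfl⟩ | ⟨β, γ, rfl⟩
    · exact ⟨_, _, torusElt_mul _ _ _ _⟩
    -- Since s inverts the torus, every element of the coset of s squares to 1.
    · refine ⟨1, 1, ?_⟩
      rw [mul_assoc, ← mul_assoc (sElt K), sElt_mul_torusElt, mul_assoc, sElt_mul_self, mul_one,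
        torusElt_mul, mul_inv_cancel, mul_inv_cancel]

end Torus

end SplitOctonion

namespace SplitOctonion

/-! ### Coordinate rings and morphisms defined over a subfield -/

section Algebraic

variable {k K : Type*} [Field k] [Field K] [Algebra k K]

theorem stdBasis_repr_inl (x : SplitOctonion K) (p : Fin 2 × Fin 2) :
    (stdBasis K).repr x (Sum.inl p) = x.fst p.1 p.2 := by
  obtain ⟨a, b⟩ := p
  simp [stdBasis, linearEquivProd, equivProd, Matrix.stdBasis]

theorem stdBasis_repr_inr (x : SplitOctonion K) (p : Fin 2 × Fin 2) :
    (stdBasis K).repr x (Sum.inr p) = x.snd p.1 p.2 := by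
  obtain ⟨a, b⟩ := p
  simp [stdBasis, linearEquivProd, equivProd, Matrix.stdBasis]

theorem entry_eq (i j : (Fin 2 × Fin 2) ⊕ (Fin 2 × Fin 2)) (g : autGroup K) :
    entry i j g = (stdBasis K).repr (g (stdBasis K j)) i := by
  rw [entry, LinearMap.toMatrix_apply]
  rfl

theorem entry_inl (p : Fin 2 × Fin 2) (j : (Fin 2 × Fin 2) ⊕ (Fin 2 × Fin 2)) (g : autGroup K) :
    entry (Sum.inl p) j g = (g (stdBasis K j)).fst p.1 p.2 := by
  rw [entry_eq, stdBasis_repr_inl]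

theorem entry_inr (p : Fin 2 × Fin 2) (j : (Fin 2 × Fin 2) ⊕ (Fin 2 × Fin 2)) (g : autGroup K) :
    entry (Sum.inr p) j g = (g (stdBasis K j)).snd p.1 p.2 := by
  rw [entry_eq, stdBasis_repr_inr]

theorem entry_mul (i j : (Fin 2 × Fin 2) ⊕ (Fin 2 × Fin 2)) (g h : autGroup K) :
    entry i j (g * h) = ∑ l, entry i l g * entry l j h := by
  have := congrFun (congrFun (LinearMap.toMatrix_mul (stdBasis K)
    ((g : SplitOctonion K ≃ₗ[K] SplitOctonion K) : SplitOctonion K →ₗ[K] SplitOctonion K)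
    ((h : SplitOctonion K ≃ₗ[K] SplitOctonion K) : SplitOctonion K →ₗ[K] SplitOctonion K)) i) j
  rw [Matrix.mul_apply] at this
  exact this

/-- The determinant of an automorphism. -/
noncomputable def autDet (g : autGroup K) : K := LinearMap.det
  ((g : SplitOctonion K ≃ₗ[K] SplitOctonion K) : SplitOctonion K →ₗ[K] SplitOctonion K)

theorem autDet_mul (g h : autGroup K) : autDet (g * h) = autDet g * autDet h := by
  rw [autDet, autDet, autDet, ← map_mul]; rfl

theorem autDet_one : autDet (1 : autGroup K) = 1 := by
  rw [autDet]; exact LinearMap.det_id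

theorem entry_mem_coordRing (i j : (Fin 2 × Fin 2) ⊕ (Fin 2 × Fin 2)) :
    (fun g => entry i j g) ∈ coordRing k K :=
  Algebra.subset_adjoin (Or.inl ⟨(i, j), rfl⟩)

theorem autDet_mem_coordRing : (fun g : autGroup K => (autDet g)⁻¹) ∈ coordRing k K :=
  Algebra.subset_adjoin (Or.inr rfl)

/-- Pulling back functions along a map. -/
def pullback {X Y : Type*} (φ : X → Y) : (Y → K) →ₐ[k] (X → K) where
  toFun f := fun x => f (φ x)
  map_one' := rfl
  map_mul' _ _ := rfl
  map_zero' := rfl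
  map_add' _ _ := rfl
  commutes' _ := rfl

/-- A map pulls the coordinate ring back into a subalgebra as soon as it does so for the
generators. -/
theorem pullback_coordRing_mem {X : Type*} {φ : X → autGroup K} {S : Subalgebra k (X → K)}
    (he : ∀ i j, (fun x => entry i j (φ x)) ∈ S) (hd : (fun x => (autDet (φ x))⁻¹) ∈ S)
    {f : autGroup K → K} (hf : f ∈ coordRing k K) : (fun x => f (φ x)) ∈ S := by
  have : coordRing k K ≤ S.comap (pullback φ) := by
    refine Algebra.adjoin_le ?_
    rintro _ (⟨⟨i, j⟩, rfl⟩ | rfl)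
    · exact he i j
    · exact hd
  exact this hf

theorem DefinedOver.mul {θ φ : MulAut (autGroup K)} (hθ : DefinedOver k θ)
    (hφ : DefinedOver k φ) : DefinedOver k (θ * φ) :=
  fun f hf => hφ _ (hθ f hf)

theorem coordRing_le : ∀ f ∈ coordRing k K, f ∈ coordRing K K := by
  intro f hf
  refine Algebra.adjoin_induction (p := fun f _ => f ∈ coordRing K K) ?_ ?_ ?_ ?_ hf
  · rintro _ (⟨⟨i, j⟩, rfl⟩ | rfl)
    · exact entry_mem_coordRing i j
    · exact autDet_mem_coordRing
  · intro r
    exact Subalgebra.algebraMap_mem (coordRing K K) (algebraMap k K r)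
  · exact fun _ _ _ _ h1 h2 => add_mem h1 h2
  · exact fun _ _ _ _ h1 h2 => mul_mem h1 h2

/-- The coordinate rings over `k` and over `K` have the same generators; only the scalars change. -/
theorem DefinedOver.extend {θ : MulAut (autGroup K)} (hθ : DefinedOver k θ) :
    DefinedOver K θ := fun _ hf =>
  pullback_coordRing_mem (fun i j => coordRing_le _ (hθ _ (entry_mem_coordRing i j)))
    (coordRing_le _ (hθ _ autDet_mem_coordRing)) hf

theorem definedOver_conj {h : autGroup K} (hh : h ∈ rationalPoints k K) :
    DefinedOver k (MulAut.conj h) := by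
  intro f hf
  refine pullback_coordRing_mem (fun i j => ?_) ?_ hf
  · have hh' := inv_mem hh
    choose c hc using hh
    choose d hd using hh'
    have e : (fun g => entry i j (MulAut.conj h g)) =
        ∑ m, ∑ l, (c i l * d m j) • (fun g : autGroup K => entry l m g) := by
      funext g
      rw [MulAut.conj_apply, entry_mul]
      simp only [entry_mul, Finset.sum_apply, Pi.smul_apply, Finset.sum_mul, ← hc, ← hd]
      simp only [Algebra.smul_def, map_mul]
      refine Finset.sum_congr rfl fun m _ => Finset.sum_congr rfl fun l _ => ?_
      ring
    rw [e]
    exact sum_mem fun m _ => sum_mem fun l _ => Subalgebra.smul_mem _ (entry_mem_coordRing l m) _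
  · have e : (fun g => (autDet (MulAut.conj h g))⁻¹) = fun g => (autDet g)⁻¹ := by
      funext g
      have h1 : autDet h * autDet h⁻¹ = 1 := by rw [← autDet_mul, mul_inv_cancel, autDet_one]
      rw [MulAut.conj_apply, autDet_mul, autDet_mul]
      congr 1
      linear_combination autDet g * h1
    rw [e]
    exact autDet_mem_coordRing

theorem mem_rationalPoints_self (g : autGroup K) : g ∈ rationalPoints K K :=
  fun i j => ⟨entry i j g, rfl⟩

/-- An automorphism of the group `G` such that it and its inverse are morphisms of varieties. -/
def IsAlgebraicAut (θ : MulAut (autGroup K)) : Prop := DefinedOver K θ ∧ DefinedOver K θ⁻¹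

theorem IsAlgebraicAut.mul {θ φ : MulAut (autGroup K)} (hθ : IsAlgebraicAut θ)
    (hφ : IsAlgebraicAut φ) : IsAlgebraicAut (θ * φ) :=
  ⟨hθ.1.mul hφ.1, by rw [mul_inv_rev]; exact hφ.2.mul hθ.2⟩

theorem isAlgebraicAut_conj (h : autGroup K) : IsAlgebraicAut (MulAut.conj h) :=
  ⟨definedOver_conj (mem_rationalPoints_self h), by
    rw [← map_inv]; exact definedOver_conj (mem_rationalPoints_self _)⟩

end Algebraic

/-! ### Characters of the torus -/

section TorusCharacters

variable {K : Type*} [Field K]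

/-- The monomial character of the torus with exponents `i`, `j`. -/
def monomialChar (i j : ℤ) : Kˣ × Kˣ →* K :=
  (Units.coeHom K).comp ((zpowGroupHom i).comp (MonoidHom.fst Kˣ Kˣ) *
    (zpowGroupHom j).comp (MonoidHom.snd Kˣ Kˣ))

theorem monomialChar_apply (i j : ℤ) (t : Kˣ × Kˣ) :
    monomialChar i j t = ((t.1 ^ i * t.2 ^ j : Kˣ) : K) := rfl

/-- The submonoid of monomial characters. -/
def monomials (K : Type*) [Field K] : Submonoid (Kˣ × Kˣ → K) where
  carrier := {f | ∃ i j : ℤ, f = monomialChar i j}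
  one_mem' := ⟨0, 0, by funext t; simp [monomialChar_apply]⟩
  mul_mem' := by
    rintro _ _ ⟨i, j, rfl⟩ ⟨i', j', rfl⟩
    refine ⟨i + i', j + j', ?_⟩
    funext t
    simp only [Pi.mul_apply, monomialChar_apply, zpow_add, Units.val_mul]
    ring

/-- Monomials are closed under products, so the algebra they generate is their span. By Dedekind's
independence of characters, a character in that span is one of them. -/
theorem exists_monomialChar_of_mem_adjoin (φ : Kˣ × Kˣ →* K)
    (h : (φ : Kˣ × Kˣ → K) ∈ Algebra.adjoin K (monomials K : Set (Kˣ × Kˣ → K))) :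
    ∃ i j : ℤ, φ = monomialChar i j := by
  rw [← Subalgebra.mem_toSubmodule, Algebra.adjoin_eq_span, Submonoid.closure_eq] at h
  by_contra hne
  have hli := linearIndependent_monoidHom (Kˣ × Kˣ) K
  refine hli.notMem_span_image (s := {f | ∃ i j : ℤ, f = monomialChar i j}) (x := φ) hne ?_
  have e : (fun f : Kˣ × Kˣ →* K => (f : Kˣ × Kˣ → K)) ''
      {f | ∃ i j : ℤ, f = monomialChar i j} = (monomials K : Set (Kˣ × Kˣ → K)) := by
    ext f
    constructor
    · rintro ⟨_, ⟨i, j, rfl⟩, rfl⟩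
      exact ⟨i, j, rfl⟩
    · rintro ⟨i, j, rfl⟩
      exact ⟨_, ⟨i, j, rfl⟩, rfl⟩
  rw [e]
  exact h

/-- A torus element is a square t², and s conjugates t to its inverse. Hence det t = det t⁻¹, and
det t² = 1. -/
theorem autDet_torusElt [IsAlgClosed K] (β γ : Kˣ) : autDet (torusElt β γ) = 1 := by
  have hs : ∀ x : Kˣ, ∃ y : Kˣ, x = y * y := by
    intro x
    obtain ⟨z, hz⟩ := IsAlgClosed.exists_eq_mul_self (x : K)
    have : z ≠ 0 := by rintro rfl; simp at hz
    exact ⟨Units.mk0 z this, Units.ext hz⟩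
  obtain ⟨b, rfl⟩ := hs β
  obtain ⟨c, rfl⟩ := hs γ
  have h1 : autDet (sElt K) * autDet (sElt K) = 1 := by
    rw [← autDet_mul, sElt_mul_self, autDet_one]
  have h2 := congrArg autDet (sElt_mul_torusElt b c)
  have h3 : autDet (torusElt b⁻¹ c⁻¹) * autDet (torusElt b c) = 1 := by
    rw [← autDet_mul, ← torusElt_inv, inv_mul_cancel, autDet_one]
  rw [autDet_mul, autDet_mul] at h2
  rw [← torusElt_mul, autDet_mul]
  have h4 : autDet (torusElt b c) = autDet (torusElt b⁻¹ c⁻¹) := by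
    linear_combination autDet (sElt K) * h2 + (autDet (torusElt b⁻¹ c⁻¹) -
      autDet (torusElt b c)) * h1
  rw [← h3, ← h4]

theorem torusElt_fst (β γ : Kˣ) (x : SplitOctonion K) (a b : Fin 2) :
    (torusElt β γ x).fst a b =
      ((![![1, β * γ], ![β⁻¹ * γ⁻¹, 1]] : Fin 2 → Fin 2 → Kˣ) a b : K) * x.fst a b := rfl

theorem torusElt_snd (β γ : Kˣ) (x : SplitOctonion K) (a b : Fin 2) :
    (torusElt β γ x).snd a b =
      ((![![γ⁻¹, β], ![β⁻¹, γ]] : Fin 2 → Fin 2 → Kˣ) a b : K) * x.snd a b := rfl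

/-- Regular functions on `G` restrict to combinations of monomial characters on the torus. -/
theorem restrict_torus_mem [IsAlgClosed K] {f : autGroup K → K} (hf : f ∈ coordRing K K) :
    (fun t : Kˣ × Kˣ => f (torusElt t.1 t.2)) ∈
      Algebra.adjoin K (monomials K : Set (Kˣ × Kˣ → K)) := by
  refine pullback_coordRing_mem (φ := fun t : Kˣ × Kˣ => torusElt t.1 t.2) (fun i j => ?_) ?_ hf
  · have key : ∀ (c : K) (m n : ℤ), (fun t : Kˣ × Kˣ => ((t.1 ^ m * t.2 ^ n : Kˣ) : K) * c) ∈
        Algebra.adjoin K (monomials K : Set (Kˣ × Kˣ → K)) := by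
      intro c m n
      have : (fun t : Kˣ × Kˣ => ((t.1 ^ m * t.2 ^ n : Kˣ) : K) * c) =
          c • (monomialChar m n : Kˣ × Kˣ → K) := by
        funext t; simp only [Pi.smul_apply, monomialChar_apply, smul_eq_mul, mul_comm]
      rw [this]
      exact Subalgebra.smul_mem _ (Algebra.subset_adjoin
        (show _ ∈ (monomials K : Set (Kˣ × Kˣ → K)) from ⟨m, n, rfl⟩)) _
    rcases i with ⟨a, b⟩ | ⟨a, b⟩
    · simp only [entry_inl, torusElt_fst]
      fin_cases a <;> fin_cases b
      · simpa using key ((stdBasis K j).fst 0 0) 0 0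
      · simpa using key ((stdBasis K j).fst 0 1) 1 1
      · simpa using key ((stdBasis K j).fst 1 0) (-1) (-1)
      · simpa using key ((stdBasis K j).fst 1 1) 0 0
    · simp only [entry_inr, torusElt_snd]
      fin_cases a <;> fin_cases b
      · simpa using key ((stdBasis K j).snd 0 0) 0 (-1)
      · simpa using key ((stdBasis K j).snd 0 1) 1 0
      · simpa using key ((stdBasis K j).snd 1 0) (-1) 0
      · simpa using key ((stdBasis K j).snd 1 1) 0 1
  · simp only [autDet_torusElt, inv_one]
    exact one_mem _

variable [NeZero (2 : K)]

theorem neg_one_ne_one' : (-1 : K) ≠ 1 := fun h => by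
  have h2 : (1 : K) = 0 := eq_zero_of_eq_neg h.symm
  exact one_ne_zero h2

variable [IsAlgClosed K]

/-- Otherwise every unit would be killed by n = |a − b|, which fails for an n-th root of −1. This
works in every characteristic other than 2. -/
theorem eq_of_forall_zpow_eq {a b : ℤ} (h : ∀ x : Kˣ, x ^ a = x ^ b) : a = b := by
  by_contra hne
  have hn : 0 < (a - b).natAbs := Int.natAbs_pos.mpr (sub_ne_zero.mpr hne)
  have h1 : ∀ x : Kˣ, x ^ (a - b).natAbs = 1 := by
    intro x
    have h2 : x ^ (a - b) = 1 := by rw [zpow_sub, h x, mul_inv_cancel]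
    rcases Int.natAbs_eq (a - b) with e | e
    · rw [e, zpow_natCast] at h2; exact h2
    · rw [e, zpow_neg, inv_eq_one, zpow_natCast] at h2; exact h2
  obtain ⟨z, hz⟩ := IsAlgClosed.exists_pow_nat_eq (-1 : K) hn
  have hz0 : z ≠ 0 := by
    rintro rfl
    rw [zero_pow hn.ne'] at hz
    simp at hz
  have h2 := congrArg (Units.val) (h1 (Units.mk0 z hz0))
  rw [Units.val_pow_eq_pow_val, Units.val_mk0, hz] at h2
  exact neg_one_ne_one' h2

/-- An algebraic automorphism fixing the two-torsion of the torus preserves the torus, acting by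
monomials. -/
theorem exists_exponents {θ : MulAut (autGroup K)} (hθ : DefinedOver K θ)
    (hB : θ (sigmaB K) = sigmaB K) (hC : θ (sigmaC K) = sigmaC K) :
    ∃ i j m n : ℤ, ∀ β γ : Kˣ, θ (torusElt β γ) =
      torusElt (β ^ i * γ ^ j) (β ^ m * γ ^ n) := by
  have h1 : ∀ t : Kˣ × Kˣ, ∃ u : Kˣ × Kˣ, θ (torusElt t.1 t.2) = torusElt u.1 u.2 := by
    intro t
    -- The torus consists of the squares in the centralizer of two elements fixed by θ. This
    -- description is purely group-theoretic, so θ preserves the torus.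
    obtain ⟨g, gB, gC, e⟩ := exists_torusElt_iff.mp ⟨t.1, t.2, rfl⟩
    obtain ⟨β, γ, e'⟩ := exists_torusElt_iff.mpr ⟨θ g, by
      have := gB.map θ.toMonoidHom
      simpa [hB] using this, by
      have := gC.map θ.toMonoidHom
      simpa [hC] using this, rfl⟩
    refine ⟨(β, γ), ?_⟩
    rw [← e', e, map_mul]
  choose u hu using h1
  have hmul : ∀ s t, u (s * t) = u s * u t := by
    intro s t
    have : θ (torusElt s.1 s.2 * torusElt t.1 t.2) = torusElt (u s).1 (u s).2 *
        torusElt (u t).1 (u t).2 := by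
      rw [map_mul, hu, hu]
    rw [torusElt_mul, torusElt_mul] at this
    have h2 := torusElt_injective ((hu (s * t)).symm.trans this)
    exact Prod.ext h2.1 h2.2
  have hone : u 1 = 1 := by
    have := hmul 1 1
    rw [one_mul] at this
    exact left_eq_mul.mp this
  let U : Kˣ × Kˣ →* Kˣ × Kˣ := ⟨⟨u, hone⟩, hmul⟩
  -- The parameters β and γ are themselves diagonal matrix entries, at (0, E₁₂) and (0, E₂₂), so
  -- each coordinate of the induced map is a regular character.
  obtain ⟨i, j, hij⟩ := exists_monomialChar_of_mem_adjoin
    ((Units.coeHom K).comp ((MonoidHom.fst Kˣ Kˣ).comp U)) (by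
      have := restrict_torus_mem (hθ _ (entry_mem_coordRing (Sum.inr (0, 1)) (Sum.inr (0, 1))))
      convert this using 1
      funext t
      rw [hu, entry_inr, torusElt_snd]
      simp [stdBasis, linearEquivProd, equivProd, Matrix.stdBasis_eq_single, U])
  obtain ⟨m, n, hmn⟩ := exists_monomialChar_of_mem_adjoin
    ((Units.coeHom K).comp ((MonoidHom.snd Kˣ Kˣ).comp U)) (by
      have := restrict_torus_mem (hθ _ (entry_mem_coordRing (Sum.inr (1, 1)) (Sum.inr (1, 1))))
      convert this using 1
      funext t
      rw [hu, entry_inr, torusElt_snd]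
      simp [stdBasis, linearEquivProd, equivProd, Matrix.stdBasis_eq_single, U])
  refine ⟨i, j, m, n, fun β γ => ?_⟩
  have e1 := DFunLike.congr_fun hij (β, γ)
  have e2 := DFunLike.congr_fun hmn (β, γ)
  rw [monomialChar_apply] at e1 e2
  rw [hu (β, γ)]
  exact congrArg₂ _ (Units.ext e1) (Units.ext e2)

end TorusCharacters

end SplitOctonion

namespace SplitOctonion

/-! ### Rigidity of the torus under a symmetry of order three -/

section TorusRigidity

variable {K : Type*} [Field K]

/-- The cyclic permutation matrix. -/
def cycSL (K : Type*) [Field K] : SL₃ K :=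
  ⟨!![0, 0, 1; 1, 0, 0; 0, 1, 0], by simp [Matrix.det_fin_three]⟩

theorem rho_cycSL_zorn (a b : K) (u v : Fin 3 → K) :
    rho (cycSL K) (zorn a b u v) = zorn a b ![u 2, u 0, u 1] ![v 2, v 0, v 1] := by
  rw [rho_zorn, Matrix.SpecialLinearGroup.coe_inv, Matrix.adjugate_fin_three]
  congr 1 <;> ext i <;> fin_cases i <;>
    simp [cycSL, Matrix.mulVec, dotProduct, Fin.sum_univ_three, Matrix.vecHead, Matrix.vecTail]

theorem rho_cycSL_mul_torusElt (β γ : Kˣ) :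
    rho (cycSL K) * torusElt β γ = torusElt γ (β * γ)⁻¹ * rho (cycSL K) := by
  refine aut_ext_zorn fun a b u v => ?_
  rw [aut_mul_apply, aut_mul_apply, torusElt_zorn, rho_cycSL_zorn, rho_cycSL_zorn, torusElt_zorn]
  have hβ := β.ne_zero
  have hγ := γ.ne_zero
  congr 1 <;> ext i <;> fin_cases i <;> simp <;> field_simp <;> simp

/-- The primed integers are the entries of an inverse of the matrix (i, j; −j, i − j), whose
determinant i² − ij + j² is the norm form of the Eisenstein integers. Writing j = 2r gives (i − r)²
+ 3r², and this is ±1 only when r = 0. -/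
theorem int_matrix_aux {i j i' j' m' n' : ℤ} (hj : Even j)
    (h1 : i * i' + (-j) * j' = 1) (h2 : j * i' + (i - j) * j' = 0)
    (h3 : i * m' + (-j) * n' = 0) (h4 : j * m' + (i - j) * n' = 1) :
    j = 0 ∧ (i = 1 ∨ i = -1) := by
  have hdet : (i * (i - j) + j * j) * (i' * n' - m' * j') = 1 := by
    linear_combination (j * m' + (i - j) * n') * h1 + h4 - (i * m' - j * n') * h2
  have hu : IsUnit (i * (i - j) + j * j) := IsUnit.of_mul_eq_one _ hdet
  have hj0 : j = 0 := by
    obtain ⟨r, rfl⟩ := hj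
    by_contra hne
    have hr : r ≠ 0 := fun h => hne (by rw [h]; rfl)
    have hr2 : 1 ≤ r * r := by nlinarith [Int.one_le_abs hr, abs_mul_abs_self r]
    rcases Int.isUnit_iff.mp hu with h | h
    · nlinarith [mul_self_nonneg (i - r)]
    · nlinarith [mul_self_nonneg (i - r)]
  subst hj0
  refine ⟨rfl, ?_⟩
  have h5 : IsUnit i := IsUnit.of_mul_eq_one i' (by linear_combination h1)
  exact Int.isUnit_iff.mp h5

theorem odd_of_neg_one_zpow [NeZero (2 : K)] {n : ℤ} (h : (-1 : Kˣ) ^ n = -1) : Odd n := by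
  by_contra hn
  rw [Int.not_odd_iff_even] at hn
  rw [hn.neg_one_zpow] at h
  exact neg_one_ne_one' (congrArg Units.val h).symm

theorem even_of_neg_one_zpow [NeZero (2 : K)] {n : ℤ} (h : (-1 : Kˣ) ^ n = 1) : Even n := by
  by_contra hn
  rw [Int.not_even_iff_odd] at hn
  rw [hn.neg_one_zpow] at h
  exact neg_one_ne_one' (congrArg Units.val h)

variable [NeZero (2 : K)] [IsAlgClosed K]

theorem exponents_eq {a b c d : ℤ} (h : ∀ β γ : Kˣ, β ^ a * γ ^ b = β ^ c * γ ^ d) :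
    a = c ∧ b = d :=
  ⟨eq_of_forall_zpow_eq fun x => by simpa using h x 1,
    eq_of_forall_zpow_eq fun x => by simpa using h 1 x⟩

/-- An algebraic automorphism fixing the two-torsion of the torus acts on the torus trivially or by
inversion. -/
theorem torus_trivial_or_inversion {θ : MulAut (autGroup K)} (hθ : IsAlgebraicAut θ)
    (hB : θ (sigmaB K) = sigmaB K) (hC : θ (sigmaC K) = sigmaC K) :
    (∀ β γ : Kˣ, θ (torusElt β γ) = torusElt β γ) ∨
    (∀ β γ : Kˣ, θ (torusElt β γ) = torusElt β⁻¹ γ⁻¹) := by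
  obtain ⟨i, j, m, n, hA⟩ := exists_exponents hθ.1 hB hC
  have hB' : θ⁻¹ (sigmaB K) = sigmaB K := by
    rw [MulAut.inv_apply, MulEquiv.symm_apply_eq, hB]
  have hC' : θ⁻¹ (sigmaC K) = sigmaC K := by
    rw [MulAut.inv_apply, MulEquiv.symm_apply_eq, hC]
  obtain ⟨i', j', m', n', hA'⟩ := exists_exponents hθ.2 hB' hC'
  have hinv : ∀ β γ : Kˣ, torusElt ((β ^ i * γ ^ j) ^ i' * (β ^ m * γ ^ n) ^ j')
      ((β ^ i * γ ^ j) ^ m' * (β ^ m * γ ^ n) ^ n') = torusElt β γ := by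
    intro β γ
    rw [← hA', ← hA, MulAut.inv_apply_self]
  have inv1 : i * i' + m * j' = 1 ∧ j * i' + n * j' = 0 := exponents_eq (K := K) fun β γ => by
    have := (torusElt_injective (hinv β γ)).1
    rw [zpow_one, zpow_zero, mul_one]
    refine Eq.trans ?_ this
    simp only [mul_zpow, zpow_add, zpow_mul]
    exact mul_mul_mul_comm _ _ _ _
  have inv2 : i * m' + m * n' = 0 ∧ j * m' + n * n' = 1 := exponents_eq (K := K) fun β γ => by
    have := (torusElt_injective (hinv β γ)).2
    rw [zpow_one, zpow_zero, one_mul]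
    refine Eq.trans ?_ this
    simp only [mul_zpow, zpow_add, zpow_mul]
    exact mul_mul_mul_comm _ _ _ _
  -- Fixing the two-torsion says that the exponent matrix is the identity modulo 2.
  have parB := torusElt_injective ((hA (-1) 1).symm.trans hB)
  have parC := torusElt_injective ((hA (-1) (-1)).symm.trans hC)
  simp only [one_zpow, mul_one, ← zpow_add] at parB parC
  have pi := odd_of_neg_one_zpow parB.1
  have pm := even_of_neg_one_zpow parB.2
  have pij := odd_of_neg_one_zpow parC.1
  have pmn := odd_of_neg_one_zpow parC.2
  have pj : Even j := by
    rcases pi with ⟨a, rfl⟩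
    rcases pij with ⟨b, hb⟩
    exact ⟨b - a, by omega⟩
  have pn : Odd n := by
    rcases pm with ⟨a, rfl⟩
    rcases pmn with ⟨b, hb⟩
    exact ⟨b - a, by omega⟩
  let c := rho (cycSL K)
  have hcyc : ∀ β γ : Kˣ, c * torusElt β γ * c⁻¹ = torusElt γ (β * γ)⁻¹ := fun β γ => by
    rw [mul_inv_eq_iff_eq_mul]; exact rho_cycSL_mul_torusElt β γ
  -- When θ fixes both t and its conjugate by c, the discrepancy c⁻¹θ(c) commutes with t. Applied to
  -- the two-torsion, this places the discrepancy in the torus or in its coset by s.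
  have hfix : ∀ β γ : Kˣ, θ (torusElt β γ) = torusElt β γ →
      θ (torusElt γ (β * γ)⁻¹) = torusElt γ (β * γ)⁻¹ →
      Commute (c⁻¹ * θ c) (torusElt β γ) := by
    intro β γ h1 h2
    rw [← hcyc, map_mul, map_mul, map_inv, h1] at h2
    rw [mul_inv_eq_iff_eq_mul] at h2
    rw [commute_iff_eq, mul_assoc, h2]
    group
  have hBC : θ (torusElt 1 (-1)) = torusElt 1 (-1) := by
    have : (torusElt 1 (-1) : autGroup K) = sigmaB K * sigmaC K := by
      rw [torusElt_mul]; simp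
    rw [this, map_mul, hB, hC]
  have zB : Commute (c⁻¹ * θ c) (sigmaB K) := hfix _ _ hB (by simpa using hBC)
  have zC : Commute (c⁻¹ * θ c) (sigmaC K) := hfix _ _ hC (by simpa using hB)
  -- Applying θ to the cyclic relation compares the exponent matrix with its conjugate by the
  -- order-3 matrix. They agree up to the sign by which the discrepancy acts.
  have hconj : ∀ β γ : Kˣ, θ (torusElt γ (β * γ)⁻¹) =
      c * ((c⁻¹ * θ c) * torusElt (β ^ i * γ ^ j) (β ^ m * γ ^ n) * (c⁻¹ * θ c)⁻¹) * c⁻¹ := by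
    intro β γ
    rw [← hcyc, map_mul, map_mul, map_inv, hA]
    group
  rcases conj_torusElt_of_commute zB zC with hz | hz
  · simp only [hz, hcyc, hA] at hconj
    have r1 : -j = m ∧ i - j = n := exponents_eq (K := K) fun β γ => by
      rw [← (torusElt_injective (hconj β γ)).1, inv_zpow', mul_zpow, sub_eq_add_neg, zpow_add]
      exact mul_left_comm _ _ _
    obtain ⟨rfl, rfl⟩ := r1
    obtain ⟨rfl, h⟩ := int_matrix_aux pj inv1.1 inv1.2 inv2.1 inv2.2
    rcases h with rfl | rfl
    · left; intro β γ; rw [hA]; simp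
    · right; intro β γ; rw [hA]; simp
  -- With the wrong sign the exponent equations force n = 0, contradicting its oddness.
  · simp only [hz, hcyc, hA] at hconj
    have r1 : -j = -m ∧ i - j = -n := exponents_eq (K := K) fun β γ => by
      have := (torusElt_injective (hconj β γ)).1
      rw [inv_zpow', mul_zpow, mul_inv, ← zpow_neg β m, ← zpow_neg γ n] at this
      rw [← this, sub_eq_add_neg, zpow_add]
      exact mul_left_comm _ _ _
    have r2 : -n = i + m ∧ m - n = j + n := exponents_eq (K := K) fun β γ => by
      have := (torusElt_injective (hconj β γ)).2
      simp only [mul_inv, inv_inv, inv_zpow', mul_zpow, zpow_neg] at this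
      rw [zpow_add, zpow_add, mul_mul_mul_comm, ← this, zpow_neg, sub_eq_add_neg, zpow_add,
        zpow_neg, mul_left_comm]
    exfalso
    obtain ⟨a, ha⟩ := pn
    omega

end TorusRigidity

end SplitOctonion

namespace SplitOctonion

/-! ### Commuting involutions and their common eigenvectors -/

section Involutions

variable {K : Type*} [Field K]

theorem zmod_two_cases (c : ZMod 2) : c = 0 ∨ c = 1 := by
  revert c; decide

/-- The character of `ℤ/2` with values in signs. -/
def sgn (K : Type*) [Field K] (c : ZMod 2) : K := if c = 0 then 1 else -1

theorem sgn_zero : sgn K 0 = 1 := rfl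
theorem sgn_one : sgn K 1 = -1 := rfl
theorem sgn_add (c d : ZMod 2) : sgn K (c + d) = sgn K c * sgn K d := by
  rcases zmod_two_cases c with rfl | rfl <;> rcases zmod_two_cases d with rfl | rfl
  · simp [sgn_zero]
  · simp [sgn_zero]
  · simp [sgn_zero]
  · rw [show (1 + 1 : ZMod 2) = 0 by rfl, sgn_zero, sgn_one]; simp
theorem sgn_mul_self (c : ZMod 2) : sgn K c * sgn K c = 1 := by
  rcases zmod_two_cases c with rfl | rfl
  · simp [sgn_zero]
  · simp [sgn_one]

variable [NeZero (2 : K)]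

theorem sgn_eq_one {c : ZMod 2} (h : sgn K c = 1) : c = 0 := by
  by_contra hc
  rw [sgn, if_neg hc] at h
  exact neg_one_ne_one' h

theorem bil_eq_zero_of_signs {s : autGroup K} {x y : SplitOctonion K} (hx : s x = -x)
    (hy : s y = y) : bil x y = 0 := by
  have h := aut_bil s x y
  rw [hx, hy, ← neg_one_smul K, bil_smul_left] at h
  exact eq_zero_of_eq_neg (by linear_combination -h)

theorem tr_eq_zero_of_sign {s : autGroup K} {x : SplitOctonion K} (hx : s x = -x) : tr x = 0 := by
  rw [← bil_one_right]
  exact bil_eq_zero_of_signs hx (aut_map_one s)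

omit [NeZero (2 : K)] in
theorem exists_bil_ne_zero {x : SplitOctonion K} (hx : x ≠ 0) : ∃ z, bil x z ≠ 0 := by
  by_contra! h
  apply hx
  have e1 := h ⟨!![1, 0; 0, 0], 0⟩
  have e2 := h ⟨!![0, 1; 0, 0], 0⟩
  have e3 := h ⟨!![0, 0; 1, 0], 0⟩
  have e4 := h ⟨!![0, 0; 0, 1], 0⟩
  have f1 := h ⟨0, !![1, 0; 0, 0]⟩
  have f2 := h ⟨0, !![0, 1; 0, 0]⟩
  have f3 := h ⟨0, !![0, 0; 1, 0]⟩
  have f4 := h ⟨0, !![0, 0; 0, 1]⟩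
  simp [bil] at e1 e2 e3 e4 f1 f2 f3 f4
  apply ext_coords <;> simp [fst_zero, snd_zero, *]

/-- `x` is a common eigenvector of `s` with signs given by `χ`. -/
def IsEigen (s : Fin 3 → autGroup K) (χ : Fin 3 → ZMod 2) (x : SplitOctonion K) : Prop :=
  ∀ i, s i x = sgn K (χ i) • x

variable {s : Fin 3 → autGroup K}

omit [NeZero (2 : K)] in
theorem IsEigen.mul {χ ψ : Fin 3 → ZMod 2} {x y : SplitOctonion K} (hx : IsEigen s χ x)
    (hy : IsEigen s ψ y) : IsEigen s (χ + ψ) (x * y) := fun i => by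
  rw [aut_map_mul, hx i, hy i, Pi.add_apply, sgn_add, smul_mul_assoc, mul_smul_comm, smul_smul]

omit [NeZero (2 : K)] in
theorem IsEigen.add {χ : Fin 3 → ZMod 2} {x y : SplitOctonion K} (hx : IsEigen s χ x)
    (hy : IsEigen s χ y) : IsEigen s χ (x + y) := fun i => by
  rw [aut_map_add, hx i, hy i, smul_add]

omit [NeZero (2 : K)] in
theorem IsEigen.smul {χ : Fin 3 → ZMod 2} {x : SplitOctonion K} (r : K) (hx : IsEigen s χ x) :
    IsEigen s χ (r • x) := fun i => by
  rw [aut_map_smul, hx i, smul_comm]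

section Projection

variable {g h : autGroup K} {ε : K}

omit [NeZero (2 : K)] in
theorem apply_add_smul_apply (hg : g * g = 1) (hε : ε * ε = 1) (x : SplitOctonion K) :
    g (x + ε • g x) = ε • (x + ε • g x) := by
  rw [aut_map_add, aut_map_smul, ← aut_mul_apply g g, hg, aut_one_apply, smul_add, smul_smul, hε,
    one_smul, add_comm]

omit [NeZero (2 : K)] in
theorem apply_add_smul_apply_of_commute (hc : Commute h g) {δ : K} {x : SplitOctonion K}
    (hx : h x = δ • x) : h (x + ε • g x) = δ • (x + ε • g x) := by
  rw [aut_map_add, aut_map_smul, ← aut_mul_apply h g, hc.eq, aut_mul_apply, hx, aut_map_smul,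
    smul_add, smul_comm]

omit [NeZero (2 : K)] in
theorem bil_add_smul_apply (hg : g * g = 1) {x z : SplitOctonion K} (hx : g x = ε • x)
    (hε : ε * ε = 1) : bil x (z + ε • g z) = 2 * bil x z := by
  have h1 := aut_bil g x (g z)
  rw [← aut_mul_apply, hg, aut_one_apply, hx, bil_smul_left] at h1
  rw [bil_add_right, bil_smul_right, ← h1]
  linear_combination bil x z * hε

/-- The two eigenspace components of x add up to 2x, so they cannot both vanish. -/
theorem exists_sign_ne_zero (g : autGroup K) {x : SplitOctonion K} (hx : x ≠ 0) :
    ∃ c : ZMod 2, x + sgn K c • g x ≠ 0 := by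
  by_contra! hall
  have h0 := hall 0
  have h1 := hall 1
  rw [sgn_zero, one_smul] at h0
  rw [sgn_one, neg_smul, one_smul] at h1
  have h2 : (2 : K) • x = 0 := by
    rw [two_smul]
    calc x + x = (x + g x) + (x + -g x) := by abel
      _ = 0 := by rw [h0, h1, add_zero]
  exact hx ((smul_eq_zero.mp h2).resolve_left (NeZero.ne _))

end Projection

variable (hcomm : ∀ i j, Commute (s i) (s j)) (hsq : ∀ i, s i * s i = 1)
include hcomm hsq

theorem exists_isEigen {g : autGroup K} (hg : ∀ i, Commute g (s i)) {δ : K}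
    {x : SplitOctonion K} (hx : x ≠ 0) (hgx : g x = δ • x) :
    ∃ χ y, y ≠ 0 ∧ IsEigen s χ y ∧ g y = δ • y := by
  obtain ⟨c0, h0⟩ := exists_sign_ne_zero (s 0) hx
  obtain ⟨c1, h1⟩ := exists_sign_ne_zero (s 1) h0
  obtain ⟨c2, h2⟩ := exists_sign_ne_zero (s 2) h1
  refine ⟨![c0, c1, c2], _, h2, ?_, ?_⟩
  · intro i
    fin_cases i
    · exact apply_add_smul_apply_of_commute (hcomm 0 2) (apply_add_smul_apply_of_commute (hcomm 0 1)
        (apply_add_smul_apply (hsq 0) (sgn_mul_self c0) _))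
    · exact apply_add_smul_apply_of_commute (hcomm 1 2)
        (apply_add_smul_apply (hsq 1) (sgn_mul_self c1) _)
    · exact apply_add_smul_apply (hsq 2) (sgn_mul_self c2) _
  · exact apply_add_smul_apply_of_commute (hg 2) (apply_add_smul_apply_of_commute (hg 1)
      (apply_add_smul_apply_of_commute (hg 0) hgx))

/-- Projecting a vector that pairs with x onto its eigenspace multiplies the pairing by a power of
2, so the norm form is nondegenerate there. It cannot vanish identically, by polarisation. -/
theorem exists_isEigen_nrm_ne_zero {χ : Fin 3 → ZMod 2} {x : SplitOctonion K} (hx : x ≠ 0)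
    (hχ : IsEigen s χ x) : ∃ y, IsEigen s χ y ∧ nrm y ≠ 0 := by
  obtain ⟨z, hz⟩ := exists_bil_ne_zero hx
  let z0 := z + sgn K (χ 0) • s 0 z
  let z1 := z0 + sgn K (χ 1) • s 1 z0
  let z2 := z1 + sgn K (χ 2) • s 2 z1
  have hz2 : IsEigen s χ z2 := by
    intro i
    fin_cases i
    · exact apply_add_smul_apply_of_commute (hcomm 0 2) (apply_add_smul_apply_of_commute (hcomm 0 1)
        (apply_add_smul_apply (hsq 0) (sgn_mul_self _) _))
    · exact apply_add_smul_apply_of_commute (hcomm 1 2)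
        (apply_add_smul_apply (hsq 1) (sgn_mul_self _) _)
    · exact apply_add_smul_apply (hsq 2) (sgn_mul_self _) _
  have hb : bil x z2 ≠ 0 := by
    rw [bil_add_smul_apply (hsq 2) (hχ 2) (sgn_mul_self _),
      bil_add_smul_apply (hsq 1) (hχ 1) (sgn_mul_self _),
      bil_add_smul_apply (hsq 0) (hχ 0) (sgn_mul_self _)]
    have := NeZero.ne (2 : K)
    positivity
  by_contra! hall
  have e := nrm_add x z2
  rw [hall _ hχ, hall _ hz2, hall _ (hχ.add hz2)] at e
  exact hb (by linear_combination -e)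

/-- For three independent commuting involutions, every sign pattern is realized by an anisotropic
common eigenvector. -/
theorem exists_isEigen_of_independent
    (hind : ∀ m : Fin 3 → ZMod 2, m ≠ 0 →
      s 0 ^ (m 0).val * s 1 ^ (m 1).val * s 2 ^ (m 2).val ≠ 1) (χ : Fin 3 → ZMod 2) :
    ∃ y, IsEigen s χ y ∧ nrm y ≠ 0 := by
  -- Multiplicativity of the norm makes the realised sign patterns closed under addition.
  let S : AddSubgroup (Fin 3 → ZMod 2) :=
    { carrier := {χ | ∃ y, IsEigen s χ y ∧ nrm y ≠ 0}
      zero_mem' := ⟨1, fun i => by rw [aut_map_one, Pi.zero_apply, sgn_zero, one_smul],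
        by rw [nrm_one]; exact one_ne_zero⟩
      add_mem' := by
        rintro a b ⟨x, hx, hx'⟩ ⟨y, hy, hy'⟩
        exact ⟨x * y, hx.mul hy, by rw [nrm_mul]; exact mul_ne_zero hx' hy'⟩
      neg_mem' := by
        rintro a ha
        rwa [show -a = a by ext i; simp] }
  let W := AddSubgroup.toZModSubmodule 2 S
  have hW : W = ⊤ := by
    by_contra hne
    -- A nonzero functional f killing all realised patterns corresponds to a nontrivial product g of
    -- the involutions, acting on a pattern ψ by the sign of f(ψ). Then g has no negated vector, so
    -- g = 1, against independence.
    obtain ⟨f, hf0, hf⟩ := W.exists_le_ker_of_lt_top (lt_top_iff_ne_top.mpr hne)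
    let m : Fin 3 → ZMod 2 := fun i => f (Pi.single i 1)
    have hfm : ∀ ψ, f ψ = ψ 0 * m 0 + ψ 1 * m 1 + ψ 2 * m 2 := by
      intro ψ
      have := LinearMap.pi_apply_eq_sum_univ f ψ
      rw [this, Fin.sum_univ_three]
      have e : ∀ i : Fin 3, (fun j => if i = j then (1 : ZMod 2) else 0) = Pi.single i 1 := by
        intro i; ext j; rw [Pi.single_apply]; simp only [eq_comm]
      simp only [e, smul_eq_mul]
      rfl
    have hm : m ≠ 0 := by
      intro h
      apply hf0
      ext ψ
      simp only [LinearMap.comp_apply, LinearMap.zero_apply]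
      rw [hfm]
      simp [h]
    set g := s 0 ^ (m 0).val * s 1 ^ (m 1).val * s 2 ^ (m 2).val with hg
    have hpow : ∀ (i : Fin 3) (c : ZMod 2) (ψ : Fin 3 → ZMod 2) (y : SplitOctonion K),
        IsEigen s ψ y → (s i ^ c.val) y = sgn K (ψ i * c) • y := by
      intro i c ψ y hy
      rcases zmod_two_cases c with rfl | rfl
      · rw [ZMod.val_zero, pow_zero, mul_zero, sgn_zero, one_smul, aut_one_apply]
      · rw [ZMod.val_one, pow_one, mul_one]
        exact hy i
    have hgy : ∀ ψ y, IsEigen s ψ y → g y = sgn K (f ψ) • y := by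
      intro ψ y hy
      rw [hg, aut_mul_apply, aut_mul_apply, hpow _ _ ψ y hy, aut_map_smul, hpow _ _ ψ y hy,
        aut_map_smul, aut_map_smul, hpow _ _ ψ y hy, hfm, sgn_add, sgn_add, smul_smul, smul_smul]
      congr 1
      ring
    have hgc : ∀ i, Commute g (s i) := fun i =>
      (((hcomm 0 i).pow_left _).mul_left ((hcomm 1 i).pow_left _)).mul_left
        ((hcomm 2 i).pow_left _)
    have hg2 : g * g = 1 := by
      have hp : ∀ i n, s i ^ n * s i ^ n = 1 := fun i n => by
        rw [← (Commute.refl (s i)).mul_pow, hsq, one_pow]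
      have c1 : Commute (s 0 ^ (m 0).val * s 1 ^ (m 1).val) (s 2 ^ (m 2).val) :=
        (((hcomm 0 2).pow_pow _ _).mul_left ((hcomm 1 2).pow_pow _ _))
      have c2 : Commute (s 0 ^ (m 0).val) (s 1 ^ (m 1).val) := (hcomm 0 1).pow_pow _ _
      rw [hg, c1.symm.mul_mul_mul_comm, hp, mul_one, c2.symm.mul_mul_mul_comm, hp, hp, mul_one]
    apply hind m hm
    rw [← hg]
    refine aut_ext fun w => ?_
    rw [aut_one_apply]
    by_contra hw
    obtain ⟨ψ, y, hy0, hy, hyg⟩ := exists_isEigen hcomm hsq hgc (x := w - g w) (δ := -1)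
      (sub_ne_zero.mpr (Ne.symm hw)) (by
        rw [aut_map_sub, ← aut_mul_apply, hg2, aut_one_apply, neg_smul, one_smul, neg_sub])
    have hψ : f ψ = 0 := hf (exists_isEigen_nrm_ne_zero hcomm hsq hy0 hy)
    rw [hgy ψ y hy, hψ, sgn_zero, one_smul] at hyg
    have h2 : (2 : K) • y = 0 := by
      rw [two_smul]
      nth_rewrite 1 [hyg]
      simp
    exact hy0 ((smul_eq_zero.mp h2).resolve_left (NeZero.ne _))
  have : χ ∈ W := hW ▸ Submodule.mem_top
  exact this

/-- Each coordinate pattern has an anisotropic eigenvector, which a square root rescales to norm −1.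
All orthogonality relations hold because some involution negates one vector and fixes the other. -/
theorem exists_triple_of_involutions [IsAlgClosed K]
    (hind : ∀ m : Fin 3 → ZMod 2, m ≠ 0 →
      s 0 ^ (m 0).val * s 1 ^ (m 1).val * s 2 ^ (m 2).val ≠ 1) :
    ∃ v : Fin 3 → SplitOctonion K, IsTriple 1 1 1 (v 0) (v 1) (v 2) ∧
      ∀ i j, s i (v j) = if i = j then -v j else v j := by
  have h1 : ∀ j : Fin 3, ∃ y, IsEigen s (Pi.single j 1) y ∧ nrm y = -1 := by
    intro j
    obtain ⟨y, hy, hn⟩ := exists_isEigen_of_independent hcomm hsq hind (Pi.single j 1)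
    obtain ⟨r, hr⟩ := IsAlgClosed.exists_pow_nat_eq (-(nrm y)⁻¹) (n := 2) (by norm_num)
    refine ⟨r • y, hy.smul r, ?_⟩
    rw [nrm_smul, hr, neg_mul, inv_mul_cancel₀ hn]
  choose v hv hn using h1
  have hs : ∀ i j, s i (v j) = if i = j then -v j else v j := by
    intro i j
    rw [hv j i, Pi.single_apply]
    split_ifs
    · rw [sgn_one, neg_smul, one_smul]
    · rw [sgn_zero, one_smul]
  have hself : ∀ i, s i (v i) = -v i := fun i => by rw [hs, if_pos rfl]
  have hne : ∀ i j, i ≠ j → s i (v j) = v j := fun i j h => by rw [hs, if_neg h]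
  have ht : ∀ i, tr (v i) = 0 := fun i => tr_eq_zero_of_sign (hself i)
  have hq : ∀ i, v i * v i = (1 : K) • 1 := fun i => mul_self_of_nrm (ht i) (hn i)
  have hb : ∀ i j, i ≠ j → bil (v i) (v j) = 0 := fun i j h =>
    bil_eq_zero_of_signs (hself i) (hne i j h)
  refine ⟨v, ⟨⟨hq 0, hq 1, ht 0, ht 1, hb 0 1 (by decide)⟩, hq 2, ht 2, hb 2 0 (by decide),
    hb 2 1 (by decide), bil_eq_zero_of_signs (hself 2) ?_⟩, hs⟩
  rw [aut_map_mul, hne 2 0 (by decide), hne 2 1 (by decide)]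

end Involutions

/-! ### The standard triple and its three involutions -/

section StandardTriple

variable (K : Type*) [Field K]

/-- The standard triple. -/
def stdTriple : Fin 3 → SplitOctonion K :=
  ![zorn 1 (-1) 0 0, zorn 0 0 ![1, 0, 0] ![1, 0, 0], zorn 0 0 ![0, 1, 0] ![0, 1, 0]]

/-- The involutions diagonal with respect to the standard triple. -/
def stdInv : Fin 3 → autGroup K := ![sElt K, sigmaB K, sigmaC K]

theorem isTriple_stdTriple : IsTriple 1 1 1 (stdTriple K 0) (stdTriple K 1) (stdTriple K 2) := by
  refine ⟨⟨mul_self_of_nrm ?_ ?_, mul_self_of_nrm ?_ ?_, ?_, ?_, ?_⟩, mul_self_of_nrm ?_ ?_,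
    ?_, ?_, ?_, ?_⟩ <;>
  simp [stdTriple, tr_zorn, nrm_zorn, bil_zorn, zorn_mul, dotProduct, Fin.sum_univ_three]

theorem stdInv_stdTriple (i j : Fin 3) :
    stdInv K i (stdTriple K j) = if i = j then -stdTriple K j else stdTriple K j := by
  have neg_zorn : ∀ (a b : K) (u v : Fin 3 → K), -zorn a b u v = zorn (-a) (-b) (-u) (-v) := by
    intro a b u v
    rw [← neg_one_smul K, zorn_smul]
    simp
  fin_cases i <;> fin_cases j <;>
    simp [stdInv, stdTriple, sElt_zorn, torusElt_zorn, neg_zorn] <;>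
    congr 1 <;> ext i <;> fin_cases i <;> simp

theorem stdInv_comm : ∀ i j : Fin 3, Commute (stdInv K i) (stdInv K j)
  | 0, 0 => Commute.refl _
  | 0, 1 => sElt_comm_sigmaB
  | 0, 2 => sElt_comm_sigmaC
  | 1, 0 => sElt_comm_sigmaB.symm
  | 1, 1 => Commute.refl _
  | 1, 2 => torusElt_comm _ _ _ _
  | 2, 0 => sElt_comm_sigmaC.symm
  | 2, 1 => torusElt_comm _ _ _ _
  | 2, 2 => Commute.refl _

theorem stdInv_mul_self (i : Fin 3) : stdInv K i * stdInv K i = 1 := by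
  fin_cases i <;> simp [stdInv, sElt_mul_self, torusElt_mul, torusElt_one]

variable [NeZero (2 : K)]

theorem stdInv_independent (m : Fin 3 → ZMod 2) (hm : m ≠ 0) :
    stdInv K 0 ^ (m 0).val * stdInv K 1 ^ (m 1).val * stdInv K 2 ^ (m 2).val ≠ 1 := by
  intro h
  apply hm
  have hpow : ∀ (i j : Fin 3) (c : ZMod 2), (stdInv K i ^ c.val) (stdTriple K j) =
      (if i = j then sgn K c else 1) • stdTriple K j := by
    intro i j c
    rcases zmod_two_cases c with rfl | rfl
    · rw [ZMod.val_zero, pow_zero, sgn_zero, ite_self, one_smul, aut_one_apply]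
    · rw [ZMod.val_one, pow_one, sgn_one, stdInv_stdTriple]
      split_ifs <;> simp
  have key : ∀ j, sgn K (m j) = 1 := by
    intro j
    have h1 := congrArg (fun g : autGroup K => g (stdTriple K j)) h
    simp only [aut_mul_apply, hpow, aut_map_smul, aut_one_apply, smul_smul] at h1
    have h3 : ((if (2 : Fin 3) = j then sgn K (m 2) else 1) *
        ((if (1 : Fin 3) = j then sgn K (m 1) else 1) *
        (if (0 : Fin 3) = j then sgn K (m 0) else 1))) = sgn K (m j) := by
      fin_cases j <;> simp
    rw [h3] at h1
    -- The product acts on the j-th vector of the triple by the j-th sign alone, so each exponent is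
    -- detected separately.
    have h4 : (sgn K (m j) - 1) • stdTriple K j = 0 := by rw [sub_smul, h1, one_smul, sub_self]
    rcases smul_eq_zero.mp h4 with h5 | h5
    · exact sub_eq_zero.mp h5
    · exfalso
      have hq : stdTriple K j * stdTriple K j = (1 : K) • 1 := by
        have t := isTriple_stdTriple K
        fin_cases j
        · exact t.sq_left
        · exact t.sq_right
        · exact t.sq_last
      rw [h5, mul_zero, one_smul] at hq
      exact one_ne_zero' hq.symm
  ext i
  exact sgn_eq_one (key i)

/-- Up to an inner automorphism, every automorphism of the group fixes the standard involutions. -/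
theorem exists_conj_stdInv [IsAlgClosed K] (θ : MulAut (autGroup K)) :
    ∃ g : autGroup K, ∀ i, θ (stdInv K i) = g * stdInv K i * g⁻¹ := by
  obtain ⟨v, hv, hs⟩ := exists_triple_of_involutions (s := fun i => θ (stdInv K i))
    (fun i j => by simpa using (stdInv_comm K i j).map θ.toMonoidHom)
    (fun i => by rw [← map_mul, stdInv_mul_self, map_one])
    (fun m hm h => by
      simp only [← map_pow, ← map_mul] at h
      exact stdInv_independent K m hm ((MulEquiv.map_eq_one_iff θ).mp h))
  obtain ⟨g, h0, h1, h2⟩ := (isTriple_stdTriple K).exists_aut_apply one_ne_zero one_ne_zero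
    one_ne_zero hv
  have hg : ∀ j, g (stdTriple K j) = v j := by
    intro j; fin_cases j
    · exact h0
    · exact h1
    · exact h2
  refine ⟨g, fun i => ?_⟩
  have key : ∀ j, (θ (stdInv K i)) (v j) = (g * stdInv K i * g⁻¹) (v j) := by
    intro j
    rw [hs, aut_mul_apply, aut_mul_apply, ← hg j, aut_inv_apply_self, stdInv_stdTriple]
    split_ifs
    · rw [aut_map_neg]
    · rfl
  exact hv.aut_ext one_ne_zero one_ne_zero one_ne_zero (key 0) (key 1) (key 2)

end StandardTriple

end SplitOctonion

namespace SplitOctonion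

/-! ### Generating SL₃ by a torus and hyperbolic rotations -/

section Generation

variable {K : Type*} [Field K]

/-- The special linear group of degree two. -/
abbrev SL₂ (K : Type*) [Field K] := Matrix.SpecialLinearGroup (Fin 2) K

/-- Hyperbolic rotations. -/
def hypRot (c s : K) (h : c ^ 2 - s ^ 2 = 1) : SL₂ K :=
  ⟨!![c, s; s, c], by rw [Matrix.det_fin_two_of]; linear_combination h⟩

/-- Diagonal matrices in `SL₂`. -/
def diagSL₂ (t : K) (h : t ≠ 0) : SL₂ K :=
  ⟨!![t, 0; 0, t⁻¹], by rw [Matrix.det_fin_two_of]; field_simp; simp⟩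

/-- Upper unipotent matrices in `SL₂`. -/
def upperSL₂ (y : K) : SL₂ K := ⟨!![1, y; 0, 1], by rw [Matrix.det_fin_two_of]; ring⟩

/-- Lower unipotent matrices in `SL₂`. -/
def lowerSL₂ (y : K) : SL₂ K := ⟨!![1, 0; y, 1], by rw [Matrix.det_fin_two_of]; ring⟩

theorem coe_hypRot (c s : K) (h : c ^ 2 - s ^ 2 = 1) :
    (hypRot c s h : Matrix (Fin 2) (Fin 2) K) = !![c, s; s, c] := rfl

theorem coe_diagSL₂ (t : K) (h : t ≠ 0) :
    (diagSL₂ t h : Matrix (Fin 2) (Fin 2) K) = !![t, 0; 0, t⁻¹] := rfl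

theorem coe_upperSL₂ (y : K) :
    (upperSL₂ y : Matrix (Fin 2) (Fin 2) K) = !![1, y; 0, 1] := rfl

theorem coe_lowerSL₂ (y : K) :
    (lowerSL₂ y : Matrix (Fin 2) (Fin 2) K) = !![1, 0; y, 1] := rfl

variable [IsAlgClosed K]

/-- A root of m⁴ = −1 satisfies all conditions in every characteristic other than 2. -/
theorem exists_param [NeZero (2 : K)] : ∃ m : K, m ≠ 0 ∧ m ^ 2 ≠ 1 ∧ m ^ 4 ≠ 1 := by
  obtain ⟨m, hm⟩ := IsAlgClosed.exists_pow_nat_eq (-1 : K) (n := 4) (by norm_num)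
  refine ⟨m, ?_, ?_, ?_⟩
  · rintro rfl; simp at hm
  · intro h
    apply neg_one_ne_one' (K := K)
    rw [← hm, show m ^ 4 = (m ^ 2) ^ 2 by ring, h, one_pow]
  · rw [hm]; exact neg_one_ne_one'

/-- Two rotations with slopes m and m², separated by diag(t, t⁻¹) with t² = −m, have a product whose
lower left entry vanishes. Diagonal scaling makes it unipotent, and conjugation by diagonal matrices
reaches all other unipotents. -/
theorem upperSL₂_mem [NeZero (2 : K)] {N : Subgroup (SL₂ K)}
    (hd : ∀ t h, diagSL₂ t h ∈ N) (hr : ∀ c s h, hypRot c s h ∈ N) (y : K) :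
    upperSL₂ y ∈ N := by
  have h2 := NeZero.ne (2 : K)
  -- a single nontrivial unipotent
  obtain ⟨y₀, hy₀, hmem⟩ : ∃ y₀ : K, y₀ ≠ 0 ∧ upperSL₂ y₀ ∈ N := by
    obtain ⟨m, hm0, hm2, hm4⟩ := exists_param (K := K)
    obtain ⟨c, hc⟩ := IsAlgClosed.exists_pow_nat_eq ((1 - m ^ 2)⁻¹) (n := 2) (by norm_num)
    obtain ⟨c', hc'⟩ := IsAlgClosed.exists_pow_nat_eq ((1 - m ^ 4)⁻¹) (n := 2) (by norm_num)
    have k2 : 1 - m ^ 2 ≠ 0 := sub_ne_zero.mpr (Ne.symm hm2)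
    have k4 : 1 - m ^ 4 ≠ 0 := sub_ne_zero.mpr (Ne.symm hm4)
    have hc0 : c ≠ 0 := by
      rintro rfl
      exact inv_ne_zero k2 (by rw [← hc]; ring)
    have hc0' : c' ≠ 0 := by
      rintro rfl
      exact inv_ne_zero k4 (by rw [← hc']; ring)
    have e1 : c ^ 2 - (m * c) ^ 2 = 1 := by
      rw [mul_pow, hc]; field_simp
    have e2 : c' ^ 2 - (m ^ 2 * c') ^ 2 = 1 := by
      rw [mul_pow, hc']; field_simp
    obtain ⟨t, ht⟩ := IsAlgClosed.exists_pow_nat_eq (-m) (n := 2) (by norm_num)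
    have ht0 : t ≠ 0 := by
      rintro rfl
      exact neg_ne_zero.mpr hm0 (by rw [← ht]; ring)
    -- This is the upper left entry of the product of the three factors; multiplying by diag(x⁻¹, x)
    -- normalises the diagonal to 1.
    let x := c * t * c' + m * c * (m ^ 2 * c') * t⁻¹
    have hx : x = c * c' * t⁻¹ * (m * (m ^ 2 - 1)) := by
      have : t = t ^ 2 * t⁻¹ := by field_simp
      simp only [x]
      nth_rewrite 1 [this]
      rw [ht]; ring
    have hx0 : x ≠ 0 := by
      rw [hx]
      have : m ^ 2 - 1 ≠ 0 := sub_ne_zero.mpr hm2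
      positivity
    refine ⟨x⁻¹ * (c * t * (m ^ 2 * c') + m * c * c' * t⁻¹), ?_, ?_⟩
    · have : c * t * (m ^ 2 * c') + m * c * c' * t⁻¹ = c * c' * t⁻¹ * (m * (1 - m ^ 2)) := by
        have : t = t ^ 2 * t⁻¹ := by field_simp
        nth_rewrite 1 [this]
        rw [ht]; ring
      rw [this]
      positivity
    · have hprod : upperSL₂ (x⁻¹ * (c * t * (m ^ 2 * c') + m * c * c' * t⁻¹)) =
          diagSL₂ x⁻¹ (inv_ne_zero hx0) *
            (hypRot c (m * c) e1 * diagSL₂ t ht0 * hypRot c' (m ^ 2 * c') e2) := by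
        apply Subtype.ext
        simp only [Matrix.SpecialLinearGroup.coe_mul, coe_upperSL₂, coe_diagSL₂, coe_hypRot]
        have z0 : m * c * t * c' + c * t⁻¹ * (m ^ 2 * c') = 0 := by
          have : t = t ^ 2 * t⁻¹ := by field_simp
          nth_rewrite 1 [this]
          rw [ht]; ring
        have z1 : x⁻¹ * x = 1 := inv_mul_cancel₀ hx0
        have z2 : x * (m * c * t * (m ^ 2 * c') + c * t⁻¹ * c') -
            (c * t * (m ^ 2 * c') + m * c * c' * t⁻¹) *
            (m * c * t * c' + c * t⁻¹ * (m ^ 2 * c')) = 1 := by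
          have tt : t * t⁻¹ = 1 := mul_inv_cancel₀ ht0
          simp only [x]
          linear_combination (c ^ 2 - (m * c) ^ 2) * (c' ^ 2 - (m ^ 2 * c') ^ 2) * tt +
            (c' ^ 2 - (m ^ 2 * c') ^ 2) * e1 + e2
        rw [z0, mul_zero, sub_zero] at z2
        ext i j
        fin_cases i <;> fin_cases j
        · simp [Matrix.mul_apply, Fin.sum_univ_two]
          rw [← z1]; simp only [x]; ring
        · simp [Matrix.mul_apply, Fin.sum_univ_two]
          left; ring
        · simp [Matrix.mul_apply, Fin.sum_univ_two]
          right; rw [← z0]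
        · simp [Matrix.mul_apply, Fin.sum_univ_two]
          rw [← z2]
      rw [hprod]
      exact mul_mem (hd _ _) (mul_mem (mul_mem (hr _ _ _) (hd _ _)) (hr _ _ _))
  by_cases hy : y = 0
  · rw [hy]
    convert one_mem N
    apply Subtype.ext
    simp [upperSL₂, Matrix.one_fin_two]
  obtain ⟨t, ht⟩ := IsAlgClosed.exists_pow_nat_eq (y / y₀) (n := 2) (by norm_num)
  have ht0 : t ≠ 0 := by
    rintro rfl
    exact div_ne_zero hy hy₀ (by rw [← ht]; ring)
  have hprod : upperSL₂ y = diagSL₂ t ht0 * upperSL₂ y₀ * diagSL₂ t⁻¹ (inv_ne_zero ht0) := by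
    apply Subtype.ext
    have hty : y = t ^ 2 * y₀ := by rw [ht]; field_simp
    ext i j
    fin_cases i <;> fin_cases j <;>
      simp [coe_upperSL₂, coe_diagSL₂, Matrix.mul_apply, Fin.sum_univ_two, ht0, hty]
    ring
  rw [hprod]
  exact mul_mem (mul_mem (hd _ _) hmem) (hd _ _)

theorem lowerSL₂_mem [NeZero (2 : K)] {N : Subgroup (SL₂ K)}
    (hd : ∀ t h, diagSL₂ t h ∈ N) (hr : ∀ c s h, hypRot c s h ∈ N) (y : K) :
    lowerSL₂ y ∈ N := by
  -- The rotation with c = 0 and s² = −1 exchanges the two axes, so it conjugates upper unipotents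
  -- to lower ones.
  obtain ⟨i, hi⟩ := IsAlgClosed.exists_pow_nat_eq (-1 : K) (n := 2) (by norm_num)
  have h1 : (0 : K) ^ 2 - i ^ 2 = 1 := by rw [hi]; ring
  have h2 : (0 : K) ^ 2 - (-i) ^ 2 = 1 := by rw [neg_sq, hi]; ring
  have hprod : lowerSL₂ y = hypRot 0 i h1 * upperSL₂ y * hypRot 0 (-i) h2 := by
    apply Subtype.ext
    have hi' : i * i = -1 := by rw [← hi]; ring
    ext a b
    fin_cases a <;> fin_cases b <;>
      simp [coe_upperSL₂, coe_lowerSL₂, coe_hypRot, Matrix.mul_apply, Fin.sum_univ_two, hi']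
    linear_combination y * hi'
  rw [hprod]
  exact mul_mem (mul_mem (hr _ _ _) (upperSL₂_mem hd hr y)) (hr _ _ _)

omit [IsAlgClosed K] in
/-- The block embedding of `SL₂` in the last two coordinates. -/
def embLast : SL₂ K →* SL₃ K where
  toFun A := ⟨!![1, 0, 0; 0, A.1 0 0, A.1 0 1; 0, A.1 1 0, A.1 1 1], by
    have := A.2
    rw [Matrix.det_fin_two] at this
    simp [Matrix.det_fin_three, this]⟩
  map_one' := by
    apply Subtype.ext
    ext i j; fin_cases i <;> fin_cases j <;> simp
  map_mul' A B := by
    apply Subtype.ext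
    change _ = (!![1, 0, 0; 0, A.1 0 0, A.1 0 1; 0, A.1 1 0, A.1 1 1] : Matrix _ _ K) *
      !![1, 0, 0; 0, B.1 0 0, B.1 0 1; 0, B.1 1 0, B.1 1 1]
    ext i j; fin_cases i <;> fin_cases j <;>
      simp [Matrix.mul_apply, Fin.sum_univ_three, Fin.sum_univ_two]

omit [IsAlgClosed K] in
/-- The block embedding of `SL₂` in the first and the last coordinate. -/
def embOuter : SL₂ K →* SL₃ K where
  toFun A := ⟨!![A.1 0 0, 0, A.1 0 1; 0, 1, 0; A.1 1 0, 0, A.1 1 1], by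
    have := A.2
    rw [Matrix.det_fin_two] at this
    simp [Matrix.det_fin_three, this]⟩
  map_one' := by
    apply Subtype.ext
    ext i j; fin_cases i <;> fin_cases j <;> simp
  map_mul' A B := by
    apply Subtype.ext
    change _ = (!![A.1 0 0, 0, A.1 0 1; 0, 1, 0; A.1 1 0, 0, A.1 1 1] : Matrix _ _ K) *
      !![B.1 0 0, 0, B.1 0 1; 0, 1, 0; B.1 1 0, 0, B.1 1 1]
    ext i j; fin_cases i <;> fin_cases j <;>
      simp [Matrix.mul_apply, Fin.sum_univ_three, Fin.sum_univ_two]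

omit [IsAlgClosed K] in
theorem coe_embLast (A : SL₂ K) : (embLast A : Matrix (Fin 3) (Fin 3) K) =
    !![1, 0, 0; 0, A.1 0 0, A.1 0 1; 0, A.1 1 0, A.1 1 1] := rfl

omit [IsAlgClosed K] in
theorem coe_embOuter (A : SL₂ K) : (embOuter A : Matrix (Fin 3) (Fin 3) K) =
    !![A.1 0 0, 0, A.1 0 1; 0, 1, 0; A.1 1 0, 0, A.1 1 1] := rfl

omit [IsAlgClosed K] in
theorem transvection_commutator {i j l : Fin 3} (hij : i ≠ j) (hjl : j ≠ l) (hil : i ≠ l) (y : K) :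
    Matrix.SpecialLinearGroup.transvection hil y =
      Matrix.SpecialLinearGroup.transvection hij y *
      Matrix.SpecialLinearGroup.transvection hjl 1 *
      Matrix.SpecialLinearGroup.transvection hij (-y) *
      Matrix.SpecialLinearGroup.transvection hjl (-1) := by
  apply Subtype.ext
  simp only [Matrix.SpecialLinearGroup.coe_mul, Matrix.SpecialLinearGroup.transvection_coe]
  ext a b
  fin_cases i <;> fin_cases j <;> fin_cases l <;> simp at hij hjl hil <;>
    fin_cases a <;> fin_cases b <;>
    simp [Matrix.mul_apply, Fin.sum_univ_three, Matrix.single, Matrix.one_apply]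

/-- A subgroup of `SL₃` containing the diagonal torus and the hyperbolic rotations in two blocks
is everything. -/
theorem eq_top_of_hypRot [NeZero (2 : K)] {N : Subgroup (SL₃ K)}
    (hd : ∀ β γ, torusSL β γ ∈ N) (h1 : ∀ c s h, embLast (hypRot c s h) ∈ N)
    (h2 : ∀ c s h, embOuter (hypRot c s h) ∈ N) : N = ⊤ := by
  have hdiag : ∀ (D : Fin 3 → K) (hD : (Matrix.diagonal D).det = 1),
      (⟨Matrix.diagonal D, hD⟩ : SL₃ K) ∈ N := by
    intro D hD
    obtain ⟨β, γ, e⟩ := exists_torusSL D hD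
    rw [e]; exact hd _ _
  have hd1 : ∀ t h, diagSL₂ t h ∈ N.comap embLast := by
    intro t ht
    have e : embLast (diagSL₂ t ht) = ⟨Matrix.diagonal ![1, t, t⁻¹], by simp [Matrix.det_diagonal, Fin.prod_univ_three, ht]⟩ := by
      apply Subtype.ext
      ext i j; fin_cases i <;> fin_cases j <;> simp [coe_embLast, coe_diagSL₂]
    rw [Subgroup.mem_comap, e]
    exact hdiag _ _
  have hd2 : ∀ t h, diagSL₂ t h ∈ N.comap embOuter := by
    intro t ht
    have e : embOuter (diagSL₂ t ht) = ⟨Matrix.diagonal ![t, 1, t⁻¹], by simp [Matrix.det_diagonal, Fin.prod_univ_three, ht]⟩ := by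
      apply Subtype.ext
      ext i j; fin_cases i <;> fin_cases j <;> simp [coe_embOuter, coe_diagSL₂]
    rw [Subgroup.mem_comap, e]
    exact hdiag _ _
  have t12 : ∀ y, Matrix.SpecialLinearGroup.transvection (show (1 : Fin 3) ≠ 2 by decide) y ∈ N := by
    intro y
    have e := upperSL₂_mem hd1 h1 y
    rw [Subgroup.mem_comap] at e
    convert e
    apply Subtype.ext
    ext i j; fin_cases i <;> fin_cases j <;>
      simp [coe_embLast, coe_upperSL₂, Matrix.SpecialLinearGroup.transvection_coe, Matrix.single]
  have t21 : ∀ y, Matrix.SpecialLinearGroup.transvection (show (2 : Fin 3) ≠ 1 by decide) y ∈ N := by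
    intro y
    have e := lowerSL₂_mem hd1 h1 y
    rw [Subgroup.mem_comap] at e
    convert e
    apply Subtype.ext
    ext i j; fin_cases i <;> fin_cases j <;>
      simp [coe_embLast, coe_lowerSL₂, Matrix.SpecialLinearGroup.transvection_coe, Matrix.single]
  have t02 : ∀ y, Matrix.SpecialLinearGroup.transvection (show (0 : Fin 3) ≠ 2 by decide) y ∈ N := by
    intro y
    have e := upperSL₂_mem hd2 h2 y
    rw [Subgroup.mem_comap] at e
    convert e
    apply Subtype.ext
    ext i j; fin_cases i <;> fin_cases j <;>
      simp [coe_embOuter, coe_upperSL₂, Matrix.SpecialLinearGroup.transvection_coe, Matrix.single]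
  have t20 : ∀ y, Matrix.SpecialLinearGroup.transvection (show (2 : Fin 3) ≠ 0 by decide) y ∈ N := by
    intro y
    have e := lowerSL₂_mem hd2 h2 y
    rw [Subgroup.mem_comap] at e
    convert e
    apply Subtype.ext
    ext i j; fin_cases i <;> fin_cases j <;>
      simp [coe_embOuter, coe_lowerSL₂, Matrix.SpecialLinearGroup.transvection_coe, Matrix.single]
  have t01 : ∀ y, Matrix.SpecialLinearGroup.transvection (show (0 : Fin 3) ≠ 1 by decide) y ∈ N := by
    intro y
    rw [transvection_commutator (show (0 : Fin 3) ≠ 2 by decide) (show (2 : Fin 3) ≠ 1 by decide)]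
    exact mul_mem (mul_mem (mul_mem (t02 _) (t21 _)) (t02 _)) (t21 _)
  have t10 : ∀ y, Matrix.SpecialLinearGroup.transvection (show (1 : Fin 3) ≠ 0 by decide) y ∈ N := by
    intro y
    rw [transvection_commutator (show (1 : Fin 3) ≠ 2 by decide) (show (2 : Fin 3) ≠ 0 by decide)]
    exact mul_mem (mul_mem (mul_mem (t12 _) (t20 _)) (t12 _)) (t20 _)
  rw [eq_top_iff]
  intro M _
  refine Matrix.SpecialLinearGroup.diagonal_transvection_induction' (fun M => M ∈ N) M ?_ ?_ ?_
  · intro i j hij c hc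
    exact hdiag _ _
  · intro i j hij a
    fin_cases i <;> fin_cases j
    · exact absurd rfl hij
    · exact t01 a
    · exact t02 a
    · exact t10 a
    · exact absurd rfl hij
    · exact t12 a
    · exact t20 a
    · exact t21 a
    · exact absurd rfl hij
  · exact fun A B hA hB => mul_mem hA hB

end Generation

end SplitOctonion

namespace SplitOctonion

/-! ### The three tori generate the automorphism group -/

section FullGroup

open Matrix

variable {K : Type*} [Field K]

theorem exists_cross_eq {w : Fin 3 → K} (hw : w ≠ 0) : ∃ m n : Fin 3 → K, crossProduct m n = w := by
  by_cases h0 : w 0 = 0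
  · by_cases h1 : w 1 = 0
    · have h2 : w 2 ≠ 0 := fun h2 => hw (by ext i; fin_cases i <;> simp [h0, h1, h2])
      refine ⟨![w 2, 0, -w 0], ![0, 1, -w 1 / w 2], ?_⟩
      ext i; fin_cases i <;> simp [cross_apply] <;> field_simp
    · refine ⟨![0, -w 2, w 1], ![1, -w 0 / w 1, 0], ?_⟩
      ext i; fin_cases i <;> simp [cross_apply] <;> field_simp
  · refine ⟨![-w 1, w 0, 0], ![-w 2 / w 0, 0, 1], ?_⟩
    ext i; fin_cases i <;> simp [cross_apply] <;> field_simp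

/-- The columns are u, m, n with m × n = v. The determinant is then u · v, and the first row of the
inverse is m × n. -/
theorem exists_SL₃ {u v : Fin 3 → K} (h : u ⬝ᵥ v = 1) : ∃ M : SL₃ K,
    (M : Matrix (Fin 3) (Fin 3) K) *ᵥ ![1, 0, 0] = u ∧
    ![1, 0, 0] ᵥ* ((M⁻¹ : SL₃ K) : Matrix (Fin 3) (Fin 3) K) = v := by
  obtain ⟨m, n, hmn⟩ := exists_cross_eq (w := v) (by rintro rfl; simp at h)
  have h0 := congrFun hmn 0
  have h1 := congrFun hmn 1
  have h2 := congrFun hmn 2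
  simp [cross_apply] at h0 h1 h2
  refine ⟨⟨!![u 0, m 0, n 0; u 1, m 1, n 1; u 2, m 2, n 2], ?_⟩, ?_, ?_⟩
  · rw [dotProduct, Fin.sum_univ_three] at h
    rw [det_fin_three]
    simp
    linear_combination h + u 0 * h0 + u 1 * h1 + u 2 * h2
  · ext i; fin_cases i <;> simp [mulVec, dotProduct, Fin.sum_univ_three]
  · change ![1, 0, 0] ᵥ* adjugate !![u 0, m 0, n 0; u 1, m 1, n 1; u 2, m 2, n 2] = v
    ext i; fin_cases i <;>
      simp [vecMul, dotProduct, Fin.sum_univ_three, adjugate_fin_three] 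
    · linear_combination h0
    · linear_combination h1
    · linear_combination h2

variable [NeZero (2 : K)]

theorem stdTriple_aut_ext {g g' : autGroup K}
    (h : ∀ j, g (stdTriple K j) = g' (stdTriple K j)) : g = g' :=
  (isTriple_stdTriple K).aut_ext one_ne_zero one_ne_zero one_ne_zero (h 0) (h 1) (h 2)

omit [NeZero (2 : K)] in
theorem idempotent_coords {x : SplitOctonion K} (ht : tr x = 1) (hn : nrm x = 0) :
    x = zorn (x.fst 0 0) (1 - x.fst 0 0) (uvec x) (vvec x) ∧
    uvec x ⬝ᵥ vvec x = x.fst 0 0 * (1 - x.fst 0 0) := by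
  rw [← zorn_eta x, tr_zorn] at ht
  rw [← zorn_eta x, nrm_zorn] at hn
  have e : x.fst 1 1 = 1 - x.fst 0 0 := by linear_combination ht
  rw [e] at hn
  exact ⟨by rw [← e, zorn_eta], by linear_combination -hn⟩

-- The three conditions exclude only the roots of a nonzero polynomial, and the field is infinite.
omit [NeZero (2 : K)] in
theorem exists_param_ne [Infinite K] {A B : K} (C : K) (h : A ≠ 0 ∨ B ≠ 0) :
    ∃ t : K, t ≠ 0 ∧ C * t - A * t ^ 2 + B ≠ 0 ∧ (C - 1) * t - A * t ^ 2 + B ≠ 0 := by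
  open Polynomial in
  have key : ∀ C' : K, (Polynomial.C C' * X - Polynomial.C A * X ^ 2 + Polynomial.C B : K[X]) ≠ 0 := by
    intro C' h0
    have c0 := congrArg (fun p : K[X] => p.coeff 0) h0
    have c2 := congrArg (fun p : K[X] => p.coeff 2) h0
    simp [coeff_X, coeff_C] at c0 c2
    rcases h with h | h
    · exact h c2
    · exact h c0
  by_contra! hcon
  have hz : (Polynomial.X * (Polynomial.C C * Polynomial.X - Polynomial.C A * Polynomial.X ^ 2 +
      Polynomial.C B) * (Polynomial.C (C - 1) * Polynomial.X - Polynomial.C A * Polynomial.X ^ 2 +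
      Polynomial.C B) : Polynomial K) = 0 := by
    apply Polynomial.funext
    intro t
    simp only [Polynomial.eval_mul, Polynomial.eval_add, Polynomial.eval_sub, Polynomial.eval_C,
      Polynomial.eval_X, Polynomial.eval_pow, Polynomial.eval_zero]
    by_cases h0 : t = 0
    · rw [h0]; ring
    by_cases h1 : C * t - A * t ^ 2 + B = 0
    · rw [h1]; ring
    · rw [hcon t h0 h1, mul_zero]
  exact mul_ne_zero (mul_ne_zero Polynomial.X_ne_zero (key C)) (key (C - 1)) hz

/-- The automorphism rotating the first entry of the standard triple towards the product of
the first two. -/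
theorem exists_rotation (c s : K) (h : c ^ 2 - s ^ 2 = 1) : ∃ r : autGroup K,
    r (stdTriple K 0) = zorn c (-c) ![s, 0, 0] ![-s, 0, 0] ∧
    r (stdTriple K 1) = stdTriple K 1 ∧ r (stdTriple K 2) = stdTriple K 2 := by
  refine (isTriple_stdTriple K).exists_aut_apply one_ne_zero one_ne_zero one_ne_zero ?_
  refine ⟨⟨mul_self_of_nrm ?_ ?_, (isTriple_stdTriple K).sq_right, ?_,
    (isTriple_stdTriple K).tr_right, ?_⟩, (isTriple_stdTriple K).sq_last,
    (isTriple_stdTriple K).tr_last, ?_, (isTriple_stdTriple K).bil_last_right, ?_⟩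
  · simp [tr_zorn]
  · simp [nrm_zorn, dotProduct, Fin.sum_univ_three]
    linear_combination -h
  · simp [tr_zorn]
  all_goals simp [stdTriple, bil_zorn, zorn_mul, cross_apply, dotProduct, Fin.sum_univ_three]

variable [IsAlgClosed K] {H : Subgroup (autGroup K)}

omit [IsAlgClosed K] [NeZero (2 : K)] in
theorem rho_torusSL_mem
    (hH : ∀ j g, g (stdTriple K j) = stdTriple K j → (∀ i, i ≠ j → Commute g (stdInv K i)) → g ∈ H)
    (β γ : Kˣ) : rho (torusSL β γ) ∈ H := by
  rw [rho_torusSL]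
  refine hH 0 _ ?_ ?_
  · rw [stdTriple, Matrix.cons_val_zero, torusElt_zorn]
    congr 1 <;> ext i <;> fin_cases i <;> simp
  · intro i hi
    fin_cases i
    · exact absurd rfl hi
    · exact torusElt_comm _ _ _ _
    · exact torusElt_comm _ _ _ _

omit [IsAlgClosed K] [NeZero (2 : K)] in
theorem hypRot_inv (c s : K) (h : c ^ 2 - s ^ 2 = 1) :
    (hypRot c s h)⁻¹ = hypRot c (-s) (by rw [neg_sq]; exact h) := by
  rw [inv_eq_iff_mul_eq_one]
  apply Subtype.ext
  rw [Matrix.SpecialLinearGroup.coe_mul, coe_hypRot, coe_hypRot]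
  ext i j; fin_cases i <;> fin_cases j <;> simp [Matrix.mul_apply, Fin.sum_univ_two]
  · linear_combination h
  · ring
  · ring
  · linear_combination h

omit [IsAlgClosed K] [NeZero (2 : K)] in
theorem rho_embLast_hypRot_zorn (c s : K) (h : c ^ 2 - s ^ 2 = 1) (a b : K) (u v : Fin 3 → K) :
    rho (embLast (hypRot c s h)) (zorn a b u v) =
      zorn a b ![u 0, c * u 1 + s * u 2, s * u 1 + c * u 2]
        ![v 0, c * v 1 - s * v 2, c * v 2 - s * v 1] := by
  rw [rho_zorn, ← map_inv, hypRot_inv, coe_embLast, coe_embLast, coe_hypRot, coe_hypRot]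
  congr 1 <;> ext i <;> fin_cases i <;>
    simp [mulVec, vecMul, dotProduct, Fin.sum_univ_three] <;> ring

omit [IsAlgClosed K] [NeZero (2 : K)] in
theorem rho_embOuter_hypRot_zorn (c s : K) (h : c ^ 2 - s ^ 2 = 1) (a b : K) (u v : Fin 3 → K) :
    rho (embOuter (hypRot c s h)) (zorn a b u v) =
      zorn a b ![c * u 0 + s * u 2, u 1, s * u 0 + c * u 2]
        ![c * v 0 - s * v 2, v 1, c * v 2 - s * v 0] := by
  rw [rho_zorn, ← map_inv, hypRot_inv, coe_embOuter, coe_embOuter, coe_hypRot, coe_hypRot]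
  congr 1 <;> ext i <;> fin_cases i <;>
    simp [mulVec, vecMul, dotProduct, Fin.sum_univ_three] <;> ring

omit [IsAlgClosed K] [NeZero (2 : K)] in
theorem rho_embLast_mem
    (hH : ∀ j g, g (stdTriple K j) = stdTriple K j → (∀ i, i ≠ j → Commute g (stdInv K i)) → g ∈ H)
    (c s : K) (h : c ^ 2 - s ^ 2 = 1) : rho (embLast (hypRot c s h)) ∈ H := by
  refine hH 1 _ ?_ ?_
  · simp only [stdTriple, Matrix.cons_val_one, Matrix.cons_val_zero, rho_embLast_hypRot_zorn]
    congr 1 <;> ext i <;> fin_cases i <;> simp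
  · intro i hi
    refine aut_ext_zorn fun a b u v => ?_
    fin_cases i
    · simp only [stdInv, aut_mul_apply, Fin.zero_eta, Matrix.cons_val_zero, rho_embLast_hypRot_zorn,
        sElt_zorn]
      congr 1 <;> ext i <;> fin_cases i <;> simp <;> ring
    · exact absurd rfl hi
    · simp only [stdInv, aut_mul_apply, Fin.reduceFinMk, Matrix.cons_val, rho_embLast_hypRot_zorn,
        torusElt_zorn]
      congr 1 <;> ext i <;> fin_cases i <;> simp <;> ring

omit [IsAlgClosed K] [NeZero (2 : K)] in
theorem rho_embOuter_mem
    (hH : ∀ j g, g (stdTriple K j) = stdTriple K j → (∀ i, i ≠ j → Commute g (stdInv K i)) → g ∈ H)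
    (c s : K) (h : c ^ 2 - s ^ 2 = 1) : rho (embOuter (hypRot c s h)) ∈ H := by
  refine hH 2 _ ?_ ?_
  · simp only [stdTriple, Matrix.cons_val, rho_embOuter_hypRot_zorn]
    congr 1 <;> ext i <;> fin_cases i <;> simp
  · intro i hi
    refine aut_ext_zorn fun a b u v => ?_
    fin_cases i
    · simp only [stdInv, aut_mul_apply, Fin.zero_eta, Matrix.cons_val_zero, rho_embOuter_hypRot_zorn,
        sElt_zorn]
      congr 1 <;> ext i <;> fin_cases i <;> simp <;> ring
    · simp only [stdInv, aut_mul_apply, Fin.mk_one, Matrix.cons_val, rho_embOuter_hypRot_zorn,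
        torusElt_zorn]
      congr 1 <;> ext i <;> fin_cases i <;> simp <;> ring
    · exact absurd rfl hi

/-- Inside SL₃ the torus of the first entry is the full diagonal torus, while the tori of the other
two contain the hyperbolic rotations of two coordinate blocks. These generate SL₃. -/
theorem rho_mem
    (hH : ∀ j g, g (stdTriple K j) = stdTriple K j → (∀ i, i ≠ j → Commute g (stdInv K i)) → g ∈ H)
    (M : SL₃ K) : rho M ∈ H := by
  have h := eq_top_of_hypRot (N := H.comap rho) (rho_torusSL_mem hH) (rho_embLast_mem hH)
    (rho_embOuter_mem hH)
  exact (h ▸ Subgroup.mem_top M : M ∈ H.comap rho)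

omit [IsAlgClosed K] in
theorem rotation_mem
    (hH : ∀ j g, g (stdTriple K j) = stdTriple K j → (∀ i, i ≠ j → Commute g (stdInv K i)) → g ∈ H)
    {c s : K} {r : autGroup K} (h0 : r (stdTriple K 0) = zorn c (-c) ![s, 0, 0] ![-s, 0, 0])
    (h1 : r (stdTriple K 1) = stdTriple K 1) (h2 : r (stdTriple K 2) = stdTriple K 2) : r ∈ H := by
  refine hH 1 r h1 fun i hi => stdTriple_aut_ext fun j => ?_
  rw [aut_mul_apply, aut_mul_apply, stdInv_stdTriple]
  have hj : j ≠ 0 → r (stdTriple K j) = stdTriple K j := by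
    intro hj
    fin_cases j
    · exact absurd rfl hj
    · exact h1
    · exact h2
  by_cases hj0 : j = 0
  · subst hj0
    have : -zorn c (-c) ![s, 0, 0] ![-s, 0, 0] = zorn (-c) c ![-s, 0, 0] ![s, 0, 0] := by
      rw [← neg_one_smul K, zorn_smul]
      simp
    fin_cases i
    · simp only [Fin.zero_eta, if_true, aut_map_neg, h0, this]
      simp [stdInv, sElt_zorn]
    · exact absurd rfl hi
    · simp [h0, stdInv, torusElt_zorn]
  · rw [hj hj0, stdInv_stdTriple]
    split_ifs
    · rw [aut_map_neg, hj hj0]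
    · exact hj hj0

omit [NeZero (2 : K)] [IsAlgClosed K] in
theorem two_smul_e₁ : (2 : K) • (e₁ : SplitOctonion K) = 1 + stdTriple K 0 := by
  rw [one_eq_zorn, stdTriple, Matrix.cons_val_zero, zorn_add, zorn_smul]
  congr 1 <;> simp <;> norm_num

/-- Idempotents in general position are images of the standard one. -/
theorem exists_mem_apply_e₁
    (hH : ∀ j g, g (stdTriple K j) = stdTriple K j → (∀ i, i ≠ j → Commute g (stdInv K i)) → g ∈ H)
    {α : K} (h0 : α ≠ 0) (h1 : α ≠ 1) {u v : Fin 3 → K} (h : u ⬝ᵥ v = α * (1 - α)) :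
    ∃ g ∈ H, g e₁ = zorn α (1 - α) u v := by
  -- Since 2e₁ is 1 plus the first entry of the triple, a rotation with c = 2α − 1 moves e₁ to an
  -- idempotent with diagonal entry α.
  obtain ⟨s, hs⟩ := IsAlgClosed.exists_pow_nat_eq ((2 * α - 1) ^ 2 - 1) (n := 2) (by norm_num)
  have h2 := NeZero.ne (2 : K)
  have hs2 : s ^ 2 = 4 * α * (α - 1) := by rw [hs]; ring
  have hs0 : s ≠ 0 := by
    rintro rfl
    have : (2 * 2 : K) * α * (α - 1) = 0 := by linear_combination -hs2
    exact mul_ne_zero (mul_ne_zero (mul_ne_zero h2 h2) h0) (sub_ne_zero.mpr h1) this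
  obtain ⟨r, r0, r1, r2⟩ := exists_rotation (2 * α - 1) s (by rw [hs]; ring)
  have hr := rotation_mem hH r0 r1 r2
  -- The rotated idempotent has vector parts (s/2, 0, 0) and (−s/2, 0, 0), so these rescalings have
  -- dot product 1 and SL₃ can move one idempotent to the other.
  obtain ⟨M, hM1, hM2⟩ := exists_SL₃ (u := (2 / s) • u) (v := (-2 / s) • v) (by
    rw [smul_dotProduct, dotProduct_smul, h, smul_eq_mul, smul_eq_mul]
    field_simp
    linear_combination -hs2)
  refine ⟨rho M * r, mul_mem (rho_mem hH M) hr, ?_⟩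
  have e : (2 : K) • (rho M * r) e₁ = (2 : K) • zorn α (1 - α) u v := by
    rw [← aut_map_smul, two_smul_e₁, aut_mul_apply, aut_map_add, aut_map_one, r0, one_eq_zorn,
      zorn_add, show ((0 : Fin 3 → K) + ![s, 0, 0]) = s • ![1, 0, 0] by
        ext i; fin_cases i <;> simp,
      show ((0 : Fin 3 → K) + ![-s, 0, 0]) = (-s) • ![1, 0, 0] by
        ext i; fin_cases i <;> simp, rho_zorn, mulVec_smul, smul_vecMul, hM1, hM2, zorn_smul,
      smul_smul, smul_smul]
    congr 1
    · ring
    · ring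
    · congr 1; field_simp
    · congr 1; field_simp
  have := congrArg ((2 : K)⁻¹ • ·) e
  simpa [smul_smul, inv_mul_cancel₀ h2] using this

/-- Some element of H has the same image of e₁, and the difference fixes e₁, hence comes from SL₃.
-/
theorem mem_of_apply_e₁
    (hH : ∀ j g, g (stdTriple K j) = stdTriple K j → (∀ i, i ≠ j → Commute g (stdInv K i)) → g ∈ H)
    {g : autGroup K} (h0 : (g e₁).fst 0 0 ≠ 0) (h1 : (g e₁).fst 0 0 ≠ 1) : g ∈ H := by
  obtain ⟨e, hd⟩ := idempotent_coords (x := g e₁) (by rw [aut_tr, tr_zorn, add_zero])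
    (by rw [aut_nrm, nrm_zorn]; simp)
  obtain ⟨k, hk, hke⟩ := exists_mem_apply_e₁ hH h0 h1 hd
  rw [← e] at hke
  have : (k⁻¹ * g) e₁ = e₁ := by rw [aut_mul_apply, ← hke, aut_inv_apply_self]
  obtain ⟨M, hM⟩ := mem_range_rho this
  have hM' := rho_mem hH M
  rw [hM] at hM'
  simpa using mul_mem hk hM'

/-- A subgroup containing the three coordinate tori is the whole group. -/
theorem eq_top_of_tori
    (hH : ∀ j g, g (stdTriple K j) = stdTriple K j → (∀ i, i ≠ j → Commute g (stdInv K i)) → g ∈ H) :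
    H = ⊤ := by
  have h2 := NeZero.ne (2 : K)
  have hm := neg_one_ne_one' (K := K)
  have n21 : (2 : K) ≠ 1 := fun h => one_ne_zero (α := K) (by linear_combination h)
  -- The diagonal entry that must avoid 0 and 1 is a pairing with the complementary idempotent.
  -- Multiplying g on the right by an element of H moves it into general position; the value 2 is
  -- admissible because it is neither 0 nor 1.
  have key : ∀ g : autGroup K, ∀ (u v : Fin 3 → K), u ⬝ᵥ v = 2 * (1 - 2) →
      bil (zorn 2 (1 - 2) u v) (g⁻¹ (zorn 0 1 0 0)) ≠ 0 →
      bil (zorn 2 (1 - 2) u v) (g⁻¹ (zorn 0 1 0 0)) ≠ 1 → g ∈ H := by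
    intro g u v huv b0 b1
    obtain ⟨k, hk, hke⟩ := exists_mem_apply_e₁ hH h2 n21 huv
    have e : ((g * k) e₁).fst 0 0 = bil (zorn 2 (1 - 2) u v) (g⁻¹ (zorn 0 1 0 0)) := by
      rw [← hke, ← aut_bil g, aut_apply_inv_self, ← aut_mul_apply, ← zorn_eta ((g * k) e₁), bil_zorn]
      simp [zorn_fst00]
    rw [← e] at b0 b1
    have := mul_mem (mem_of_apply_e₁ hH b0 b1) (inv_mem hk)
    simpa using this
  rw [eq_top_iff]
  intro g _
  obtain ⟨e, hd⟩ := idempotent_coords (x := g⁻¹ (zorn 0 1 0 0)) (by rw [aut_tr, tr_zorn, zero_add])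
    (by rw [aut_nrm, nrm_zorn]; simp)
  generalize hα : (g⁻¹ (zorn 0 1 0 0)).fst 0 0 = α at e hd
  generalize hu : uvec (g⁻¹ (zorn 0 1 0 0)) = u at e hd
  generalize hv : vvec (g⁻¹ (zorn 0 1 0 0)) = v at e hd
  by_cases huv : u = 0 ∧ v = 0
  -- For a diagonal idempotent the pairing is 2 or −1, so any choice of vectors works.
  · obtain ⟨rfl, rfl⟩ := huv
    refine key g ![1, 0, 0] ![-2, 0, 0] (by simp [dotProduct, Fin.sum_univ_three]; norm_num) ?_ ?_ <;>
      rw [e, bil_zorn] <;> simp only [dotProduct_zero, sub_zero] <;>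
      rw [zero_dotProduct, eq_comm, mul_eq_zero] at hd <;> rcases hd with hd | hd
    · simpa [hd] using h2
    · have : α = 1 := by linear_combination -hd
      simp only [this]
      intro h; exact one_ne_zero (α := K) (by linear_combination -h)
    · simpa [hd] using n21
    · have : α = 1 := by linear_combination -hd
      simp only [this]
      intro h; exact hm (by linear_combination h)
  · obtain ⟨i, hi⟩ : ∃ i, v i ≠ 0 ∨ 2 * u i ≠ 0 := by
      by_contra! hcon
      exact huv ⟨funext fun i => (mul_eq_zero.mp (hcon i).2).resolve_left h2,
        funext fun i => (hcon i).1⟩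
    have : Infinite K := IsAlgClosed.instInfinite
    -- Vectors supported on one coordinate make the pairing a rational function of t, and t is
    -- chosen to avoid the values 0 and 1.
    obtain ⟨t, t0, t1, t2⟩ := exists_param_ne (2 * (1 - α) - α) hi
    have eb : bil (zorn 2 (1 - 2) (Pi.single i t) (Pi.single i (-2 / t))) (g⁻¹ (zorn 0 1 0 0)) =
        ((2 * (1 - α) - α) * t - v i * t ^ 2 + 2 * u i) / t := by
      rw [e, bil_zorn, single_dotProduct, single_dotProduct]
      field_simp
      ring
    refine key g (Pi.single i t) (Pi.single i (-2 / t)) ?_ ?_ ?_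
    · rw [single_dotProduct, Pi.single_eq_same]; field_simp; norm_num
    · rw [eb]; exact div_ne_zero t1 t0
    · rw [eb]
      intro h
      rw [div_eq_one_iff_eq t0] at h
      exact t2 (by linear_combination h)

end FullGroup

end SplitOctonion

namespace SplitOctonion

/-! ### Every algebraic automorphism is inner -/

section Inner

variable {K : Type*} [Field K] [NeZero (2 : K)]

/-- The torus attached to an entry of the standard triple. -/
def IsTorus (j : Fin 3) (t : autGroup K) : Prop :=
  t (stdTriple K j) = stdTriple K j ∧ ∀ i, i ≠ j → Commute t (stdInv K i)

theorem exists_torusElt_of_isTorus {t : autGroup K} (h : IsTorus 0 t) :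
    ∃ β γ, t = torusElt β γ := by
  refine eq_torusElt_of_commute (h.2 1 (by decide)) (h.2 2 (by decide)) ?_
  have e : (2 : K) • t e₁ = (2 : K) • e₁ := by
    rw [← aut_map_smul, two_smul_e₁, aut_map_add, aut_map_one, h.1]
  have := congrArg ((2 : K)⁻¹ • ·) e
  simpa [smul_smul, inv_mul_cancel₀ (NeZero.ne (2 : K))] using this

variable (K) in
theorem exists_cyclic : ∃ h : autGroup K, ∀ i, h (stdTriple K i) = stdTriple K (i + 1) := by
  have ht : IsTriple 1 1 1 (stdTriple K 1) (stdTriple K 2) (stdTriple K 0) := by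
    refine ⟨⟨mul_self_of_nrm ?_ ?_, mul_self_of_nrm ?_ ?_, ?_, ?_, ?_⟩, mul_self_of_nrm ?_ ?_,
      ?_, ?_, ?_, ?_⟩ <;>
    simp [stdTriple, tr_zorn, nrm_zorn, bil_zorn, zorn_mul, dotProduct, Fin.sum_univ_three,
      cross_apply]
  obtain ⟨h, h0, h1, h2⟩ := (isTriple_stdTriple K).exists_aut_apply one_ne_zero one_ne_zero
    one_ne_zero ht
  refine ⟨h, fun i => ?_⟩
  fin_cases i
  · exact h0
  · exact h1
  · exact h2

variable (K) in
theorem exists_shift (j : Fin 3) :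
    ∃ h : autGroup K, ∀ i, h (stdTriple K i) = stdTriple K (i + j) := by
  obtain ⟨h, hh⟩ := exists_cyclic K
  fin_cases j
  · exact ⟨1, fun i => by simp⟩
  · exact ⟨h, hh⟩
  · exact ⟨h * h, fun i => by rw [aut_mul_apply, hh, hh, add_assoc]; rfl⟩

theorem shift_stdInv {h : autGroup K} {j : Fin 3}
    (hh : ∀ i, h (stdTriple K i) = stdTriple K (i + j)) (i : Fin 3) :
    h * stdInv K i = stdInv K (i + j) * h := by
  refine stdTriple_aut_ext fun l => ?_
  rw [aut_mul_apply, aut_mul_apply, hh, stdInv_stdTriple, stdInv_stdTriple]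
  by_cases hil : i = l
  · rw [if_pos hil, if_pos (by rw [hil]), aut_map_neg, hh]
  · rw [if_neg hil, if_neg (fun h => hil (add_right_cancel h)), hh]

theorem isTorus_shift {h : autGroup K} {j : Fin 3}
    (hh : ∀ i, h (stdTriple K i) = stdTriple K (i + j)) {t : autGroup K} (ht : IsTorus j t) :
    IsTorus 0 (h⁻¹ * t * h) := by
  constructor
  · rw [aut_mul_apply, aut_mul_apply, hh, zero_add, ht.1, ← aut_inv_apply_self h (stdTriple K 0),
      hh, zero_add]
  · intro i hi
    have h1 := ht.2 (i + j) (fun h => hi (by simpa using h))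
    have h2 := shift_stdInv hh i
    have h3 : stdInv K i = h⁻¹ * stdInv K (i + j) * h := by rw [mul_assoc, ← h2]; group
    rw [h3, commute_iff_eq]
    calc h⁻¹ * t * h * (h⁻¹ * stdInv K (i + j) * h)
        = h⁻¹ * (t * stdInv K (i + j)) * h := by group
      _ = h⁻¹ * (stdInv K (i + j) * t) * h := by rw [h1.eq]
      _ = _ := by group

/-- A cyclic automorphism permuting the standard triple reduces every index to the first, where s
inverts the diagonal torus. -/
theorem IsTorus.conj_stdInv {j : Fin 3} {t : autGroup K} (ht : IsTorus j t) :
    stdInv K j * t * (stdInv K j)⁻¹ = t⁻¹ := by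
  obtain ⟨h, hh⟩ := exists_shift K j
  obtain ⟨β, γ, e⟩ := exists_torusElt_of_isTorus (isTorus_shift hh ht)
  have h2 := shift_stdInv hh 0
  rw [zero_add] at h2
  have h3 : stdInv K j = h * stdInv K 0 * h⁻¹ := by rw [h2]; group
  have h4 : t = h * torusElt β γ * h⁻¹ := by rw [← e]; group
  have h5 : stdInv K 0 * torusElt β γ = (torusElt β γ)⁻¹ * stdInv K 0 := by
    rw [torusElt_inv]; exact sElt_mul_torusElt β γ
  rw [h3, h4]
  calc h * stdInv K 0 * h⁻¹ * (h * torusElt β γ * h⁻¹) * (h * stdInv K 0 * h⁻¹)⁻¹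
      = h * (stdInv K 0 * torusElt β γ) * (stdInv K 0)⁻¹ * h⁻¹ := by group
    _ = _ := by rw [h5]; group

variable [IsAlgClosed K]

theorem isTorus_trivial_or_inversion {θ : MulAut (autGroup K)} (hθ : IsAlgebraicAut θ)
    (hs : ∀ i, θ (stdInv K i) = stdInv K i) (j : Fin 3) :
    (∀ t, IsTorus j t → θ t = t) ∨ (∀ t, IsTorus j t → θ t = t⁻¹) := by
  obtain ⟨h, hh⟩ := exists_shift K j
  let θ' : MulAut (autGroup K) := MulAut.conj h⁻¹ * θ * MulAut.conj h
  have hθ' : IsAlgebraicAut θ' := ((isAlgebraicAut_conj _).mul hθ).mul (isAlgebraicAut_conj _)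
  have hs' : ∀ i, θ' (stdInv K i) = stdInv K i := by
    intro i
    have h2 := shift_stdInv hh i
    have h3 : h * stdInv K i * h⁻¹ = stdInv K (i + j) := by rw [h2]; group
    simp only [θ', MulAut.mul_apply, MulAut.conj_apply, h3, hs]
    rw [inv_inv, mul_assoc, ← h2]; group
  have key : ∀ t, θ t = h * θ' (h⁻¹ * t * h) * h⁻¹ := by
    intro t
    simp only [θ', MulAut.mul_apply, MulAut.conj_apply]
    rw [show h * (h⁻¹ * t * h) * h⁻¹ = t by group]
    group
  rcases torus_trivial_or_inversion hθ' (hs' 1) (hs' 2) with h1 | h1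
  · left
    intro t ht
    obtain ⟨β, γ, e⟩ := exists_torusElt_of_isTorus (isTorus_shift hh ht)
    rw [key, e, h1, ← e]; group
  · right
    intro t ht
    obtain ⟨β, γ, e⟩ := exists_torusElt_of_isTorus (isTorus_shift hh ht)
    rw [key, e, h1, ← torusElt_inv, ← e]; group

theorem fin_three_cases (j : Fin 3) : j = 0 ∨ j = 1 ∨ j = 2 := by
  fin_cases j <;> simp

/-- Every automorphism of the algebraic group `Aut(C)` is inner. -/
theorem exists_eq_conj {θ : MulAut (autGroup K)} (hθ : IsAlgebraicAut θ) :
    ∃ g, θ = MulAut.conj g := by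
  obtain ⟨g, hg⟩ := exists_conj_stdInv K θ
  let θ' : MulAut (autGroup K) := MulAut.conj g⁻¹ * θ
  have hθ' : IsAlgebraicAut θ' := (isAlgebraicAut_conj _).mul hθ
  have hs : ∀ i, θ' (stdInv K i) = stdInv K i := by
    intro i
    simp only [θ', MulAut.mul_apply, MulAut.conj_apply, hg]
    group
  -- If θ' inverts the j-th torus, conjugation by the j-th involution undoes this. That involution
  -- centralises the other two tori, so the three corrections do not interfere.
  have hn : ∀ j, ∃ n : autGroup K, (n = 1 ∨ n = stdInv K j) ∧
      ∀ t, IsTorus j t → n * θ' t * n⁻¹ = t := by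
    intro j
    rcases isTorus_trivial_or_inversion hθ' hs j with h | h
    · exact ⟨1, Or.inl rfl, fun t ht => by rw [h t ht]; group⟩
    · refine ⟨stdInv K j, Or.inr rfl, fun t ht => ?_⟩
      rw [h t ht, ← ht.conj_stdInv]
      have := stdInv_mul_self K j
      have e : (stdInv K j)⁻¹ = stdInv K j := by rwa [inv_eq_iff_mul_eq_one]
      rw [e]
      calc stdInv K j * (stdInv K j * t * stdInv K j) * stdInv K j
          = (stdInv K j * stdInv K j) * t * (stdInv K j * stdInv K j) := by group
        _ = t := by rw [this]; group
  choose n hn1 hn2 using hn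
  have hcomm : ∀ i j, i ≠ j → ∀ t, IsTorus j t → n i * t * (n i)⁻¹ = t := by
    intro i j hij t ht
    rcases hn1 i with h | h
    · rw [h]; group
    · rw [h, ← (ht.2 i hij).eq]; group
  have hnn : ∀ i j, Commute (n i) (n j) := by
    intro i j
    rcases hn1 i with h | h <;> rcases hn1 j with h' | h' <;> rw [h, h']
    · exact Commute.one_left _
    · exact Commute.one_right _
    · exact stdInv_comm K i j
  let φ : MulAut (autGroup K) := MulAut.conj (n 0 * n 1 * n 2) * θ'
  have hφ : ∀ j t, IsTorus j t → φ t = t := by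
    intro j t ht
    simp only [φ, MulAut.mul_apply, MulAut.conj_apply]
    have e2 := hn2 j t ht
    have e1 : θ' t = (n j)⁻¹ * t * n j := by
      rw [mul_assoc, eq_inv_mul_iff_mul_eq, ← mul_inv_eq_iff_eq_mul, e2]
    rcases fin_three_cases j with rfl | rfl | rfl
    · calc n 0 * n 1 * n 2 * θ' t * (n 0 * n 1 * n 2)⁻¹
          = n 0 * n 1 * n 2 * (n 0)⁻¹ * t * ((n 0 * n 1 * n 2) * (n 0)⁻¹)⁻¹ := by rw [e1]; group
        _ = n 1 * (n 2 * t * (n 2)⁻¹) * (n 1)⁻¹ := by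
            rw [show n 0 * n 1 * n 2 * (n 0)⁻¹ = n 1 * n 2 by
              rw [mul_assoc (n 0), ((hnn 0 1).mul_right (hnn 0 2)).eq]; group]
            group
        _ = t := by rw [hcomm 2 0 (by decide) t ht, hcomm 1 0 (by decide) t ht]
    · calc n 0 * n 1 * n 2 * θ' t * (n 0 * n 1 * n 2)⁻¹
          = n 0 * n 1 * n 2 * (n 1)⁻¹ * t * ((n 0 * n 1 * n 2) * (n 1)⁻¹)⁻¹ := by rw [e1]; group
        _ = n 0 * (n 2 * t * (n 2)⁻¹) * (n 0)⁻¹ := by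
            rw [show n 0 * n 1 * n 2 * (n 1)⁻¹ = n 0 * n 2 by
              rw [mul_assoc (n 0), (hnn 1 2).eq]; group]
            group
        _ = t := by rw [hcomm 2 1 (by decide) t ht, hcomm 0 1 (by decide) t ht]
    · calc n 0 * n 1 * n 2 * θ' t * (n 0 * n 1 * n 2)⁻¹
          = n 0 * (n 1 * t * (n 1)⁻¹) * (n 0)⁻¹ := by rw [e1]; group
        _ = t := by rw [hcomm 1 2 (by decide) t ht, hcomm 0 2 (by decide) t ht]
  let H : Subgroup (autGroup K) := φ.toMonoidHom.eqLocus (MonoidHom.id _)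
  have hH : H = ⊤ := eq_top_of_tori fun j t h1 h2 => hφ j t ⟨h1, h2⟩
  refine ⟨(n 0 * n 1 * n 2 * g⁻¹)⁻¹, MulEquiv.ext fun x => ?_⟩
  have hx : φ x = x := (hH ▸ Subgroup.mem_top x : x ∈ H)
  rw [MulAut.conj_apply]
  nth_rewrite 2 [← hx]
  simp only [φ, θ', MulAut.mul_apply, MulAut.conj_apply]
  group

end Inner

end SplitOctonion

open scoped Quaternion

namespace SplitOctonion

/-! ### Coordinatewise change of rings -/

section MapOct

variable {R S : Type*} [CommRing R] [CommRing S] (f : R →+* S)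

/-- Coordinatewise extension of a ring homomorphism to octonions. -/
def mapOct (x : SplitOctonion R) : SplitOctonion S := ⟨x.fst.map f, x.snd.map f⟩

theorem mapOct_fst (x : SplitOctonion R) (i j : Fin 2) :
    (mapOct f x).fst i j = f (x.fst i j) := rfl

theorem mapOct_snd (x : SplitOctonion R) (i j : Fin 2) :
    (mapOct f x).snd i j = f (x.snd i j) := rfl

theorem mapOct_add (x y : SplitOctonion R) : mapOct f (x + y) = mapOct f x + mapOct f y := by
  ext i j <;> simp [mapOct_fst, mapOct_snd, fst_add, snd_add]

theorem mapOct_zero : mapOct f 0 = 0 := by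
  ext i j <;> simp [mapOct_fst, mapOct_snd, fst_zero, snd_zero]

theorem mapOct_smul (r : R) (x : SplitOctonion R) : mapOct f (r • x) = f r • mapOct f x := by
  ext i j <;> simp [mapOct_fst, mapOct_snd, fst_smul, snd_smul]

theorem mapOct_one : mapOct f 1 = 1 := by
  apply ext_coords <;> simp [mapOct_fst, mapOct_snd, fst_one, snd_one]

theorem mapOct_mul (x y : SplitOctonion R) : mapOct f (x * y) = mapOct f x * mapOct f y := by
  apply ext_coords <;> simp [mapOct_fst, mapOct_snd, fst_mul00, fst_mul01, fst_mul10, fst_mul11,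
    snd_mul00, snd_mul01, snd_mul10, snd_mul11]

theorem tr_mapOct (x : SplitOctonion R) : tr (mapOct f x) = f (tr x) := by
  simp [tr, mapOct_fst]

theorem bil_mapOct (x y : SplitOctonion R) : bil (mapOct f x) (mapOct f y) = f (bil x y) := by
  simp [bil, mapOct_fst, mapOct_snd]

theorem mapOct_injective (hf : Function.Injective f) : Function.Injective (mapOct f) := by
  intro x y h
  have h1 := congrArg SplitOctonion.fst h
  have h2 := congrArg SplitOctonion.snd h
  ext i j
  · exact hf (congrFun (congrFun h1 i) j)
  · exact hf (congrFun (congrFun h2 i) j)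

end MapOct

/-! ### Extending automorphisms along a field homomorphism -/

section BaseChange

variable {k K : Type*} [Field k] [Field K] (f : k →+* K)

theorem mapOct_zorn (a b : k) (u v : Fin 3 → k) :
    mapOct f (zorn a b u v) = zorn (f a) (f b) (fun i => f (u i)) (fun i => f (v i)) := by
  apply ext_coords <;> simp [mapOct_fst, mapOct_snd, zorn]

theorem mapOct_stdTriple (i : Fin 3) : mapOct f (stdTriple k i) = stdTriple K i := by
  fin_cases i <;> simp [stdTriple, mapOct_zorn] <;> congr 1 <;> ext j <;> fin_cases j <;> simp

theorem mapOct_stdBasis (j : (Fin 2 × Fin 2) ⊕ (Fin 2 × Fin 2)) :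
    mapOct f (stdBasis k j) = stdBasis K j := by
  apply (stdBasis K).repr.injective
  ext i
  have hk : (stdBasis k).repr (stdBasis k j) i = if j = i then 1 else 0 := by
    rw [Module.Basis.repr_self, Finsupp.single_apply]
  rw [Module.Basis.repr_self, Finsupp.single_apply]
  rcases i with i | i
  · rw [stdBasis_repr_inl] at hk ⊢
    rw [mapOct_fst, hk, apply_ite f, map_one, map_zero]
  · rw [stdBasis_repr_inr] at hk ⊢
    rw [mapOct_snd, hk, apply_ite f, map_one, map_zero]

theorem isTriple_mapOct_iff {a b c : SplitOctonion k} :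
    IsTriple 1 1 1 (mapOct f a) (mapOct f b) (mapOct f c) ↔ IsTriple 1 1 1 a b c := by
  have hsq : ∀ x : SplitOctonion k, mapOct f x * mapOct f x = (1 : K) • 1 ↔ x * x = (1 : k) • 1 := by
    intro x
    rw [← mapOct_mul, one_smul, one_smul, ← mapOct_one f, (mapOct_injective f f.injective).eq_iff]
  have hz : ∀ r : k, f r = 0 ↔ r = 0 := fun r => map_eq_zero f
  constructor
  · rintro ⟨⟨h1, h2, h3, h4, h5⟩, h6, h7, h8, h9, h10⟩
    rw [← mapOct_mul] at h10
    simp only [hsq, tr_mapOct, bil_mapOct, hz] at *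
    exact ⟨⟨h1, h2, h3, h4, h5⟩, h6, h7, h8, h9, h10⟩
  · rintro ⟨⟨h1, h2, h3, h4, h5⟩, h6, h7, h8, h9, h10⟩
    refine ⟨⟨?_, ?_, ?_, ?_, ?_⟩, ?_, ?_, ?_, ?_, ?_⟩ <;>
      simp only [tr_mapOct, bil_mapOct, ← mapOct_mul, mapOct_smul, mapOct_one, map_one, map_zero, *]

theorem mapOct_tripleMap (a b c : SplitOctonion k) (p : ℍ[k,1,1] × ℍ[k,1,1]) :
    mapOct f (tripleMap 1 1 a b c p) = tripleMap 1 1 (mapOct f a) (mapOct f b) (mapOct f c)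
      (⟨f p.1.re, f p.1.imI, f p.1.imJ, f p.1.imK⟩, ⟨f p.2.re, f p.2.imI, f p.2.imJ, f p.2.imK⟩) := by
  simp only [tripleMap_apply, quatMap_apply, mapOct_add, mapOct_mul, mapOct_smul, mapOct_one]

variable [NeZero (2 : k)] [NeZero (2 : K)]

/-- The image of the standard triple determines an automorphism. Transporting that image triple to
`K` and using transitivity there produces the extension. -/
theorem exists_baseChange (g : autGroup k) :
    ∃ h : autGroup K, ∀ x, h (mapOct f x) = mapOct f (g x) := by
  have ht : IsTriple 1 1 1 (mapOct f (g (stdTriple k 0))) (mapOct f (g (stdTriple k 1)))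
      (mapOct f (g (stdTriple k 2))) :=
    (isTriple_mapOct_iff f).mpr ((isTriple_stdTriple k).map g)
  obtain ⟨h, h0, h1, h2⟩ := (isTriple_stdTriple K).exists_aut_apply one_ne_zero one_ne_zero
    one_ne_zero ht
  refine ⟨h, fun x => ?_⟩
  obtain ⟨p, rfl⟩ := (isTriple_stdTriple k).tripleMap_surjective one_ne_zero one_ne_zero
    one_ne_zero x
  rw [aut_tripleMap, mapOct_tripleMap, mapOct_tripleMap, aut_tripleMap, mapOct_stdTriple,
    mapOct_stdTriple, mapOct_stdTriple, h0, h1, h2]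

omit [NeZero (2 : k)] in
theorem eq_of_apply_mapOct {h h' : autGroup K} (e : ∀ x, h (mapOct f x) = h' (mapOct f x)) :
    h = h' :=
  stdTriple_aut_ext fun j => by rw [← mapOct_stdTriple f, e]

/-- The action of a field homomorphism on automorphisms of the octonions. -/
noncomputable def baseChange : autGroup k →* autGroup K where
  toFun g := (exists_baseChange f g).choose
  map_one' := eq_of_apply_mapOct f fun x => by
    rw [(exists_baseChange f 1).choose_spec, aut_one_apply, aut_one_apply]
  map_mul' g h := eq_of_apply_mapOct f fun x => by
    rw [(exists_baseChange f (g * h)).choose_spec, aut_mul_apply, aut_mul_apply,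
      (exists_baseChange f h).choose_spec, (exists_baseChange f g).choose_spec]

theorem baseChange_mapOct (g : autGroup k) (x : SplitOctonion k) :
    baseChange f g (mapOct f x) = mapOct f (g x) :=
  (exists_baseChange f g).choose_spec x

theorem eq_baseChange {g : autGroup k} {h : autGroup K}
    (e : ∀ x, h (mapOct f x) = mapOct f (g x)) : h = baseChange f g :=
  eq_of_apply_mapOct f fun x => by rw [e, baseChange_mapOct]

theorem baseChange_injective : Function.Injective (baseChange f) := by
  intro g g' h
  refine aut_ext fun x => mapOct_injective f f.injective ?_
  rw [← baseChange_mapOct, ← baseChange_mapOct, h]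

theorem entry_baseChange (i j : (Fin 2 × Fin 2) ⊕ (Fin 2 × Fin 2)) (g : autGroup k) :
    entry i j (baseChange f g) = f (entry i j g) := by
  rcases i with i | i
  · rw [entry_inl, entry_inl, ← mapOct_stdBasis f, baseChange_mapOct, mapOct_fst]
  · rw [entry_inr, entry_inr, ← mapOct_stdBasis f, baseChange_mapOct, mapOct_snd]

theorem autDet_baseChange (g : autGroup k) : autDet (baseChange f g) = f (autDet g) := by
  -- The formula is needed for both fields, which may live in different universes, hence two copies.
  have h : ∀ {F : Type _} [Field F] (g : autGroup F), autDet g =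
      (Matrix.of fun i j => entry i j g).det := by
    intro F _ g
    rw [autDet, ← LinearMap.det_toMatrix (stdBasis F)]
    rfl
  have h' : ∀ {F : Type _} [Field F] (g : autGroup F), autDet g =
      (Matrix.of fun i j => entry i j g).det := by
    intro F _ g
    rw [autDet, ← LinearMap.det_toMatrix (stdBasis F)]
    rfl
  rw [h, h', RingHom.map_det]
  congr 1
  ext i j
  simp [entry_baseChange]

omit [NeZero (2 : k)] [NeZero (2 : K)] in
theorem eq_of_entry_eq {g h : autGroup K} (e : ∀ i j, entry i j g = entry i j h) : g = h := by
  apply Subtype.ext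
  apply LinearEquiv.toLinearMap_injective
  apply (LinearMap.toMatrix (stdBasis K) (stdBasis K)).injective
  ext i j
  exact e i j

end BaseChange

/-! ### Rational points and Galois descent -/

section Rational

variable {k K : Type*} [Field k] [Field K] [Algebra k K]

theorem exists_apply_mapOct {g : autGroup K} (hg : g ∈ rationalPoints k K) (x : SplitOctonion k) :
    ∃ y, g (mapOct (algebraMap k K) x) = mapOct (algebraMap k K) y := by
  have hx : x ∈ Submodule.span k (Set.range (stdBasis k)) := (stdBasis k).mem_span x
  induction hx using Submodule.span_induction with
  | zero => exact ⟨0, by rw [mapOct_zero]; exact map_zero g.1⟩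
  | add x y _ _ hx hy =>
    obtain ⟨x', hx⟩ := hx
    obtain ⟨y', hy⟩ := hy
    exact ⟨x' + y', by rw [mapOct_add, aut_map_add, hx, hy, mapOct_add]⟩
  | smul r x _ hx =>
    obtain ⟨x', hx⟩ := hx
    exact ⟨r • x', by rw [mapOct_smul, aut_map_smul, hx, mapOct_smul]⟩
  | mem x hx =>
    obtain ⟨j, rfl⟩ := hx
    have h1 : ∀ p, ∃ r : k, algebraMap k K r = entry (Sum.inl p) j g := fun p => hg _ _
    have h2 : ∀ p, ∃ r : k, algebraMap k K r = entry (Sum.inr p) j g := fun p => hg _ _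
    choose a ha using h1
    choose b hb using h2
    refine ⟨⟨fun i l => a (i, l), fun i l => b (i, l)⟩, ?_⟩
    rw [mapOct_stdBasis]
    ext i l
    · rw [mapOct_fst, ha, entry_inl]
    · rw [mapOct_snd, hb, entry_inr]

variable [NeZero (2 : k)] [NeZero (2 : K)]

/-- A rational g carries the standard triple to a triple with coordinates in `k`, and transitivity
over `k` supplies the automorphism. -/
theorem mem_rationalPoints_iff {g : autGroup K} :
    g ∈ rationalPoints k K ↔ ∃ h : autGroup k, g = baseChange (algebraMap k K) h := by
  constructor
  · intro hg
    choose y hy using exists_apply_mapOct hg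
    have ht : IsTriple 1 1 1 (y (stdTriple k 0)) (y (stdTriple k 1)) (y (stdTriple k 2)) := by
      rw [← isTriple_mapOct_iff (algebraMap k K), ← hy, ← hy, ← hy, mapOct_stdTriple,
        mapOct_stdTriple, mapOct_stdTriple]
      exact (isTriple_stdTriple K).map g
    obtain ⟨h, h0, h1, h2⟩ := (isTriple_stdTriple k).exists_aut_apply one_ne_zero one_ne_zero
      one_ne_zero ht
    refine ⟨h, stdTriple_aut_ext fun j => ?_⟩
    rw [← mapOct_stdTriple (algebraMap k K), hy, baseChange_mapOct]
    rcases fin_three_cases j with rfl | rfl | rfl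
    · rw [h0]
    · rw [h1]
    · rw [h2]
  · rintro ⟨h, rfl⟩ i j
    exact ⟨entry i j h, (entry_baseChange _ i j h).symm⟩

omit [NeZero (2 : k)] in
theorem coordRing_baseChange {f : autGroup K → K} (hf : f ∈ coordRing k K) (τ : K ≃ₐ[k] K)
    (g : autGroup K) : f (baseChange (τ : K →+* K) g) = τ (f g) := by
  induction hf using Algebra.adjoin_induction with
  | mem f hf =>
    rcases hf with ⟨p, rfl⟩ | rfl
    · exact entry_baseChange _ _ _ _
    · change (autDet _)⁻¹ = τ (autDet g)⁻¹
      rw [autDet_baseChange, map_inv₀]; rfl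
  | algebraMap r => exact (τ.commutes r).symm
  | add f f' _ _ hf hf' => rw [Pi.add_apply, Pi.add_apply, hf, hf', map_add]
  | mul f f' _ _ hf hf' => rw [Pi.mul_apply, Pi.mul_apply, hf, hf', map_mul]

-- Functions in the `k`-coordinate ring commute with the Galois action, and pulling a matrix entry
-- back along θ stays in that ring.
omit [NeZero (2 : k)] in
theorem DefinedOver.baseChange_comm {θ : MulAut (autGroup K)} (hθ : DefinedOver k θ)
    (τ : K ≃ₐ[k] K) (g : autGroup K) :
    θ (baseChange (τ : K →+* K) g) = baseChange (τ : K →+* K) (θ g) := by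
  refine eq_of_entry_eq fun i j => ?_
  rw [entry_baseChange]
  exact coordRing_baseChange (hθ _ (entry_mem_coordRing i j)) τ g

omit [NeZero (2 : k)] in
theorem baseChange_surjective (τ : K ≃ₐ[k] K) : Function.Surjective (baseChange (τ : K →+* K)) := by
  intro g
  refine ⟨baseChange (τ.symm : K →+* K) g, ?_⟩
  refine eq_of_entry_eq fun i j => ?_
  rw [entry_baseChange, entry_baseChange]
  simp

omit [NeZero (2 : k)] in
theorem mem_rationalPoints_of_fixed [IsGalois k K] {g : autGroup K}
    (h : ∀ τ : K ≃ₐ[k] K, baseChange (τ : K →+* K) g = g) : g ∈ rationalPoints k K := by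
  intro i j
  have : entry i j g ∈ Set.range (algebraMap k K) := by
    rw [InfiniteGalois.mem_range_algebraMap_iff_fixed]
    intro τ
    have := entry_baseChange (τ : K →+* K) i j g
    rw [h τ] at this
    exact this.symm
  exact this

end Rational

/-! ### Triviality of the centre -/

section Center

variable {K : Type*} [Field K] [NeZero (2 : K)] [IsAlgClosed K]

/-- A central element lies in the torus or its coset by s, and the coset fails to commute with a
torus element that is not its own inverse. So it fixes the first entry of the triple, and commuting
with the cyclic automorphism it fixes all three. -/
theorem eq_one_of_central {z : autGroup K} (hz : ∀ g, Commute z g) : z = 1 := by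
  obtain ⟨h, hh⟩ := exists_cyclic K
  have key : z (stdTriple K 0) = stdTriple K 0 := by
    rcases eq_torusElt_or_of_commute (hz (sigmaB K)) (hz (sigmaC K)) with ⟨β, γ, e⟩ | ⟨β, γ, e⟩
    · rw [e, stdTriple, Matrix.cons_val_zero, torusElt_zorn]
      congr 1 <;> ext i <;> fin_cases i <;> simp
    · exfalso
      obtain ⟨m, hm0, hm2, -⟩ := exists_param (K := K)
      have h1 := (hz (torusElt (Units.mk0 m hm0) 1)).eq
      rw [e, mul_assoc, sElt_mul_torusElt, ← mul_assoc, ← mul_assoc, mul_left_inj, torusElt_mul,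
        torusElt_mul] at h1
      have h2 := (torusElt_injective h1).1
      rw [mul_comm, mul_left_inj] at h2
      have h3 := congrArg Units.val h2
      simp only [Units.val_inv_eq_inv_val, Units.val_mk0] at h3
      apply hm2
      rw [sq]
      nth_rewrite 1 [← h3]
      exact inv_mul_cancel₀ hm0
  have step : ∀ i, z (stdTriple K i) = stdTriple K i → z (stdTriple K (i + 1)) = stdTriple K (i + 1) := by
    intro i hi
    rw [← hh, ← aut_mul_apply, (hz h).eq, aut_mul_apply, hi]
  refine stdTriple_aut_ext fun j => ?_
  rw [aut_one_apply]
  rcases fin_three_cases j with rfl | rfl | rfl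
  · exact key
  · exact step 0 key
  · exact step 1 (step 0 key)

theorem conj_injective {g h : autGroup K} (e : MulAut.conj g = MulAut.conj h) : g = h := by
  have : h⁻¹ * g = 1 := eq_one_of_central fun x => by
    have := congrArg (fun φ : MulAut (autGroup K) => φ x) e
    simp only [MulAut.conj_apply] at this
    rw [commute_iff_eq]
    calc h⁻¹ * g * x = h⁻¹ * (g * x * g⁻¹) * g := by group
      _ = x * (h⁻¹ * g) := by rw [this]; group
  rwa [inv_mul_eq_one, eq_comm] at this

end Center

/-! ### Descent of involutions to the base field -/

section Classes

variable {k K : Type*} [Field k] [Field K] [Algebra k K] [NeZero (2 : k)] [NeZero (2 : K)]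
  [IsAlgClosed K]

-- If conjugation by g commutes with a Galois element τ, then τ(g) and g induce the same inner
-- automorphism, hence coincide.
omit [NeZero (2 : k)] in
theorem mem_rationalPoints_of_definedOver [IsGalois k K] {g : autGroup K}
    (h : DefinedOver k (MulAut.conj g)) : g ∈ rationalPoints k K := by
  refine mem_rationalPoints_of_fixed fun τ => conj_injective (MulEquiv.ext fun x => ?_)
  obtain ⟨y, rfl⟩ := baseChange_surjective τ x
  have := h.baseChange_comm τ y
  rw [this, MulAut.conj_apply, MulAut.conj_apply, map_mul, map_mul, map_inv]

/-- The involutions of the group defined over `k` come from involutions of the octonion algebra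
over `k`. -/
theorem isKInvolution_iff [IsGalois k K] {θ : MulAut (autGroup K)} : IsKInvolution k θ ↔
    ∃ g : autGroup k, g * g = 1 ∧ g ≠ 1 ∧ θ = MulAut.conj (baseChange (algebraMap k K) g) := by
  constructor
  · rintro ⟨ho, hθ⟩
    have h2 : θ * θ = 1 := by
      rw [← sq, ← ho, pow_orderOf_eq_one]
    have hinv : θ⁻¹ = θ := by rwa [inv_eq_iff_mul_eq_one]
    obtain ⟨g, rfl⟩ := exists_eq_conj (θ := θ) ⟨hθ.extend, by rw [hinv]; exact hθ.extend⟩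
    obtain ⟨g0, rfl⟩ := mem_rationalPoints_iff.mp (mem_rationalPoints_of_definedOver hθ)
    refine ⟨g0, ?_, ?_, rfl⟩
    · apply baseChange_injective (algebraMap k K)
      apply conj_injective
      rw [map_mul, map_mul, h2, map_one, map_one]
    · rintro rfl
      rw [map_one, map_one, orderOf_one] at ho
      exact absurd ho (by decide)
  · rintro ⟨g, h2, h1, rfl⟩
    refine ⟨?_, definedOver_conj (mem_rationalPoints_iff.mpr ⟨g, rfl⟩)⟩
    rw [orderOf_eq_prime_iff]
    refine ⟨by rw [sq, ← map_mul, ← map_mul, h2, map_one, map_one], fun h => h1 ?_⟩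
    apply baseChange_injective (algebraMap k K)
    apply conj_injective
    rw [h, map_one, map_one]

theorem conj_baseChange_equiv_iff {g h : autGroup k} :
    (∃ x ∈ rationalPoints k K, MulAut.conj (baseChange (algebraMap k K) h) =
      MulAut.conj x * MulAut.conj (baseChange (algebraMap k K) g) * (MulAut.conj x)⁻¹) ↔
    ∃ x : autGroup k, h = x * g * x⁻¹ := by
  constructor
  · rintro ⟨x, hx, e⟩
    obtain ⟨x, rfl⟩ := mem_rationalPoints_iff.mp hx
    refine ⟨x, ?_⟩
    rw [← map_inv, ← map_mul, ← map_mul] at e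
    have := conj_injective e
    rw [← map_inv, ← map_mul, ← map_mul] at this
    exact baseChange_injective _ this
  · rintro ⟨x, rfl⟩
    exact ⟨_, mem_rationalPoints_iff.mpr ⟨x, rfl⟩, by simp only [map_mul, map_inv]⟩

end Classes

end SplitOctonion

open scoped Quaternion

namespace SplitOctonion

/-! ### Fixed and negated spaces of an involution -/

section Types

variable {k : Type*} [Field k]

/-- A subspace on which the norm form is nondegenerate, as witnessed by a projection, and which is
not zero contains an anisotropic vector. -/
theorem exists_bil_ne_zero_of_projection {V : SplitOctonion k → Prop}
    {P : SplitOctonion k → SplitOctonion k} {r : k} (hr : r ≠ 0)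
    (hP : ∀ z, V (P z)) (hb : ∀ x z, V x → bil x (P z) = r * bil x z) {x : SplitOctonion k}
    (hx : x ≠ 0) (hV : V x) : ∃ y, V y ∧ bil x y ≠ 0 := by
  obtain ⟨z, hz⟩ := exists_bil_ne_zero hx
  exact ⟨P z, hP z, by rw [hb _ _ hV]; exact mul_ne_zero hr hz⟩

theorem exists_nrm_ne_zero_of_projection {V : SplitOctonion k → Prop}
    (hadd : ∀ x y, V x → V y → V (x + y))
    {P : SplitOctonion k → SplitOctonion k} {r : k} (hr : r ≠ 0)
    (hP : ∀ z, V (P z)) (hb : ∀ x z, V x → bil x (P z) = r * bil x z) {x : SplitOctonion k}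
    (hx : x ≠ 0) (hV : V x) : ∃ y, V y ∧ nrm y ≠ 0 := by
  obtain ⟨y, hy, hxy⟩ := exists_bil_ne_zero_of_projection hr hP hb hx hV
  by_contra! hall
  have e := nrm_add x y
  rw [hall _ hV, hall _ hy, hall _ (hadd _ _ hV hy)] at e
  exact hxy (by linear_combination -e)

theorem mul_mul_self_of_tr (x c : SplitOctonion k) (hc : tr c = 0) :
    (x * c) * c = (-nrm c) • x := by
  rw [right_alternative, mul_self, hc, zero_smul, zero_sub, ← neg_smul, mul_smul_comm, mul_one]

theorem bil_zero_left (x : SplitOctonion k) : bil 0 x = 0 := by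
  simp [bil, fst_zero, snd_zero]

theorem eq_zero_of_mul_eq_zero {x c : SplitOctonion k} (hc : tr c = 0) (hn : nrm c ≠ 0)
    (h : x * c = 0) : x = 0 := by
  have := mul_mul_self_of_tr x c hc
  rw [h, zero_mul, eq_comm, smul_eq_zero] at this
  exact this.resolve_left (neg_ne_zero.mpr hn)

variable [NeZero (2 : k)] {g : autGroup k} (hg : g * g = 1)
include hg

omit [NeZero (2 : k)] in
theorem apply_apply (x : SplitOctonion k) : g (g x) = x := by
  rw [← aut_mul_apply, hg, aut_one_apply]

omit [NeZero (2 : k)] in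
theorem apply_add_apply (x : SplitOctonion k) : g (x + g x) = x + g x := by
  rw [aut_map_add, apply_apply hg, add_comm]

omit [NeZero (2 : k)] in
theorem apply_sub_apply (x : SplitOctonion k) : g (x - g x) = -(x - g x) := by
  rw [aut_map_sub, apply_apply hg, neg_sub]

omit [NeZero (2 : k)] hg in
theorem bil_add_apply {x : SplitOctonion k} (hx : g x = x) (z : SplitOctonion k) :
    bil x (z + g z) = 2 * bil x z := by
  have h1 := aut_bil g x z
  rw [hx] at h1
  rw [bil_add_right, h1]; ring

omit [NeZero (2 : k)] hg in
theorem bil_sub_apply {x : SplitOctonion k} (hx : g x = -x) (z : SplitOctonion k) :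
    bil x (z - g z) = 2 * bil x z := by
  have h1 := aut_bil g x z
  rw [hx, ← neg_one_smul k, bil_smul_left] at h1
  rw [sub_eq_add_neg, bil_add_right, ← neg_one_smul k (g z), bil_smul_right]
  linear_combination h1

theorem exists_neg_nrm_ne_zero (hg1 : g ≠ 1) : ∃ c, g c = -c ∧ nrm c ≠ 0 := by
  obtain ⟨z, hz⟩ : ∃ z, z - g z ≠ 0 := by
    by_contra! h
    exact hg1 (aut_ext fun x => by rw [aut_one_apply, ← sub_eq_zero, ← neg_sub, h, neg_zero])
  exact exists_nrm_ne_zero_of_projection (V := fun x => g x = -x)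
    (fun x y hx hy => by rw [aut_map_add, hx, hy, neg_add]) (NeZero.ne (2 : k))
    (apply_sub_apply hg) (fun x z hx => bil_sub_apply hx z) hz (apply_sub_apply hg z)

/-- The negated subspace of an involution contains a square root of one. -/
theorem exists_neg_nrm_eq (hg1 : g ≠ 1) : ∃ c, g c = -c ∧ nrm c = -1 := by
  obtain ⟨c, hc, hcn⟩ := exists_neg_nrm_ne_zero hg hg1
  have h2 := NeZero.ne (2 : k)
  -- The negated space is nondegenerate, so an isotropic vector in it makes the norm universal
  -- there.
  have univ : ∀ e : SplitOctonion k, e ≠ 0 → g e = -e → nrm e = 0 → ∃ c, g c = -c ∧ nrm c = -1 := by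
    intro e he hge hne
    obtain ⟨y, hy, hey⟩ := exists_bil_ne_zero_of_projection (V := fun x => g x = -x) h2
      (apply_sub_apply hg) (fun x z hx => bil_sub_apply hx z) he hge
    refine ⟨((-1 - nrm y) / bil e y) • e + y, ?_, ?_⟩
    · rw [aut_map_add, aut_map_smul, hge, hy, smul_neg, neg_add]
    · rw [nrm_add, nrm_smul, hne, bil_smul_left]
      field_simp
      ring
  -- Splitness enters through this isotropic vector. Its fixed and negated parts d and e have
  -- opposite norms: if N(e) ≠ 0, then de/N(e) is negated with norm −1.
  let x : SplitOctonion k := zorn 1 0 0 0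
  have hxn : nrm x = 0 := by simp [x, nrm_zorn]
  have hx0 : x ≠ 0 := by
    intro h
    have := congrArg (fun x : SplitOctonion k => x.fst 0 0) h
    simp [x, zorn_fst00, fst_zero] at this
  set d := x + g x with hd
  set e := x - g x with he
  have hgd : g d = d := apply_add_apply hg x
  have hge : g e = -e := apply_sub_apply hg x
  have hde : d + e = (2 : k) • x := by rw [hd, he, two_smul]; abel
  have hsum : nrm d + nrm e = 0 := by
    have := nrm_add d e
    rw [hde, nrm_smul, hxn, bil_comm, bil_eq_zero_of_signs hge hgd] at this
    linear_combination -this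
  by_cases hen : nrm e = 0
  · by_cases he0 : e = 0
    · rw [he0, add_zero] at hde
      have hd0 : d ≠ 0 := by rw [hde]; exact smul_ne_zero h2 hx0
      refine univ (d * c) (fun h => hd0 (eq_zero_of_mul_eq_zero (tr_eq_zero_of_sign hc) hcn h)) ?_ ?_
      · rw [aut_map_mul, hgd, hc, mul_neg]
      · rw [nrm_mul, show nrm d = 0 by rw [hen, add_zero] at hsum; exact hsum, zero_mul]
    · exact univ e he0 hge hen
  · refine ⟨(nrm e)⁻¹ • (d * e), ?_, ?_⟩
    · rw [aut_map_smul, aut_map_mul, hgd, hge, mul_neg, smul_neg]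
    · rw [nrm_smul, nrm_mul, show nrm d = -nrm e by linear_combination hsum]
      field_simp

/-- The fixed space of an involution has dimension at least four. -/
theorem four_le_finrank_fixed (hg1 : g ≠ 1) :
    4 ≤ Module.finrank k (LinearMap.ker ((g : SplitOctonion k ≃ₗ[k] SplitOctonion k).toLinearMap -
      LinearMap.id)) := by
  obtain ⟨c, hc, hcn⟩ := exists_neg_nrm_ne_zero hg hg1
  have : FiniteDimensional k (SplitOctonion k) := Module.Basis.finiteDimensional_of_finite (stdBasis k)
  set f := (g : SplitOctonion k ≃ₗ[k] SplitOctonion k).toLinearMap - LinearMap.id with hf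
  have hfx : ∀ x, f x = g x - x := fun x => rfl
  have h1 := LinearMap.finrank_range_add_finrank_ker f
  rw [finrank_eq] at h1
  -- Right multiplication by an anisotropic negated c embeds the negated space into the fixed space,
  -- which therefore has at least half of the dimension 8.
  have h2 : Module.finrank k (LinearMap.range f) ≤ Module.finrank k (LinearMap.ker f) := by
    have hmem : ∀ x : LinearMap.range f, (LinearMap.mulRight k c) x.1 ∈ LinearMap.ker f := by
      rintro ⟨_, x, rfl⟩
      change f (f x * c) = 0
      rw [hfx, aut_map_mul, hc, hfx, sub_eq_zero,
        ← neg_sub x, aut_map_neg, apply_sub_apply hg, neg_neg, mul_neg, neg_mul]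
    refine LinearMap.finrank_le_finrank_of_injective
      (f := ((LinearMap.mulRight k c).comp (LinearMap.range f).subtype).codRestrict
        (LinearMap.ker f) hmem) ?_
    rw [← LinearMap.ker_eq_bot, LinearMap.ker_eq_bot']
    rintro x hx
    have := congrArg Subtype.val hx
    exact Subtype.ext (eq_zero_of_mul_eq_zero (tr_eq_zero_of_sign hc) hcn this)
  omega

theorem exists_fixed_ne_zero (hg1 : g ≠ 1) (i : SplitOctonion k) :
    ∃ x, x ≠ 0 ∧ g x = x ∧ tr x = 0 ∧ bil x i = 0 := by
  have h4 := four_le_finrank_fixed hg hg1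
  set V := LinearMap.ker ((g : SplitOctonion k ≃ₗ[k] SplitOctonion k).toLinearMap -
      LinearMap.id) with hV
  let f : SplitOctonion k →ₗ[k] k × k :=
    { toFun := fun x => (tr x, bil x i)
      map_add' := fun x y => by rw [tr_add, bil_add_left]; rfl
      map_smul' := fun r x => by rw [tr_smul, bil_smul_left]; rfl }
  have : FiniteDimensional k (SplitOctonion k) := Module.Basis.finiteDimensional_of_finite (stdBasis k)
  have hker : LinearMap.ker (f.comp V.subtype) ≠ ⊥ := by
    apply LinearMap.ker_ne_bot_of_finrank_lt
    rw [Module.finrank_prod, Module.finrank_self]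
    omega
  obtain ⟨x, hx, hx0⟩ := Submodule.exists_mem_ne_zero_of_ne_bot hker
  have hx' : f x.1 = 0 := hx
  have h1 : tr x.1 = 0 := congrArg Prod.fst hx'
  have h2 : bil x.1 i = 0 := congrArg Prod.snd hx'
  have h3 : g x.1 - x.1 = 0 := x.2
  exact ⟨x.1, fun h => hx0 (Subtype.ext h), sub_eq_zero.mp h3, h1, h2⟩

omit [NeZero (2 : k)] in
theorem projection_fixed_pure (h2 : (2 : k) ≠ 0) (z : SplitOctonion k) :
    (fun x => g x = x ∧ tr x = 0) ((z + g z) + (-tr (z + g z) / 2) • 1) := by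
  constructor
  · rw [aut_map_add, apply_add_apply hg, aut_map_smul, aut_map_one]
  · rw [tr_add, tr_smul, tr_one]; field_simp; ring

theorem exists_bil_ne_zero_fixed_pure {x : SplitOctonion k} (hx : x ≠ 0) (hgx : g x = x)
    (ht : tr x = 0) : ∃ y, (g y = y ∧ tr y = 0) ∧ bil x y ≠ 0 := by
  have h2 := NeZero.ne (2 : k)
  refine exists_bil_ne_zero_of_projection (V := fun x => g x = x ∧ tr x = 0) h2
    (projection_fixed_pure hg h2) (fun x z hx => ?_) hx ⟨hgx, ht⟩
  rw [bil_add_right, bil_add_apply hx.1, bil_smul_right, bil_one_right, hx.2, mul_zero, add_zero]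

theorem exists_fixed_pure (hg1 : g ≠ 1) : ∃ y, (g y = y ∧ tr y = 0) ∧ nrm y ≠ 0 := by
  have h2 := NeZero.ne (2 : k)
  obtain ⟨x, hx, hgx, ht, -⟩ := exists_fixed_ne_zero hg hg1 0
  refine exists_nrm_ne_zero_of_projection (V := fun x => g x = x ∧ tr x = 0) ?_ h2
    (projection_fixed_pure hg h2) (fun x z hx => ?_) hx ⟨hgx, ht⟩
  · rintro x y ⟨h1, h2⟩ ⟨h3, h4⟩
    exact ⟨by rw [aut_map_add, h1, h3], by rw [tr_add, h2, h4, add_zero]⟩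
  · rw [bil_add_right, bil_add_apply hx.1, bil_smul_right, bil_one_right, hx.2, mul_zero,
      add_zero]

theorem exists_fixed_pure_orthogonal (hg1 : g ≠ 1) {i : SplitOctonion k} (hi : g i = i)
    (hti : tr i = 0) (hni : nrm i ≠ 0) : ∃ y, (g y = y ∧ tr y = 0 ∧ bil y i = 0) ∧ nrm y ≠ 0 := by
  have h2 := NeZero.ne (2 : k)
  obtain ⟨x, hx, hgx, ht, hxi⟩ := exists_fixed_ne_zero hg hg1 i
  -- This is twice the orthogonal projection onto the fixed vectors orthogonal to 1 and i.
  let P : SplitOctonion k → SplitOctonion k := fun z =>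
    (((z + g z) + (-tr (z + g z) / 2) • 1) + (-bil (z + g z) i / (2 * nrm i)) • i)
  refine exists_nrm_ne_zero_of_projection (V := fun x => g x = x ∧ tr x = 0 ∧ bil x i = 0) ?_ h2
    (P := P) (fun z => ⟨?_, ?_, ?_⟩) (fun x z hx => ?_) hx ⟨hgx, ht, hxi⟩
  · rintro x y ⟨h1, h2, h3⟩ ⟨h4, h5, h6⟩
    exact ⟨by rw [aut_map_add, h1, h4], by rw [tr_add, h2, h5, add_zero],
      by rw [bil_add_left, h3, h6, add_zero]⟩
  · simp only [P]
    rw [aut_map_add, (projection_fixed_pure hg h2 z).1, aut_map_smul, hi]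
  · simp only [P]
    rw [tr_add, (projection_fixed_pure hg h2 z).2, tr_smul, hti]; ring
  · simp only [P]
    rw [bil_add_left, bil_add_left, bil_smul_left, bil_smul_left, bil_self, bil_comm 1,
      bil_one_right, hti]
    field_simp
    ring
  · simp only [P]
    rw [bil_add_right, bil_add_right, bil_add_apply hx.1, bil_smul_right, bil_one_right, hx.2.1,
      bil_smul_right, hx.2.2]
    ring

end Types

/-! ### The quaternion type of an involution -/

section HasType

variable {k : Type*} [Field k]

/-- The fixed algebra of `g` contains the standard generators of a quaternion algebra with
parameters `α`, `β`. -/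
def HasType (g : autGroup k) (α β : k) : Prop :=
  ∃ i j, IsPair α β i j ∧ g i = i ∧ g j = j

namespace HasType

variable {g h : autGroup k} {α β : k}

theorem conj (hT : HasType g α β) (x : autGroup k) : HasType (x * g * x⁻¹) α β := by
  obtain ⟨i, j, ⟨h1, h2, h3, h4, h5⟩, hi, hj⟩ := hT
  refine ⟨x i, x j, ⟨?_, ?_, ?_, ?_, ?_⟩, ?_, ?_⟩
  · rw [← aut_map_mul, h1, aut_map_smul, aut_map_one]
  · rw [← aut_map_mul, h2, aut_map_smul, aut_map_one]
  · rw [aut_tr, h3]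
  · rw [aut_tr, h4]
  · rw [aut_bil, h5]
  · rw [aut_mul_apply, aut_mul_apply, aut_inv_apply_self, hi]
  · rw [aut_mul_apply, aut_mul_apply, aut_inv_apply_self, hj]

theorem symm (hT : HasType g α β) : HasType g β α := by
  obtain ⟨i, j, ⟨h1, h2, h3, h4, h5⟩, hi, hj⟩ := hT
  exact ⟨j, i, ⟨h2, h1, h4, h3, by rw [bil_comm, h5]⟩, hj, hi⟩

/-- Replacing j by (r + si)j keeps it pure and orthogonal to i, and multiplies its square by the
norm of r + si. -/
theorem mul_norm (hT : HasType g α β) (r s : k) : HasType g α (β * (r ^ 2 - α * s ^ 2)) := by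
  obtain ⟨i, j, h, hi, hj⟩ := hT
  have ht := h.tr_mul
  have hni := nrm_of_mul_self h.tr_left h.sq_left
  have hnj := nrm_of_mul_self h.tr_right h.sq_right
  refine ⟨i, r • j + s • (i * j), ⟨h.sq_left, mul_self_of_nrm ?_ ?_, h.tr_left, ?_, ?_⟩, hi, ?_⟩
  · rw [tr_add, tr_smul, tr_smul, h.tr_right, ht]; ring
  · rw [nrm_add, nrm_smul, nrm_smul, nrm_mul, bil_smul_left, bil_smul_right, h.bil_right_mul,
      hni, hnj]
    ring
  · rw [tr_add, tr_smul, tr_smul, h.tr_right, ht]; ring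
  · rw [bil_add_right, bil_smul_right, bil_smul_right, h.bil_eq, h.bil_left_mul]; ring
  · rw [aut_map_add, aut_map_smul, aut_map_smul, aut_map_mul, hi, hj]

theorem mul_sq_right (hT : HasType g α β) (r : k) : HasType g α (β * r ^ 2) := by
  have := hT.mul_norm r 0
  rwa [show r ^ 2 - α * 0 ^ 2 = r ^ 2 by ring] at this

theorem one_one_of_left [NeZero (2 : k)] (hT : HasType g 1 β) (hβ : β ≠ 0) : HasType g 1 1 := by
  have h2 := NeZero.ne (2 : k)
  -- The norm r² − s² factors; taking r + s = β⁻¹ and r − s = 1 gives the value β⁻¹.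
  have := hT.mul_norm ((β⁻¹ + 1) / 2) ((β⁻¹ - 1) / 2)
  rwa [show β * (((β⁻¹ + 1) / 2) ^ 2 - 1 * ((β⁻¹ - 1) / 2) ^ 2) = 1 by field_simp; ring] at this

/-- A representation of a nonzero value by the form on pure quaternions gives a new first
parameter. -/
theorem exists_left [NeZero (2 : k)] (hT : HasType g α β) (hg : g * g = 1) (hg1 : g ≠ 1) (r s t : k)
    {α' : k} (hα' : α' ≠ 0) (e : α * r ^ 2 + β * s ^ 2 - α * β * t ^ 2 = α') :
    ∃ β', β' ≠ 0 ∧ HasType g α' β' := by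
  obtain ⟨i, j, h, hi, hj⟩ := hT
  have htr : tr (quatMap α β i j ⟨0, r, s, t⟩) = 0 := by rw [h.tr_quatMap]; ring
  have hn : nrm (quatMap α β i j ⟨0, r, s, t⟩) = -α' := by
    rw [h.nrm_quatMap, ← e]; ring
  have hgx : g (quatMap α β i j ⟨0, r, s, t⟩) = quatMap α β i j ⟨0, r, s, t⟩ := by
    rw [aut_quatMap, hi, hj]
  obtain ⟨y, ⟨hy1, hy2, hy3⟩, hy⟩ := exists_fixed_pure_orthogonal hg hg1 hgx htr
    (by rw [hn]; exact neg_ne_zero.mpr hα')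
  exact ⟨-nrm y, neg_ne_zero.mpr hy, _, y, ⟨mul_self_of_nrm htr hn,
    mul_self_of_nrm hy2 (neg_neg _).symm, htr, hy2, by rw [bil_comm]; exact hy3⟩, hgx, hy1⟩

/-- An isotropic fixed pure vector makes the norm universal on fixed pure vectors. One of norm −1
has square 1 and serves as a first generator, and first parameter 1 already forces the split type.
-/
theorem one_one_of_isotropic [NeZero (2 : k)] (hT : HasType g α β) (hα : α ≠ 0) (hβ : β ≠ 0)
    (hg : g * g = 1) (hg1 : g ≠ 1) {r s t : k} (h0 : ¬(r = 0 ∧ s = 0 ∧ t = 0))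
    (e : α * r ^ 2 + β * s ^ 2 - α * β * t ^ 2 = 0) : HasType g 1 1 := by
  have h2 := NeZero.ne (2 : k)
  obtain ⟨i, j, h, hi, hj⟩ := hT
  set x := quatMap α β i j ⟨0, r, s, t⟩ with hx
  have htr : tr x = 0 := by rw [h.tr_quatMap]; ring
  have hn : nrm x = 0 := by rw [h.nrm_quatMap]; linear_combination -e
  have hgx : g x = x := by rw [hx, aut_quatMap, hi, hj]
  have hx0 : x ≠ 0 := by
    intro hx0
    have hq := h.quatMap_eq_zero hα hβ (p := ⟨0, r, s, t⟩) fun q => by rw [← hx, hx0, bil_zero_left]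
    have e1 := congrArg QuaternionAlgebra.imI hq
    have e2 := congrArg QuaternionAlgebra.imJ hq
    have e3 := congrArg QuaternionAlgebra.imK hq
    exact h0 ⟨e1, e2, e3⟩
  obtain ⟨y, ⟨hy1, hy2⟩, hxy⟩ := exists_bil_ne_zero_fixed_pure hg hx0 hgx htr
  set p := ((-1 - nrm y) / bil x y) • x + y with hp
  have hpn : nrm p = -1 := by
    rw [hp, nrm_add, nrm_smul, hn, bil_smul_left]
    field_simp
    ring
  have hpt : tr p = 0 := by rw [hp, tr_add, tr_smul, htr, hy2]; ring
  have hgp : g p = p := by rw [hp, aut_map_add, aut_map_smul, hgx, hy1]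
  obtain ⟨z, ⟨hz1, hz2, hz3⟩, hz⟩ := exists_fixed_pure_orthogonal hg hg1 hgp hpt
    (by rw [hpn]; exact neg_ne_zero.mpr one_ne_zero)
  have hT' : HasType g 1 (-nrm z) := ⟨p, z, ⟨mul_self_of_nrm hpt hpn,
    mul_self_of_nrm hz2 (neg_neg _).symm, hpt, hz2, by rw [bil_comm]; exact hz3⟩, hgp, hz1⟩
  exact hT'.one_one_of_left (neg_ne_zero.mpr hz)

theorem exists_isTriple [NeZero (2 : k)] (hT : HasType g α β) (hg : g * g = 1) (hg1 : g ≠ 1) :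
    ∃ i j c, IsTriple α β 1 i j c ∧ g i = i ∧ g j = j ∧ g c = -c := by
  obtain ⟨i, j, h, hi, hj⟩ := hT
  obtain ⟨c, hc, hcn⟩ := exists_neg_nrm_eq hg hg1
  have hct := tr_eq_zero_of_sign hc
  exact ⟨i, j, c, ⟨h, mul_self_of_nrm hct hcn, hct, bil_eq_zero_of_signs hc hi,
    bil_eq_zero_of_signs hc hj, bil_eq_zero_of_signs hc (by rw [aut_map_mul, hi, hj])⟩, hi, hj, hc⟩

/-- Involutions of the same type are conjugate. -/
theorem exists_conj_eq [NeZero (2 : k)] (hα : α ≠ 0) (hβ : β ≠ 0) (hT : HasType g α β)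
    (hg : g * g = 1) (hg1 : g ≠ 1) (hT' : HasType h α β) (hh : h * h = 1) (hh1 : h ≠ 1) :
    ∃ x, h = x * g * x⁻¹ := by
  obtain ⟨i, j, c, ht, hi, hj, hc⟩ := hT.exists_isTriple hg hg1
  obtain ⟨i', j', c', ht', hi', hj', hc'⟩ := hT'.exists_isTriple hh hh1
  obtain ⟨x, xi, xj, xc⟩ := ht.exists_aut_apply hα hβ one_ne_zero ht'
  refine ⟨x, ht'.aut_ext hα hβ one_ne_zero ?_ ?_ ?_⟩
  · rw [← xi, aut_mul_apply, aut_mul_apply, aut_inv_apply_self, hi, xi, hi']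
  · rw [← xj, aut_mul_apply, aut_mul_apply, aut_inv_apply_self, hj, xj, hj']
  · rw [← xc, aut_mul_apply, aut_mul_apply, aut_inv_apply_self, hc, aut_map_neg, xc, hc']

/-- The norm of a fixed pure octonion is given by the form on pure quaternions. -/
theorem exists_form_eq [NeZero (2 : k)] (hα : α ≠ 0) (hβ : β ≠ 0) (hT : HasType g α β)
    (hg : g * g = 1) (hg1 : g ≠ 1) {x : SplitOctonion k} (hx : g x = x) (ht : tr x = 0) :
    ∃ r s t, nrm x = -(α * r ^ 2 + β * s ^ 2 - α * β * t ^ 2) ∧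
      (r = 0 ∧ s = 0 ∧ t = 0 → x = 0) := by
  have h2 := NeZero.ne (2 : k)
  obtain ⟨i, j, c, hijc, hi, hj, hc⟩ := hT.exists_isTriple hg hg1
  obtain ⟨⟨p, q⟩, rfl⟩ := hijc.tripleMap_surjective hα hβ one_ne_zero x
  -- In the double by c the involution negates the second half, so a fixed vector lies in the first.
  have hq : quatMap α β i j q * c = 0 := by
    have e := hx
    rw [aut_tripleMap, hi, hj, hc, tripleMap_apply, tripleMap_apply, mul_neg] at e
    have e' : (2 : k) • (quatMap α β i j q * c) = 0 := by
      rw [two_smul]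
      have := add_left_cancel e
      nth_rewrite 1 [← this]
      exact neg_add_cancel _
    exact (smul_eq_zero.mp e').resolve_left h2
  rw [tripleMap_apply, hq, add_zero] at ht ⊢
  simp only
  simp only at ht
  rw [hijc.toIsPair.tr_quatMap] at ht
  have hre : p.re = 0 := (mul_eq_zero.mp ht).resolve_left h2
  refine ⟨p.imI, p.imJ, p.imK, ?_, ?_⟩
  · rw [hijc.toIsPair.nrm_quatMap, hre]; ring
  · rintro ⟨h1, h2, h3⟩
    rw [quatMap_apply, hre, h1, h2, h3]; simp

/-- Two types of the same involution represent the same values. -/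
theorem form_represents [NeZero (2 : k)] (hα : α ≠ 0) (hβ : β ≠ 0) (hT : HasType g α β)
    (hg : g * g = 1) (hg1 : g ≠ 1) {α' β' : k} (hα' : α' ≠ 0) (hβ' : β' ≠ 0) (hT' : HasType g α' β')
    {r s t : k} (h0 : ¬(r = 0 ∧ s = 0 ∧ t = 0)) : ∃ r' s' t', ¬(r' = 0 ∧ s' = 0 ∧ t' = 0) ∧
    α' * r' ^ 2 + β' * s' ^ 2 - α' * β' * t' ^ 2 = α * r ^ 2 + β * s ^ 2 - α * β * t ^ 2 := by
  obtain ⟨i, j, h, hi, hj⟩ := hT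
  obtain ⟨r', s', t', e, e0⟩ := hT'.exists_form_eq hα' hβ' hg hg1
    (x := quatMap α β i j ⟨0, r, s, t⟩) (by rw [aut_quatMap, hi, hj]) (by rw [h.tr_quatMap]; ring)
  refine ⟨r', s', t', ?_, ?_⟩
  · intro h'
    have hq := h.quatMap_eq_zero hα hβ fun q => by rw [e0 h', bil_zero_left]
    exact h0 ⟨congrArg QuaternionAlgebra.imI hq, congrArg QuaternionAlgebra.imJ hq,
      congrArg QuaternionAlgebra.imK hq⟩
  · rw [h.nrm_quatMap] at e
    linear_combination e

end HasType

variable [NeZero (2 : k)]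

theorem exists_hasType {g : autGroup k} (hg : g * g = 1) (hg1 : g ≠ 1) :
    ∃ α β, α ≠ 0 ∧ β ≠ 0 ∧ HasType g α β := by
  obtain ⟨i, ⟨hi, hti⟩, hni⟩ := exists_fixed_pure hg hg1
  obtain ⟨j, ⟨hj, htj, hji⟩, hnj⟩ := exists_fixed_pure_orthogonal hg hg1 hi hti hni
  exact ⟨-nrm i, -nrm j, neg_ne_zero.mpr hni, neg_ne_zero.mpr hnj, i, j,
    ⟨mul_self_of_nrm hti (neg_neg _).symm, mul_self_of_nrm htj (neg_neg _).symm, hti, htj,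
      by rw [bil_comm]; exact hji⟩, hi, hj⟩

/-- Negating the last entry of a triple gives another triple with the same parameters; the
automorphism between them is the required involution. -/
theorem IsTriple.exists_involution {α β : k} {i j c : SplitOctonion k} (hα : α ≠ 0) (hβ : β ≠ 0)
    (h : IsTriple α β 1 i j c) : ∃ g : autGroup k, g * g = 1 ∧ g ≠ 1 ∧ HasType g α β := by
  have h' : IsTriple α β 1 i j (-c) := by
    have hb : ∀ x, bil (-c) x = -bil c x := fun x => by
      rw [← neg_one_smul k, bil_smul_left]; ring
    refine ⟨h.toIsPair, ?_, ?_, ?_, ?_, ?_⟩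
    · rw [neg_mul_neg, h.sq_last]
    · rw [← neg_one_smul k, tr_smul, h.tr_last, mul_zero]
    · rw [hb, h.bil_last_left, neg_zero]
    · rw [hb, h.bil_last_right, neg_zero]
    · rw [hb, h.bil_last_mul, neg_zero]
  obtain ⟨g, hi, hj, hc⟩ := h.exists_aut_apply hα hβ one_ne_zero h'
  refine ⟨g, h.aut_ext hα hβ one_ne_zero ?_ ?_ ?_, ?_, i, j, h.toIsPair, hi, hj⟩
  · rw [aut_mul_apply, hi, hi, aut_one_apply]
  · rw [aut_mul_apply, hj, hj, aut_one_apply]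
  · rw [aut_mul_apply, hc, aut_map_neg, hc, neg_neg, aut_one_apply]
  · rintro rfl
    rw [aut_one_apply] at hc
    have e := h.sq_last
    have e2 : (2 : k) • c = 0 := by
      rw [two_smul]; nth_rewrite 1 [hc]; exact neg_add_cancel c
    rw [(smul_eq_zero.mp e2).resolve_left (NeZero.ne _), zero_mul, one_smul] at e
    exact one_ne_zero' e.symm

/-- All types occur. -/
theorem exists_involution_hasType {α β : k} (hα : α ≠ 0) (hβ : β ≠ 0) :
    ∃ g : autGroup k, g * g = 1 ∧ g ≠ 1 ∧ HasType g α β := by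
  -- Here i is the companion matrix of X² − α, c is the diagonal matrix anticommuting with it, and j
  -- lies in the orthogonal second summand with norm −β.
  refine IsTriple.exists_involution (i := ⟨!![0, α; 1, 0], 0⟩) (j := ⟨0, !![1, 0; 0, β]⟩)
    (c := ⟨!![1, 0; 0, -1], 0⟩) hα hβ ?_
  refine ⟨⟨mul_self_of_nrm ?_ ?_, mul_self_of_nrm ?_ ?_, ?_, ?_, ?_⟩, mul_self_of_nrm ?_ ?_,
    ?_, ?_, ?_, ?_⟩ <;>
  simp [tr, nrm, bil, fst_mul00, fst_mul01, fst_mul10, fst_mul11, snd_mul00,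
    snd_mul01, snd_mul10, snd_mul11]

end HasType

end SplitOctonion

namespace SplitOctonion

/-! ### Isomorphy classes and their quaternion parameters -/

section IsoClasses

variable {k : Type*} [Field k]

instance [NeZero (2 : k)] : NeZero (2 : AlgebraicClosure k) := ⟨by
  rw [← map_ofNat (algebraMap k (AlgebraicClosure k)) 2]
  exact (map_ne_zero _).mpr (NeZero.ne (2 : k))⟩

variable [NeZero (2 : k)]

/-- The isomorphy class `c` comes from the involution `g` of the octonion algebra over `k`. -/
def Represents (c : IsoClasses k) (g : autGroup k) : Prop :=
  g * g = 1 ∧ g ≠ 1 ∧ ∃ h : IsKInvolution k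
    (MulAut.conj (baseChange (algebraMap k (AlgebraicClosure k)) g)), c = isoClass h

/-- The isomorphy class `c` consists of involutions whose fixed quaternion algebra has parameters
`α`, `β`. -/
def ClassType (c : IsoClasses k) (α β : k) : Prop :=
  α ≠ 0 ∧ β ≠ 0 ∧ ∃ g, Represents c g ∧ HasType g α β

theorem represents_congr {c c' : IsoClasses k} {g g' : autGroup k} (h : Represents c g)
    (h' : Represents c' g') : c = c' ↔ ∃ x, g' = x * g * x⁻¹ := by
  obtain ⟨-, -, hk, rfl⟩ := h
  obtain ⟨-, -, hk', rfl⟩ := h'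
  rw [isoClass, isoClass, Quotient.eq]
  exact conj_baseChange_equiv_iff

namespace ClassType

variable {c c' : IsoClasses k} {α β α' β' : k}

theorem eq (h : ClassType c α β) (h' : ClassType c' α β) : c = c' := by
  obtain ⟨hα, hβ, g, hg, hT⟩ := h
  obtain ⟨-, -, g', hg', hT'⟩ := h'
  exact (represents_congr hg hg').mpr
    (hT.exists_conj_eq hα hβ hg.1 hg.2.1 hT' hg'.1 hg'.2.1)

theorem symm (h : ClassType c α β) : ClassType c β α := by
  obtain ⟨hα, hβ, g, hg, hT⟩ := h
  exact ⟨hβ, hα, g, hg, hT.symm⟩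

theorem mul_norm (h : ClassType c α β) {r s : k} (hn : r ^ 2 - α * s ^ 2 ≠ 0) :
    ClassType c α (β * (r ^ 2 - α * s ^ 2)) := by
  obtain ⟨hα, hβ, g, hg, hT⟩ := h
  exact ⟨hα, mul_ne_zero hβ hn, g, hg, hT.mul_norm r s⟩

theorem mul_sq_right (h : ClassType c α β) {r : k} (hr : r ≠ 0) : ClassType c α (β * r ^ 2) := by
  obtain ⟨hα, hβ, g, hg, hT⟩ := h
  exact ⟨hα, mul_ne_zero hβ (pow_ne_zero 2 hr), g, hg, hT.mul_sq_right r⟩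

theorem mul_sq_left (h : ClassType c α β) {r : k} (hr : r ≠ 0) : ClassType c (α * r ^ 2) β :=
  (h.symm.mul_sq_right hr).symm

theorem one_one_of_left (h : ClassType c 1 β) : ClassType c 1 1 := by
  obtain ⟨hα, hβ, g, hg, hT⟩ := h
  exact ⟨one_ne_zero, one_ne_zero, g, hg, hT.one_one_of_left hβ⟩

theorem one_one_of_isSquare (h : ClassType c α β) (hs : IsSquare α) : ClassType c 1 1 := by
  obtain ⟨r, hr⟩ := hs
  have hr0 : r ≠ 0 := by
    rintro rfl
    exact h.1 (by rw [hr, mul_zero])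
  have := h.mul_sq_left (inv_ne_zero hr0)
  rw [hr, show r * r * r⁻¹ ^ 2 = 1 by field_simp] at this
  exact this.one_one_of_left

theorem exists_left (h : ClassType c α β) (r s t : k)
    (e : α * r ^ 2 + β * s ^ 2 - α * β * t ^ 2 = α') (hα' : α' ≠ 0) :
    ∃ β', ClassType c α' β' := by
  obtain ⟨hα, hβ, g, hg, hT⟩ := h
  obtain ⟨β', hβ', hT'⟩ := hT.exists_left hg.1 hg.2.1 r s t hα' e
  exact ⟨β', hα', hβ', g, hg, hT'⟩

theorem one_one_of_isotropic (h : ClassType c α β) {r s t : k} (h0 : ¬(r = 0 ∧ s = 0 ∧ t = 0))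
    (e : α * r ^ 2 + β * s ^ 2 - α * β * t ^ 2 = 0) : ClassType c 1 1 := by
  obtain ⟨hα, hβ, g, hg, hT⟩ := h
  exact ⟨one_ne_zero, one_ne_zero, g, hg,
    hT.one_one_of_isotropic hα hβ hg.1 hg.2.1 h0 e⟩

theorem form_represents (h : ClassType c α β) (h' : ClassType c α' β') {r s t : k}
    (h0 : ¬(r = 0 ∧ s = 0 ∧ t = 0)) : ∃ r' s' t', ¬(r' = 0 ∧ s' = 0 ∧ t' = 0) ∧
    α' * r' ^ 2 + β' * s' ^ 2 - α' * β' * t' ^ 2 = α * r ^ 2 + β * s ^ 2 - α * β * t ^ 2 := by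
  obtain ⟨hα, hβ, g, hg, hT⟩ := h
  obtain ⟨hα', hβ', g', hg', hT'⟩ := h'
  obtain ⟨x, rfl⟩ := (represents_congr hg hg').mp rfl
  exact (hT.conj x).form_represents hα hβ hg'.1 hg'.2.1 hα' hβ' hT' h0

end ClassType

theorem classType_isoClass {θ : MulAut (autGroup (AlgebraicClosure k))} {g : autGroup k} {α β : k}
    (hα : α ≠ 0) (hβ : β ≠ 0) (hg : g * g = 1) (hg1 : g ≠ 1) (hT : HasType g α β)
    (e : θ = MulAut.conj (baseChange (algebraMap k (AlgebraicClosure k)) g))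
    (h : IsKInvolution k θ) : ClassType (isoClass h) α β := by
  subst e
  exact ⟨hα, hβ, g, ⟨hg, hg1, h, rfl⟩, hT⟩

theorem baseChange_sElt {K : Type*} [Field K] [NeZero (2 : K)] (f : k →+* K) :
    baseChange f (sElt k) = sElt K := by
  refine (eq_baseChange f fun x => ?_).symm
  rw [← zorn_eta x, sElt_zorn, mapOct_zorn, mapOct_zorn, sElt_zorn]
  congr 1 <;> ext i <;> fin_cases i <;> simp

theorem baseChange_torusElt_neg_one {K : Type*} [Field K] [NeZero (2 : K)] (f : k →+* K) :
    baseChange f (torusElt 1 (-1)) = torusElt 1 (-1) := by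
  refine (eq_baseChange f fun x => ?_).symm
  rw [← zorn_eta x, torusElt_zorn, mapOct_zorn, mapOct_zorn, torusElt_zorn]
  congr 1 <;> ext i <;> fin_cases i <;> simp

omit [NeZero (2 : k)] in
variable (k) in
theorem hasType_sElt : HasType (sElt k) 1 1 := by
  refine ⟨stdTriple k 1, stdTriple k 2, ⟨(isTriple_stdTriple k).sq_right,
    (isTriple_stdTriple k).sq_last, (isTriple_stdTriple k).tr_right,
    (isTriple_stdTriple k).tr_last, ?_⟩, ?_, ?_⟩
  · rw [bil_comm]; exact (isTriple_stdTriple k).bil_last_right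
  · exact stdInv_stdTriple k 0 1
  · exact stdInv_stdTriple k 0 2

omit [NeZero (2 : k)] in
variable (k) in
theorem sElt_ne_one : sElt k ≠ 1 := by
  intro h
  have := congrArg (fun g : autGroup k => (g e₁).fst 0 0) h
  simp [sElt_zorn, zorn_fst00] at this

omit [NeZero (2 : k)] in
variable (k) in
theorem sElt_torusElt_sq :
    (sElt k * torusElt 1 (-1)) * (sElt k * torusElt 1 (-1)) = 1 := by
  nth_rewrite 1 [sElt_mul_torusElt]
  rw [mul_assoc, ← mul_assoc (sElt k), sElt_mul_self, one_mul, torusElt_mul]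
  simp [torusElt_one]

omit [NeZero (2 : k)] in
variable (k) in
theorem sElt_torusElt_ne_one : sElt k * torusElt 1 (-1) ≠ 1 := by
  intro h
  have := congrArg (fun g : autGroup k => (g e₁).fst 0 0) h
  simp [sElt_zorn, torusElt_zorn, zorn_fst00] at this

omit [NeZero (2 : k)] in
variable (k) in
theorem hasType_sElt_torusElt : HasType (sElt k * torusElt 1 (-1)) (-1) (-1) := by
  refine ⟨zorn 0 0 ![1, 0, 0] ![-1, 0, 0], zorn 0 0 ![0, 0, 1] ![0, 0, -1],
    ⟨mul_self_of_nrm ?_ ?_, mul_self_of_nrm ?_ ?_, ?_, ?_, ?_⟩, ?_, ?_⟩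
  · simp [tr_zorn]
  · simp [nrm_zorn, dotProduct, Fin.sum_univ_three]
  · simp [tr_zorn]
  · simp [nrm_zorn, dotProduct, Fin.sum_univ_three]
  · simp [tr_zorn]
  · simp [tr_zorn]
  · simp [bil_zorn, dotProduct, Fin.sum_univ_three]
  · rw [aut_mul_apply, torusElt_zorn, sElt_zorn]
    congr 1 <;> ext i <;> fin_cases i <;> simp
  · rw [aut_mul_apply, torusElt_zorn, sElt_zorn]
    congr 1 <;> ext i <;> fin_cases i <;> simp

variable (k) in
theorem theta_eq : theta k =
    MulAut.conj (baseChange (algebraMap k (AlgebraicClosure k)) (sElt k)) := by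
  rw [baseChange_sElt, theta]

variable (k) in
theorem thetaTwist_eq : thetaTwist k =
    MulAut.conj (baseChange (algebraMap k (AlgebraicClosure k)) (sElt k * torusElt 1 (-1))) := by
  rw [map_mul, baseChange_sElt, baseChange_torusElt_neg_one, map_mul, thetaTwist, theta]

theorem classType_theta (h : IsKInvolution k (theta k)) : ClassType (isoClass h) 1 1 :=
  classType_isoClass one_ne_zero one_ne_zero sElt_mul_self (sElt_ne_one k) (hasType_sElt k)
    (theta_eq k) h

theorem classType_thetaTwist (h : IsKInvolution k (thetaTwist k)) :
    ClassType (isoClass h) (-1) (-1) :=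
  classType_isoClass (neg_ne_zero.mpr one_ne_zero) (neg_ne_zero.mpr one_ne_zero)
    (sElt_torusElt_sq k) (sElt_torusElt_ne_one k) (hasType_sElt_torusElt k) (thetaTwist_eq k) h

/-- The forms on pure quaternions of types of distinct classes: if one represents zero and the
other does not, the classes are distinct. -/
theorem ClassType.ne_of_anisotropic {c c' : IsoClasses k} {α β : k} (h : ClassType c 1 1)
    (h' : ClassType c' α β)
    (ha : ∀ r s t : k, α * r ^ 2 + β * s ^ 2 - α * β * t ^ 2 = 0 → r = 0 ∧ s = 0 ∧ t = 0) :
    c ≠ c' := by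
  rintro rfl
  -- The split form r² + s² − t² vanishes at (1, 0, 1).
  obtain ⟨r, s, t, h0, e⟩ := h.form_represents h' (r := 1) (s := 0) (t := 1) (by simp)
  exact h0 (ha r s t (by rw [e]; ring))

variable [PerfectField k]

/-- Perfectness makes the algebraic closure Galois over `k`, as the descent requires. -/
theorem isKInvolution_theta : IsKInvolution k (theta k) :=
  isKInvolution_iff.mpr ⟨_, sElt_mul_self, sElt_ne_one k, theta_eq k⟩

theorem isKInvolution_thetaTwist : IsKInvolution k (thetaTwist k) :=
  isKInvolution_iff.mpr ⟨_, sElt_torusElt_sq k, sElt_torusElt_ne_one k, thetaTwist_eq k⟩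

theorem exists_classType (c : IsoClasses k) : ∃ α β, ClassType c α β := by
  obtain ⟨⟨θ, hθ⟩, rfl⟩ := Quotient.exists_rep c
  obtain ⟨g, hg, hg1, rfl⟩ := isKInvolution_iff.mp hθ
  obtain ⟨α, β, hα, hβ, hT⟩ := exists_hasType hg hg1
  exact ⟨α, β, classType_isoClass hα hβ hg hg1 hT rfl hθ⟩

theorem exists_class {α β : k} (hα : α ≠ 0) (hβ : β ≠ 0) : ∃ c : IsoClasses k, ClassType c α β := by
  obtain ⟨g, hg, hg1, hT⟩ := exists_involution_hasType hα hβ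
  have h := isKInvolution_iff (K := AlgebraicClosure k) |>.mpr ⟨g, hg, hg1, rfl⟩
  exact ⟨isoClass h, classType_isoClass hα hβ hg hg1 hT rfl h⟩

end IsoClasses

end SplitOctonion

namespace SplitOctonion

/-! ### Squares and primitive vectors over the p-adic numbers -/

section PadicSquares

variable {p : ℕ} [Fact p.Prime]

theorem PadicInt.exists_sq_eq {a c : ℤ_[p]} (h : ‖a ^ 2 - c‖ < ‖2 * a‖ ^ 2) :
    ∃ z : ℤ_[p], z ^ 2 = c := by
  obtain ⟨z, hz, -⟩ := hensels_lemma (R := ℤ_[p]) (F := Polynomial.X ^ 2 - Polynomial.C c) (a := a)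
    (by simpa [show (1 : ℤ_[p]) + 1 = 2 from one_add_one_eq_two] using h)
  exact ⟨z, by simpa [sub_eq_zero] using hz⟩

theorem PadicInt.toZMod_eq_zero_iff {x : ℤ_[p]} : PadicInt.toZMod x = 0 ↔ ‖x‖ < 1 := by
  rw [← RingHom.mem_ker, PadicInt.ker_toZMod, IsLocalRing.mem_maximalIdeal, PadicInt.mem_nonunits]

theorem PadicInt.toZMod_eq_zero_iff_dvd {x : ℤ_[p]} : PadicInt.toZMod x = 0 ↔ (p : ℤ_[p]) ∣ x := by
  rw [PadicInt.toZMod_eq_zero_iff, PadicInt.norm_lt_one_iff_dvd]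

theorem PadicInt.toZMod_ne_zero_iff {x : ℤ_[p]} : PadicInt.toZMod x ≠ 0 ↔ ‖x‖ = 1 := by
  rw [Ne, PadicInt.toZMod_eq_zero_iff, not_lt]
  exact ⟨fun h => le_antisymm (PadicInt.norm_le_one x) h, fun h => h.ge⟩

theorem PadicInt.toZMod_surjective : Function.Surjective (PadicInt.toZMod (p := p)) :=
  ZMod.ringHom_surjective _

theorem PadicInt.norm_two (hp : 2 < p) : ‖(2 : ℤ_[p])‖ = 1 := by
  rw [← PadicInt.toZMod_ne_zero_iff, map_ofNat]
  intro h
  have h' : ((2 : ℕ) : ZMod p) = 0 := by exact_mod_cast h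
  rw [ZMod.natCast_eq_zero_iff] at h'
  exact absurd (Nat.le_of_dvd (by norm_num) h') (by omega)

theorem PadicInt.exists_sq_eq_of_toZMod (hp : 2 < p) {c : ℤ_[p]} {y : ZMod p} (hy : y ≠ 0)
    (h : PadicInt.toZMod c = y ^ 2) : ∃ z : ℤ_[p], z ^ 2 = c := by
  obtain ⟨x, rfl⟩ := PadicInt.toZMod_surjective y
  refine PadicInt.exists_sq_eq (a := x) ?_
  rw [norm_mul, PadicInt.norm_two hp, PadicInt.toZMod_ne_zero_iff.mp hy]
  have : ‖x ^ 2 - c‖ < 1 := by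
    rw [← PadicInt.toZMod_eq_zero_iff, map_sub, map_pow, h, sub_self]
  simpa using this

/-- Up to squares, a nonzero `p`-adic number is a unit or `p` times a unit. -/
theorem Padic.exists_mul_sq_eq {x : ℚ_[p]} (hx : x ≠ 0) : ∃ u : ℤ_[p], ‖u‖ = 1 ∧
    ∃ r : ℚ_[p], r ≠ 0 ∧ (x * r ^ 2 = u ∨ x * r ^ 2 = p * u) := by
  have hp0 : (p : ℚ_[p]) ≠ 0 := by exact_mod_cast (Fact.out : p.Prime).ne_zero
  have hn : ‖x * (p : ℚ_[p]) ^ (-x.valuation)‖ = 1 := by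
    have hp0' : (p : ℝ) ≠ 0 := by exact_mod_cast (Fact.out : p.Prime).ne_zero
    rw [norm_mul, Padic.norm_p_zpow, Padic.norm_eq_zpow_neg_valuation hx, ← zpow_add₀ hp0']
    simp
  refine ⟨⟨_, hn.le⟩, hn, ?_⟩
  rcases Int.even_or_odd' x.valuation with ⟨m, hm | hm⟩
  · refine ⟨(p : ℚ_[p]) ^ (-m), zpow_ne_zero _ hp0, Or.inl ?_⟩
    change _ = x * (p : ℚ_[p]) ^ (-x.valuation)
    rw [← zpow_natCast, ← zpow_mul, hm]
    congr 2
    push_cast; ring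
  · refine ⟨(p : ℚ_[p]) ^ (-m), zpow_ne_zero _ hp0, Or.inr ?_⟩
    change _ = (p : ℚ_[p]) * (x * (p : ℚ_[p]) ^ (-x.valuation))
    rw [← zpow_natCast, ← zpow_mul, hm, mul_left_comm, ← zpow_one_add₀ hp0]
    congr 2
    push_cast; ring

/-- A nonzero vector of `p`-adic numbers has a multiple that is integral with a coordinate equal
to one. -/
theorem Padic.exists_primitive {n : ℕ} {v : Fin n → ℚ_[p]} (hv : v ≠ 0) :
    ∃ (w : Fin n → ℤ_[p]) (c : ℚ_[p]), (∀ i, (w i : ℚ_[p]) = c * v i) ∧ ∃ i, w i = 1 := by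
  obtain ⟨j, hj⟩ := Function.ne_iff.mp hv
  have : Nonempty (Fin n) := ⟨j⟩
  obtain ⟨i, hi⟩ := Finite.exists_max fun i => ‖v i‖
  have hi0 : v i ≠ 0 := by
    intro h
    have := hi j
    rw [h, norm_zero] at this
    exact hj (norm_le_zero_iff.mp this)
  have hle : ∀ l, ‖(v i)⁻¹ * v l‖ ≤ 1 := by
    intro l
    rw [norm_mul, norm_inv, inv_mul_le_one₀ (norm_pos_iff.mpr hi0)]
    exact hi l
  refine ⟨fun l => ⟨(v i)⁻¹ * v l, hle l⟩, (v i)⁻¹, fun l => rfl, i, ?_⟩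
  apply PadicInt.ext
  exact inv_mul_cancel₀ hi0

end PadicSquares

/-! ### Complex, finite and real base fields -/

section SimpleFields

theorem Nat.card_isoClasses_eq_one {k : Type*} [Field k] [NeZero (2 : k)] [PerfectField k]
    (h : ∀ (c : IsoClasses k) (α β : k), ClassType c α β → ClassType c 1 1) :
    Nat.card (IsoClasses k) = 1 := by
  rw [Nat.card_eq_one_iff_unique]
  refine ⟨⟨fun c c' => ?_⟩, ⟨isoClass isKInvolution_theta⟩⟩
  obtain ⟨α, β, hc⟩ := exists_classType c
  obtain ⟨α', β', hc'⟩ := exists_classType c'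
  exact (h _ _ _ hc).eq (h _ _ _ hc')

theorem card_isoClasses_complex : Nat.card (IsoClasses ℂ) = 1 :=
  Nat.card_isoClasses_eq_one fun c α β h => h.one_one_of_isSquare (by
    obtain ⟨z, hz⟩ := IsAlgClosed.exists_pow_nat_eq α (n := 2) (by norm_num)
    exact ⟨z, by rw [← hz, sq]⟩)

theorem card_isoClasses_zmod (p : ℕ) [Fact p.Prime] (hp : 2 < p) :
    Nat.card (IsoClasses (ZMod p)) = 1 := by
  have h2 : NeZero (2 : ZMod p) := ⟨fun h => by
    have h' : ((2 : ℕ) : ZMod p) = 0 := by exact_mod_cast h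
    rw [ZMod.natCast_eq_zero_iff] at h'
    exact absurd (Nat.le_of_dvd (by norm_num) h') (by omega)⟩
  refine Nat.card_isoClasses_eq_one fun c α β h => ?_
  have hodd : Fintype.card (ZMod p) % 2 = 1 := by
    rw [ZMod.card]
    exact ((Fact.out : p.Prime).eq_two_or_odd).resolve_left (by omega)
  -- Over a finite field of odd order αr² + βs² = αβ is solvable, which is an isotropic vector with
  -- t = 1.
  obtain ⟨r, s, e⟩ := FiniteField.exists_root_sum_quadratic
    (f := Polynomial.C α * Polynomial.X ^ 2)
    (g := Polynomial.C β * Polynomial.X ^ 2 + Polynomial.C (-(α * β)))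
    (Polynomial.degree_C_mul_X_pow 2 h.1)
    (by
      rw [Polynomial.degree_add_eq_left_of_degree_lt] <;>
        rw [Polynomial.degree_C_mul_X_pow 2 h.2.1]
      · rfl
      · exact lt_of_le_of_lt Polynomial.degree_C_le (by decide)) hodd
  simp only [Polynomial.eval_add, Polynomial.eval_mul, Polynomial.eval_C, Polynomial.eval_X,
    Polynomial.eval_pow] at e
  exact h.one_one_of_isotropic (r := r) (s := s) (t := 1) (by simp) (by linear_combination e)

theorem anisotropic_of_sum_squares {k : Type*} [Field k] [LinearOrder k] [IsStrictOrderedRing k]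
    {a b : k} (ha : 0 < a) (hb : 0 < b) (r s t : k)
    (h : -a * r ^ 2 + -b * s ^ 2 - -a * -b * t ^ 2 = 0) : r = 0 ∧ s = 0 ∧ t = 0 := by
  have h1 : 0 ≤ a * r ^ 2 := by positivity
  have h2 : 0 ≤ b * s ^ 2 := by positivity
  have h3 : 0 ≤ a * b * t ^ 2 := by positivity
  have e1 : a * r ^ 2 = 0 := by linarith
  have e2 : b * s ^ 2 = 0 := by linarith
  have e3 : a * b * t ^ 2 = 0 := by linarith
  refine ⟨?_, ?_, ?_⟩
  · simpa [ha.ne'] using e1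
  · simpa [hb.ne'] using e2
  · simpa [ha.ne', hb.ne'] using e3

theorem isoClasses_real (c : IsoClasses ℝ) : ClassType c 1 1 ∨ ClassType c (-1) (-1) := by
  obtain ⟨α, β, h⟩ := exists_classType c
  rcases lt_or_gt_of_ne h.1 with hα | hα
  · rcases lt_or_gt_of_ne h.2.1 with hβ | hβ
    · right
      have key : ∀ x : ℝ, x < 0 → x * (√(-x))⁻¹ ^ 2 = -1 ∧ (√(-x))⁻¹ ≠ 0 := by
        intro x hx
        refine ⟨?_, inv_ne_zero (Real.sqrt_pos.mpr (by linarith)).ne'⟩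
        rw [inv_pow, Real.sq_sqrt (by linarith)]
        have := hx.ne
        field_simp
      have h' := (h.mul_sq_left (key α hα).2).mul_sq_right (key β hβ).2
      rwa [(key α hα).1, (key β hβ).1] at h'
    · left
      exact h.symm.one_one_of_isSquare ⟨√β, (Real.mul_self_sqrt hβ.le).symm⟩
  · left
    exact h.one_one_of_isSquare ⟨√α, (Real.mul_self_sqrt hα.le).symm⟩

end SimpleFields

/-! ### The p-adic numbers for odd p -/

section OddPadic

variable {p : ℕ} [Fact p.Prime]

/-- The equation is solvable in the residue field, and Hensel's lemma lifts whichever of r, s is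
nonzero there. -/
theorem exists_norm_eq (hp : 2 < p) {v w : ℤ_[p]} (hv : ‖v‖ = 1) (hw : ‖w‖ = 1) :
    ∃ r s : ℤ_[p], r ^ 2 - v * s ^ 2 = w := by
  have hv0 := PadicInt.toZMod_ne_zero_iff.mpr hv
  have hw0 := PadicInt.toZMod_ne_zero_iff.mpr hw
  have hodd : Fintype.card (ZMod p) % 2 = 1 := by
    rw [ZMod.card]
    exact ((Fact.out : p.Prime).eq_two_or_odd).resolve_left (by omega)
  obtain ⟨r, s, e⟩ := FiniteField.exists_root_sum_quadratic
    (f := Polynomial.C 1 * Polynomial.X ^ 2 + Polynomial.C (-PadicInt.toZMod w))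
    (g := Polynomial.C (-PadicInt.toZMod v) * Polynomial.X ^ 2)
    (by
      rw [Polynomial.degree_add_eq_left_of_degree_lt] <;>
        rw [Polynomial.degree_C_mul_X_pow 2 one_ne_zero]
      · rfl
      · exact lt_of_le_of_lt Polynomial.degree_C_le (by decide))
    (Polynomial.degree_C_mul_X_pow 2 (neg_ne_zero.mpr hv0)) hodd
  simp only [Polynomial.eval_add, Polynomial.eval_mul, Polynomial.eval_C, Polynomial.eval_X,
    Polynomial.eval_pow] at e
  by_cases hr : r = 0
  · have hs : s ≠ 0 := by
      rintro rfl
      apply hw0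
      rw [hr] at e
      linear_combination -e
    obtain ⟨v', hv'⟩ := PadicInt.isUnit_iff.mpr hv
    have hvi : v * (v'⁻¹ : ℤ_[p]ˣ) = 1 := by rw [← hv']; exact v'.mul_inv
    obtain ⟨z, hz⟩ := PadicInt.exists_sq_eq_of_toZMod hp (c := -(v'⁻¹ : ℤ_[p]ˣ) * w) hs (by
      have h1 := congrArg PadicInt.toZMod hvi
      rw [map_mul, map_one] at h1
      rw [map_mul, map_neg]
      rw [hr] at e
      linear_combination PadicInt.toZMod (v'⁻¹ : ℤ_[p]ˣ).1 * e + s ^ 2 * h1)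
    refine ⟨0, z, ?_⟩
    rw [hz]
    linear_combination w * hvi
  · obtain ⟨s', rfl⟩ := PadicInt.toZMod_surjective s
    obtain ⟨z, hz⟩ := PadicInt.exists_sq_eq_of_toZMod hp (c := w + v * s' ^ 2) hr (by
      rw [map_add, map_mul, map_pow]
      linear_combination -e)
    exact ⟨z, s', by rw [hz]; ring⟩

theorem exists_nonsquare_unit (hp : 2 < p) : ∃ u : ℤ_[p], ¬IsSquare (PadicInt.toZMod u) := by
  obtain ⟨a, ha⟩ := FiniteField.exists_nonsquare (F := ZMod p) (by
    rw [ZMod.ringChar_zmod_n]; omega)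
  obtain ⟨u, rfl⟩ := PadicInt.toZMod_surjective a
  exact ⟨u, ha⟩

theorem norm_eq_one_of_nonsquare {u : ℤ_[p]} (hu : ¬IsSquare (PadicInt.toZMod u)) : ‖u‖ = 1 := by
  rw [← PadicInt.toZMod_ne_zero_iff]
  intro h
  exact hu (by rw [h]; exact IsSquare.zero)

/-- In a primitive solution the first coordinate is divisible by p. After dividing by p, the other
two satisfy s² = ut² modulo p, so they are divisible as well because u is a nonsquare. -/
theorem anisotropic_odd {u : ℤ_[p]} (hu : ¬IsSquare (PadicInt.toZMod u)) (r s t : ℚ_[p])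
    (h : (u : ℚ_[p]) * r ^ 2 + p * s ^ 2 - u * p * t ^ 2 = 0) : r = 0 ∧ s = 0 ∧ t = 0 := by
  by_contra hne
  have hv : ![r, s, t] ≠ 0 := by
    intro h0
    exact hne ⟨congrFun h0 0, congrFun h0 1, congrFun h0 2⟩
  have hp0 : (p : ℤ_[p]) ≠ 0 := by exact_mod_cast (Fact.out : p.Prime).ne_zero
  obtain ⟨w, c, hw, i, hi⟩ := Padic.exists_primitive hv
  have e : u * w 0 ^ 2 + p * w 1 ^ 2 - u * p * w 2 ^ 2 = 0 := by
    apply PadicInt.ext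
    push_cast
    rw [hw, hw, hw]
    simp only [Matrix.cons_val]
    linear_combination c ^ 2 * h
  have hp1 : PadicInt.toZMod (p : ℤ_[p]) = 0 := by simp
  have hu0 := PadicInt.toZMod_ne_zero_iff.mpr (norm_eq_one_of_nonsquare hu)
  have h0 : PadicInt.toZMod (w 0) = 0 := by
    have := congrArg PadicInt.toZMod e
    simp only [map_sub, map_add, map_mul, map_pow, hp1, map_zero] at this
    have h' : PadicInt.toZMod u * PadicInt.toZMod (w 0) ^ 2 = 0 := by linear_combination this
    exact pow_eq_zero_iff (two_ne_zero) |>.mp ((mul_eq_zero.mp h').resolve_left hu0)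
  obtain ⟨w', hw'⟩ := PadicInt.toZMod_eq_zero_iff_dvd.mp h0
  have e' : u * p * w' ^ 2 + w 1 ^ 2 - u * w 2 ^ 2 = 0 := by
    apply mul_left_cancel₀ hp0
    rw [hw'] at e
    linear_combination e
  have e2 := congrArg PadicInt.toZMod e'
  simp only [map_sub, map_add, map_mul, map_pow, hp1, map_zero] at e2
  have h2 : PadicInt.toZMod (w 2) = 0 := by
    by_contra h2
    refine hu ⟨PadicInt.toZMod (w 1) / PadicInt.toZMod (w 2), ?_⟩
    field_simp
    linear_combination -e2
  have h1 : PadicInt.toZMod (w 1) = 0 := by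
    rw [h2] at e2
    exact pow_eq_zero_iff (two_ne_zero) |>.mp (by linear_combination e2)
  have hall : ∀ j, PadicInt.toZMod (w j) = 0 := by
    intro j
    rcases fin_three_cases j with rfl | rfl | rfl
    · exact h0
    · exact h1
    · exact h2
  have := hall i
  rw [hi, map_one] at this
  exact one_ne_zero this

theorem ClassType.exists_unit_left {c : IsoClasses ℚ_[p]} {α β : ℚ_[p]} (h : ClassType c α β) :
    ∃ (v : ℤ_[p]) (β' : ℚ_[p]), ‖v‖ = 1 ∧ ClassType c v β' := by
  have hp0 : (p : ℚ_[p]) ≠ 0 := by exact_mod_cast (Fact.out : p.Prime).ne_zero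
  obtain ⟨u, hu, r, hr, e⟩ := Padic.exists_mul_sq_eq h.1
  obtain ⟨w, hw, s, hs, e'⟩ := Padic.exists_mul_sq_eq h.2.1
  have h1 := (h.mul_sq_left hr).mul_sq_right hs
  rcases e with e | e
  · rw [e] at h1
    exact ⟨u, _, hu, h1⟩
  rcases e' with e' | e'
  · rw [e'] at h1
    exact ⟨w, _, hw, h1.symm⟩
  rw [e, e'] at h1
  have hu0 : (u : ℚ_[p]) ≠ 0 := fun h => h1.1 (by rw [h, mul_zero])
  -- When both parameters are p times a unit, multiplying the second by minus the first gives p²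
  -- times a unit.
  have h2 := (h1.mul_norm (r := 0) (s := 1) (by simpa using ⟨(Fact.out : p.Prime).ne_zero, by simpa using hu0⟩)).mul_sq_right
    (inv_ne_zero hp0)
  refine ⟨-(w * u), p * u, by rw [norm_neg, norm_mul, hu, hw, one_mul], ?_⟩
  have e3 : (p : ℚ_[p]) * w * (0 ^ 2 - p * u * 1 ^ 2) * (p : ℚ_[p])⁻¹ ^ 2 = ((-(w * u) : ℤ_[p]) : ℚ_[p]) := by
    push_cast
    field_simp
    ring
  rw [e3] at h2
  exact h2.symm

theorem PadicInt.isSquare_of_toZMod (hp : 2 < p) {v : ℤ_[p]} (hv : ‖v‖ = 1)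
    (h : IsSquare (PadicInt.toZMod v)) : IsSquare v := by
  obtain ⟨y, hy⟩ := h
  obtain ⟨z, hz⟩ := PadicInt.exists_sq_eq_of_toZMod hp (c := v) (y := y) (by
    rintro rfl
    exact PadicInt.toZMod_ne_zero_iff.mpr hv (by rw [hy, mul_zero])) (by rw [hy, sq])
  exact ⟨z, by rw [← hz, sq]⟩

/-- Once the first parameter is a nonsquare unit, every unit is a value of its norm form, so the
second becomes 1 or p. Two nonsquare units differ by a square, so the first can be taken to be u. -/
theorem isoClasses_odd (hp : 2 < p) {u : ℤ_[p]} (hu : ¬IsSquare (PadicInt.toZMod u))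
    (c : IsoClasses ℚ_[p]) : ClassType c 1 1 ∨ ClassType c u p := by
  obtain ⟨α, β, h⟩ := exists_classType c
  obtain ⟨v, β', hv, h⟩ := h.exists_unit_left
  by_cases hs : IsSquare (PadicInt.toZMod v)
  · left
    obtain ⟨z, hz⟩ := PadicInt.isSquare_of_toZMod hp hv hs
    exact h.one_one_of_isSquare ⟨z, by rw [hz, PadicInt.coe_mul]⟩
  have hu1 := norm_eq_one_of_nonsquare hu
  have hu0 := PadicInt.toZMod_ne_zero_iff.mpr hu1
  have hv0 := PadicInt.toZMod_ne_zero_iff.mpr hv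
  obtain ⟨w, hw, r, hr, e⟩ := Padic.exists_mul_sq_eq h.2.1
  have h1 := h.mul_sq_right hr
  obtain ⟨w', hw'⟩ := PadicInt.isUnit_iff.mpr hw
  have hwi : w * (w'⁻¹ : ℤ_[p]ˣ) = 1 := by rw [← hw']; exact w'.mul_inv
  have hwi' : (w : ℚ_[p]) * ((w'⁻¹ : ℤ_[p]ˣ) : ℤ_[p]) = 1 := by
    rw [← PadicInt.coe_mul, hwi, PadicInt.coe_one]
  obtain ⟨a, b, hab⟩ := exists_norm_eq hp hv (w := (w'⁻¹ : ℤ_[p]ˣ))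
    (PadicInt.isUnit_iff.mp (w'⁻¹).isUnit)
  have hab' : (a : ℚ_[p]) ^ 2 - v * (b : ℚ_[p]) ^ 2 = ((w'⁻¹ : ℤ_[p]ˣ) : ℤ_[p]) := by
    rw [← hab]; push_cast; ring
  have h2 := h1.mul_norm (r := a) (s := b) (by
    rw [hab']
    intro h0
    rw [h0, mul_zero] at hwi'
    exact zero_ne_one hwi')
  rw [hab'] at h2
  rcases e with e | e
  · left
    rw [e, hwi'] at h2
    exact h2.symm.one_one_of_left
  · right
    rw [e, mul_assoc, hwi', mul_one] at h2
    have hq : IsSquare (PadicInt.toZMod (u * v)) := by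
      rw [map_mul]
      have hF : ringChar (ZMod p) ≠ 2 := by rw [ZMod.ringChar_zmod_n]; omega
      rw [← quadraticChar_one_iff_isSquare (mul_ne_zero hu0 hv0), map_mul,
        quadraticChar_neg_one_iff_not_isSquare.mpr hu,
        quadraticChar_neg_one_iff_not_isSquare.mpr hs]
      norm_num
    obtain ⟨z, hz⟩ := PadicInt.isSquare_of_toZMod hp (by rw [norm_mul, hu1, hv, one_mul]) hq
    have hz' : (u : ℚ_[p]) * v = z * z := by
      rw [← PadicInt.coe_mul, hz, PadicInt.coe_mul]
    have hz0 : (z : ℚ_[p]) ≠ 0 := by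
      intro h0
      rw [h0, mul_zero] at hz'
      have := congrArg norm hz'
      rw [norm_mul, norm_zero] at this
      rw [show ‖(u : ℚ_[p])‖ = 1 from hu1, show ‖(v : ℚ_[p])‖ = 1 from hv] at this
      norm_num at this
    have h3 := h2.mul_sq_left (r := z / v) (div_ne_zero hz0 h2.1)
    rwa [show (v : ℚ_[p]) * (z / v) ^ 2 = u by
      have := h2.1
      field_simp
      linear_combination -hz'] at h3

theorem card_isoClasses_padic (hp : 2 < p) : Nat.card (IsoClasses ℚ_[p]) = 2 := by
  have hp0 : (p : ℚ_[p]) ≠ 0 := by exact_mod_cast (Fact.out : p.Prime).ne_zero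
  obtain ⟨u, hu⟩ := exists_nonsquare_unit hp
  have hu0 : (u : ℚ_[p]) ≠ 0 := by
    intro h
    have := norm_eq_one_of_nonsquare hu
    rw [show ‖u‖ = ‖(u : ℚ_[p])‖ from rfl, h, norm_zero] at this
    exact zero_ne_one this
  obtain ⟨c₁, h₁⟩ := exists_class (k := ℚ_[p]) one_ne_zero one_ne_zero
  obtain ⟨c₂, h₂⟩ := exists_class hu0 hp0
  rw [Nat.card_eq_two_iff]
  refine ⟨c₁, c₂, h₁.ne_of_anisotropic h₂ (anisotropic_odd hu), ?_⟩
  ext c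
  simp only [Set.mem_insert_iff, Set.mem_singleton_iff, Set.mem_univ, iff_true]
  rcases isoClasses_odd hp hu c with h | h
  · exact Or.inl (h.eq h₁)
  · exact Or.inr (h.eq h₂)

end OddPadic

end SplitOctonion

namespace SplitOctonion

/-! ### The dyadic numbers -/

section DyadicField

theorem PadicInt.exists_sq_eq_of_dyadic {c : ℤ_[2]} (h : ‖1 - c‖ ≤ (2 : ℝ) ^ (-3 : ℤ)) :
    ∃ z : ℤ_[2], z ^ 2 = c := by
  refine PadicInt.exists_sq_eq (a := 1) ?_
  have h2 : ‖(2 : ℤ_[2])‖ = 2⁻¹ := by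
    have := PadicInt.norm_p (p := 2)
    exact_mod_cast this
  rw [one_pow, mul_one, h2]
  refine lt_of_le_of_lt h ?_
  norm_num

theorem isSquare_intCast_dyadic {n : ℤ} (h : n % 8 = 1 ∨ n % 32 = 4) : IsSquare (n : ℚ_[2]) := by
  have key : ∀ m : ℤ, m % 8 = 1 → IsSquare (m : ℚ_[2]) := by
    intro m hm
    obtain ⟨z, hz⟩ := PadicInt.exists_sq_eq_of_dyadic (c := (m : ℤ_[2])) (by
      have := (PadicInt.norm_int_le_pow_iff_dvd (p := 2) (k := 1 - m) (n := 3)).mpr (by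
        norm_num; omega)
      push_cast at this
      exact this)
    refine ⟨z, ?_⟩
    rw [← PadicInt.coe_mul, ← sq, hz]
    simp
  rcases h with h | h
  · exact key n h
  · obtain ⟨m, rfl⟩ : ∃ m, n = 2 * 2 * m := ⟨n / 4, by omega⟩
    obtain ⟨q, hq⟩ := key m (by omega)
    refine ⟨2 * q, ?_⟩
    push_cast
    rw [hq]
    ring

/-- Representatives of the square classes of the field of dyadic numbers. -/
def dyadicReps : List ℤ := [1, 3, 5, 7, 2, 6, 10, 14]

theorem exists_mul_sq_mem_dyadicReps {x : ℚ_[2]} (hx : x ≠ 0) :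
    ∃ r : ℚ_[2], r ≠ 0 ∧ ∃ a ∈ dyadicReps, x * r ^ 2 = a := by
  have unit : ∀ u : ℤ_[2], ‖u‖ = 1 → ∃ s : ℚ_[2], s ≠ 0 ∧
      ∃ n : ℕ, (n = 1 ∨ n = 3 ∨ n = 5 ∨ n = 7) ∧ (u : ℚ_[2]) * s ^ 2 = n := by
    intro u hu
    have hlt : u.appr 3 < 8 := by simpa using PadicInt.appr_lt u 3
    have hspec : ‖u - u.appr 3‖ ≤ (2 : ℝ) ^ (-3 : ℤ) := by
      have := (PadicInt.norm_le_pow_iff_mem_span_pow _ 3).mpr (PadicInt.appr_spec 3 u)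
      exact_mod_cast this
    generalize u.appr 3 = n at hlt hspec
    have hn1 : ‖(n : ℤ_[2])‖ = 1 := by
      have h1 : ‖u - n‖ < ‖u‖ := by
        rw [hu]; exact lt_of_le_of_lt hspec (by norm_num)
      have := PadicInt.norm_eq_of_norm_add_lt_left (z1 := u) (z2 := -(n : ℤ_[2])) (by
        rwa [← sub_eq_add_neg])
      rw [← norm_neg, ← this, hu]
    have hodd : n % 2 = 1 := by
      by_contra h
      have hd : ((2 : ℕ) : ℤ_[2]) ∣ (n : ℤ_[2]) := by
        obtain ⟨m, rfl⟩ : 2 ∣ n := by omega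
        exact ⟨m, by push_cast; ring⟩
      rw [← PadicInt.norm_lt_one_iff_dvd, hn1] at hd
      exact lt_irrefl _ hd
    -- With n the residue of u modulo 8, un ≡ n² ≡ 1 modulo 8, so un is a square and u has the
    -- square class of n.
    have hsq : ‖1 - u * n‖ ≤ (2 : ℝ) ^ (-3 : ℤ) := by
      have e : 1 - u * n = ((1 - (n : ℤ) ^ 2 : ℤ) : ℤ_[2]) + -((u - n) * n) := by push_cast; ring
      rw [e]
      refine (PadicInt.nonarchimedean _ _).trans (max_le ?_ ?_)
      · refine (PadicInt.norm_int_le_pow_iff_dvd (p := 2) (n := 3)).mpr ?_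
        have : n = 1 ∨ n = 3 ∨ n = 5 ∨ n = 7 := by omega
        rcases this with rfl | rfl | rfl | rfl <;> norm_num
      · rw [norm_neg, norm_mul, hn1, mul_one]; exact hspec
    obtain ⟨z, hz⟩ := PadicInt.exists_sq_eq_of_dyadic hsq
    have hz' : (z : ℚ_[2]) ^ 2 = u * n := by
      rw [← PadicInt.coe_pow, hz]; push_cast; ring
    have hu0 : (u : ℚ_[2]) ≠ 0 := by
      intro h
      have : ‖(u : ℚ_[2])‖ = 1 := hu
      rw [h, norm_zero] at this
      exact zero_ne_one this
    have hn0 : (n : ℚ_[2]) ≠ 0 := by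
      have : n ≠ 0 := by omega
      exact_mod_cast this
    have hz0 : (z : ℚ_[2]) ≠ 0 := by
      intro h
      rw [h] at hz'
      exact mul_ne_zero hu0 hn0 (by rw [← hz']; ring)
    refine ⟨n / z, div_ne_zero hn0 hz0, n, by omega, ?_⟩
    field_simp
    rw [hz']
  obtain ⟨u, hu, r, hr, e⟩ := Padic.exists_mul_sq_eq hx
  obtain ⟨s, hs, n, hn, hun⟩ := unit u hu
  rcases e with e | e
  · refine ⟨r * s, mul_ne_zero hr hs, n, ?_, ?_⟩
    · rcases hn with rfl | rfl | rfl | rfl <;> decide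
    · rw [mul_pow, ← mul_assoc, e, hun]; norm_cast
  · refine ⟨r * s, mul_ne_zero hr hs, 2 * n, ?_, ?_⟩
    · rcases hn with rfl | rfl | rfl | rfl <;> decide
    · rw [mul_pow, ← mul_assoc, e, mul_assoc, hun]; push_cast; ring

/-- For each pair of square classes the pure form is either isotropic or has a value that is minus a
dyadic square. Hence the type is split or can be given first parameter −1. -/
theorem dyadicReps_form : ∀ a ∈ dyadicReps, ∀ b ∈ dyadicReps, ∃ r ∈ [(0 : ℤ), 1, 2, 3],
    ∃ s ∈ [(0 : ℤ), 1, 2, 3], ∃ t ∈ [(0 : ℤ), 1, 2, 3], ¬(r = 0 ∧ s = 0 ∧ t = 0) ∧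
    ((a * r ^ 2 + b * s ^ 2 - a * b * t ^ 2) = 0 ∨
      (-(a * r ^ 2 + b * s ^ 2 - a * b * t ^ 2)) % 8 = 1 ∨
      (-(a * r ^ 2 + b * s ^ 2 - a * b * t ^ 2)) % 32 = 4) := by
  decide

/-- With first parameter −1 the norm form is a sum of two squares; multiplying by one of its values
brings the second parameter to a square or minus a square. -/
theorem dyadicReps_norm : ∀ b ∈ dyadicReps, ∃ s ∈ [(0 : ℤ), 1, 2, 3], ∃ r ∈ [(0 : ℤ), 1],
    ((b * (r ^ 2 + s ^ 2)) % 8 = 1 ∨ (b * (r ^ 2 + s ^ 2)) % 32 = 4) ∨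
    ((-(b * (r ^ 2 + s ^ 2))) % 8 = 1 ∨ (-(b * (r ^ 2 + s ^ 2))) % 32 = 4) := by
  decide

theorem isoClasses_dyadic (c : IsoClasses ℚ_[2]) : ClassType c 1 1 ∨ ClassType c (-1) (-1) := by
  obtain ⟨α, β, h⟩ := exists_classType c
  obtain ⟨x, hx, a, ha, ea⟩ := exists_mul_sq_mem_dyadicReps h.1
  obtain ⟨y, hy, b, hb, eb⟩ := exists_mul_sq_mem_dyadicReps h.2.1
  have h1 := (h.mul_sq_left hx).mul_sq_right hy
  rw [ea, eb] at h1
  obtain ⟨r, -, s, -, t, -, h0, hv⟩ := dyadicReps_form a ha b hb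
  rcases hv with hv | hv
  · left
    refine h1.one_one_of_isotropic (r := r) (s := s) (t := t) (by exact_mod_cast h0) ?_
    exact_mod_cast hv
  obtain ⟨z, hz⟩ := isSquare_intCast_dyadic hv
  push_cast at hz
  have hz0 : z ≠ 0 := by
    rintro rfl
    have h2 : (-(a * r ^ 2 + b * s ^ 2 - a * b * t ^ 2) : ℤ) = 0 := by
      have : ((-(a * r ^ 2 + b * s ^ 2 - a * b * t ^ 2) : ℤ) : ℚ_[2]) = 0 := by
        push_cast; rw [hz]; ring
      exact_mod_cast this
    omega
  obtain ⟨β', h2⟩ := h1.exists_left (α' := -1) (r / z) (s / z) (t / z) (by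
    field_simp
    linear_combination -hz) (neg_ne_zero.mpr one_ne_zero)
  obtain ⟨w, hw, d, hd, ed⟩ := exists_mul_sq_mem_dyadicReps h2.2.1
  have h3 := h2.mul_sq_right hw
  rw [ed] at h3
  obtain ⟨s', -, r', -, hn⟩ := dyadicReps_norm d hd
  have hne : d * (r' ^ 2 + s' ^ 2) ≠ 0 := by
    rcases hn with hn | hn <;> omega
  have hne' : ((d * (r' ^ 2 + s' ^ 2) : ℤ) : ℚ_[2]) ≠ 0 := by exact_mod_cast hne
  have h4 := h3.mul_norm (r := r') (s := s') (by
    intro h5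
    apply hne'
    push_cast
    linear_combination (d : ℚ_[2]) * h5)
  have e4 : (d : ℚ_[2]) * ((r' : ℚ_[2]) ^ 2 - -1 * (s' : ℚ_[2]) ^ 2) =
      ((d * (r' ^ 2 + s' ^ 2) : ℤ) : ℚ_[2]) := by push_cast; ring
  rw [e4] at h4
  rcases hn with hn | hn
  · exact Or.inl (h4.symm.one_one_of_isSquare (isSquare_intCast_dyadic hn))
  · right
    obtain ⟨q, hq⟩ := isSquare_intCast_dyadic hn
    have hq0 : q ≠ 0 := by
      rintro rfl
      apply hne'
      rw [Int.cast_neg, mul_zero] at hq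
      linear_combination -hq
    have h5 := h4.mul_sq_right (inv_ne_zero hq0)
    rwa [show ((d * (r' ^ 2 + s' ^ 2) : ℤ) : ℚ_[2]) * q⁻¹ ^ 2 = -1 by
      rw [Int.cast_neg] at hq
      field_simp
      linear_combination -hq] at h5

/-- Three squares with sum 0 modulo 4 cannot include the square of 1, but a primitive solution has a
coordinate equal to 1. -/
theorem anisotropic_dyadic (r s t : ℚ_[2])
    (h : -1 * r ^ 2 + -1 * s ^ 2 - -1 * -1 * t ^ 2 = 0) : r = 0 ∧ s = 0 ∧ t = 0 := by
  by_contra hne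
  have hv : ![r, s, t] ≠ 0 := by
    intro h0
    exact hne ⟨congrFun h0 0, congrFun h0 1, congrFun h0 2⟩
  obtain ⟨w, c, hw, i, hi⟩ := Padic.exists_primitive hv
  have e : w 0 ^ 2 + w 1 ^ 2 + w 2 ^ 2 = 0 := by
    apply PadicInt.ext
    push_cast
    rw [hw, hw, hw]
    simp only [Matrix.cons_val]
    linear_combination -c ^ 2 * h
  have key : ∀ x y z : ZMod (2 ^ 2), x ^ 2 + y ^ 2 + z ^ 2 = 0 → x ≠ 1 ∧ y ≠ 1 ∧ z ≠ 1 := by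
    decide
  have e' := congrArg (PadicInt.toZModPow 2) e
  rw [map_add, map_add, map_pow, map_pow, map_pow, map_zero] at e'
  have hi' : PadicInt.toZModPow 2 (w i) = 1 := by rw [hi, map_one]
  obtain ⟨k0, k1, k2⟩ := key _ _ _ e'
  rcases fin_three_cases i with rfl | rfl | rfl
  · exact k0 hi'
  · exact k1 hi'
  · exact k2 hi'

end DyadicField

/-! ### A third quaternion algebra over ℚ -/

section Rationals

theorem form_ne_two (r s t : ℚ) : r ^ 2 + 3 * s ^ 2 + 3 * t ^ 2 ≠ 2 := by
  intro h
  have key : ∀ x y : ZMod 3, x ^ 2 = 2 * y ^ 2 → x = 0 ∧ y = 0 := by decide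
  have key' : ∀ x y : ZMod 3, x ^ 2 + y ^ 2 = 0 → x = 0 ∧ y = 0 := by decide
  have : Fact (Nat.Prime 3) := ⟨Nat.prime_three⟩
  -- Homogenising by a fourth coordinate allows a 3-adic descent: as 2 is a nonsquare modulo 3, the
  -- first and last coordinates are divisible by 3, and after division so are the middle two,
  -- because −1 is also a nonsquare.
  have hv : ![(r : ℚ_[3]), s, t, 1] ≠ 0 := fun h0 => one_ne_zero (congrFun h0 3)
  have h' : (r : ℚ_[3]) ^ 2 + 3 * (s : ℚ_[3]) ^ 2 + 3 * (t : ℚ_[3]) ^ 2 = 2 := by exact_mod_cast h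
  obtain ⟨w, c, hw, i, hi⟩ := Padic.exists_primitive hv
  have e : w 0 ^ 2 + 3 * w 1 ^ 2 + 3 * w 2 ^ 2 = 2 * w 3 ^ 2 := by
    apply PadicInt.ext
    have c2 : ((2 : ℤ_[3]) : ℚ_[3]) = 2 := rfl
    have c3 : ((3 : ℤ_[3]) : ℚ_[3]) = 3 := rfl
    push_cast
    rw [hw, hw, hw, hw, c2, c3]
    simp only [Matrix.cons_val]
    linear_combination c ^ 2 * h'
  have h30 : PadicInt.toZMod (3 : ℤ_[3]) = 0 := by
    rw [map_ofNat]; rfl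
  have e1 := congrArg PadicInt.toZMod e
  simp only [map_add, map_mul, map_pow, h30, zero_mul, add_zero, map_ofNat] at e1
  obtain ⟨k0, k3⟩ := key _ _ e1
  obtain ⟨a, ha⟩ := PadicInt.toZMod_eq_zero_iff_dvd.mp k0
  obtain ⟨d, hd⟩ := PadicInt.toZMod_eq_zero_iff_dvd.mp k3
  have e2 : w 1 ^ 2 + w 2 ^ 2 = 3 * (2 * d ^ 2 - a ^ 2) := by
    have h3 : (3 : ℤ_[3]) ≠ 0 := by norm_num
    apply mul_left_cancel₀ h3
    rw [ha, hd] at e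
    push_cast at e
    linear_combination e
  have e3 := congrArg PadicInt.toZMod e2
  rw [map_add, map_pow, map_pow, map_mul, h30, zero_mul] at e3
  obtain ⟨k1, k2⟩ := key' _ _ e3
  have hi' : PadicInt.toZMod (w i) = 1 := by rw [hi, map_one]
  have hall : PadicInt.toZMod (w i) = 0 := by
    fin_cases i
    · exact k0
    · exact k1
    · exact k2
    · exact k3
  rw [hall] at hi'
  exact zero_ne_one hi'

end Rationals

theorem isoClass_theta_ne_of_anisotropic {k : Type*} [Field k] [NeZero (2 : k)]
    (h₁ : IsKInvolution k (theta k)) (h₂ : IsKInvolution k (thetaTwist k))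
    (ha : ∀ r s t : k, -1 * r ^ 2 + -1 * s ^ 2 - -1 * -1 * t ^ 2 = 0 → r = 0 ∧ s = 0 ∧ t = 0) :
    isoClass h₁ ≠ isoClass h₂ :=
  (classType_theta h₁).ne_of_anisotropic (classType_thetaTwist h₂) ha

end SplitOctonion

theorem mainTheorem1 :
    (∃ (h₁ : SplitOctonion.IsKInvolution ℝ (SplitOctonion.theta ℝ))
        (h₂ : SplitOctonion.IsKInvolution ℝ (SplitOctonion.thetaTwist ℝ)),
      SplitOctonion.isoClass h₁ ≠ SplitOctonion.isoClass h₂ ∧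
      ∀ c : SplitOctonion.IsoClasses ℝ,
        c = SplitOctonion.isoClass h₁ ∨ c = SplitOctonion.isoClass h₂) ∧
    (∃ (h₁ : SplitOctonion.IsKInvolution ℚ_[2] (SplitOctonion.theta ℚ_[2]))
        (h₂ : SplitOctonion.IsKInvolution ℚ_[2] (SplitOctonion.thetaTwist ℚ_[2])),
      SplitOctonion.isoClass h₁ ≠ SplitOctonion.isoClass h₂ ∧
      ∀ c : SplitOctonion.IsoClasses ℚ_[2],
        c = SplitOctonion.isoClass h₁ ∨ c = SplitOctonion.isoClass h₂) ∧
    (∃ (h₁ : SplitOctonion.IsKInvolution ℚ (SplitOctonion.theta ℚ))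
        (h₂ : SplitOctonion.IsKInvolution ℚ (SplitOctonion.thetaTwist ℚ)),
      SplitOctonion.isoClass h₁ ≠ SplitOctonion.isoClass h₂ ∧
      ∃ c : SplitOctonion.IsoClasses ℚ,
        c ≠ SplitOctonion.isoClass h₁ ∧ c ≠ SplitOctonion.isoClass h₂) ∧
    (∀ (p : ℕ) [Fact p.Prime], 2 < p → Nat.card (SplitOctonion.IsoClasses ℚ_[p]) = 2) ∧
    Nat.card (SplitOctonion.IsoClasses ℂ) = 1 ∧
    (∀ (p : ℕ) [Fact p.Prime], 2 < p → Nat.card (SplitOctonion.IsoClasses (ZMod p)) = 1) := by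
  open SplitOctonion in
  refine ⟨⟨isKInvolution_theta, isKInvolution_thetaTwist,
      isoClass_theta_ne_of_anisotropic _ _ (anisotropic_of_sum_squares one_pos one_pos),
      fun c => (isoClasses_real c).imp (fun h => h.eq (classType_theta _))
        fun h => h.eq (classType_thetaTwist _)⟩,
    ⟨isKInvolution_theta, isKInvolution_thetaTwist,
      isoClass_theta_ne_of_anisotropic _ _ anisotropic_dyadic,
      fun c => (isoClasses_dyadic c).imp (fun h => h.eq (classType_theta _))
        fun h => h.eq (classType_thetaTwist _)⟩,
    ⟨isKInvolution_theta, isKInvolution_thetaTwist,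
      isoClass_theta_ne_of_anisotropic _ _ (anisotropic_of_sum_squares one_pos one_pos), ?_⟩,
    fun p _ hp => card_isoClasses_padic hp, card_isoClasses_complex,
    fun p _ hp => card_isoClasses_zmod p hp⟩
  -- The algebra (−1, −3) has a definite pure form, so it is not split. It differs from (−1, −1)
  -- because the pure form of the latter takes the value −2 at (1, 1, 0), which −(r² + 3s² + 3t²)
  -- never takes.
  obtain ⟨c, hc⟩ := SplitOctonion.exists_class (k := ℚ) (α := -1) (β := -3) (by norm_num) (by norm_num)
  refine ⟨c, ?_, ?_⟩
  · refine ((SplitOctonion.classType_theta _).ne_of_anisotropic hc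
      (SplitOctonion.anisotropic_of_sum_squares one_pos three_pos)).symm
  · rintro rfl
    obtain ⟨r, s, t, -, e⟩ := (SplitOctonion.classType_thetaTwist _).form_represents hc
      (r := 1) (s := 1) (t := 0) (by simp)
    exact SplitOctonion.form_ne_two r s t (by linear_combination -e)
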